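/- Let $k$ be a field and $G$ a group with unit $\epsilon$. A 3-cocycle is a map $\Phi:G^3\to k^*$ with $\Phi(e,f,g)\Phi(e,fg,h)\Phi(f,g,h)=\Phi(ef,g,h)\Phi(e,f,gh)$ and $\Phi=1$ whenever one argument is $\epsilon$. A $(kG,\Phi)$-Majid bimodule is a $G$-bigraded space $M=\bigoplus_{g,h\in G}{}^gM^h$ (that is, a $kG$-bicomodule) with linear maps $m\mapsto f.m$ and $m\mapsto m.f$ ($f\in G$), where $\epsilon$ acts as the identity on both sides, $f.{}^gM^h\subseteq{}^{fg}M^{fh}$, ${}^gM^h.f\subseteq{}^{gf}M^{hf}$, and, for $m\in{}^gM^h$, $$e.(f.m)=\tfrac{\Phi(e,f,g)}{\Phi(e,f,h)}(ef).m,\quad (m.e).f=\tfrac{\Phi(h,e,f)}{\Phi(g,e,f)}m.(ef),\quad (e.m).f=\tfrac{\Phi(e,h,f)}{\Phi(e,g,f)}e.(m.f).$$ *The algebras.* The Hopf quiver of $M$ has vertex set $G$, and its arrows from $x$ to $y$ form a basis of ${}^yM^x$. $H(M)$ is the graded Majid algebra on its path coalgebra ($\Delta(p)=\sum_{p=p''p'}p''\otimes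 p'$) with unit $\epsilon$ and reassociator $\Phi$ (extended by $0$ to paths of positive length). Its product is the quantum shuffle product: the unique graded coalgebra map $H(M)\otimes H(M)\to H(M)$ that is the multiplication of $G$ on vertices and the given actions on pairs (vertex, arrow) and (arrow, vertex). $B(M)$ is the smallest sub Majid algebra of $H(M)$ containing $G$ and $M$. *Gauge equivalence of Majid algebras.* A gauge transformation on a Majid algebra $H$ is a convolution-invertible $F:H\otimes H\to k$ with $F(h,1)=F(1,h)=\varepsilon(h)$. $H_F$ is the coalgebra $H$ with the same unit and with $$g\cdot_Fh=F^{-1}(g_1,h_1)\,g_2h_2\,F(g_3,h_3),$$ $$\Phi_F(f,g,h)=F^{-1}(g_1,h_1)F^{-1}(f_1,g_2h_2)\Phi(f_2,g_3,h_3)F(f_3g_4,h_4)F(f_4,g_5).$$ An isomorphism of Majid algebras is a coalgebra isomorphism that preserves product, unit and reassociator. $H$ and $H'$ are gauge equivalent if $H_F\cong H'$ for some $F$; if both contain $kG$, they are gauge equivalent over $G$ if $F$ and the isomorphism can be chosen such that the isomorphism is the identity on $G$. *Gauge equivalence of bimodules.* A gauge transformation on $G$ is a map $F:G^2\to k^*$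 with $F(g,\epsilon)=F(\epsilon,g)=1$. Put $\Phi_F(e,f,g)=\frac{F(e,f)F(ef,g)}{F(e,fg)F(f,g)}\Phi(e,f,g)$, and let $M_F$ be the $(kG,\Phi_F)$-Majid bimodule with the same bigraded space as $M$ and with $f._Fm=\frac{F(f,h)}{F(f,g)}f.m$, $m._Ff=\frac{F(h,f)}{F(g,f)}m.f$ for $m\in{}^gM^h$. A $(kG,\Phi)$-Majid bimodule $M$ and a $(kG,\Phi')$-Majid bimodule $N$ are gauge equivalent if, for some $F$, $\Phi'=\Phi_F$ and $M_F\cong N$. *Collections.* Fix an element $g(C)$ in each conjugacy class $C$ of $G$, with centralizer $Z_C$. Put $M_C={}^{g(C)}M^\epsilon$, with the projective $Z_C$-action $f\triangleright m=(f.m).f^{-1}$. For a gauge transformation $F$ on $G$ put $\mu^F_C(f)=\frac{F(f,f^{-1})}{F(f,g(C))F(fg(C),f^{-1})}$, and let $M^F_C$ be $M_C$ with the action $\mu^F_C(f)\,f\triangleright m$. The collections $(M_C)$ and $(N_C)$ are gauge equivalent if there is an $F$ with $\Phi'=\Phi_F$ and $M^F_C\cong N_C$ as projective representations for all $C$. They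 are uniformly projective equivalent if there are an $F$ with $\Phi'=\Phi_F$ and linear isomorphisms $\phi_C:M_C\to N_C$ such that $f$ acts on $N_C$ as $\mu^F_C(f)\,\phi_C\circ(f\triangleright\cdot)\circ\phi_C^{-1}$, for all $C$ and all $f\in Z_C$. **Theorem.** Let $M$ be a $(kG,\Phi)$-Majid bimodule and $N$ a $(kG,\Phi')$-Majid bimodule. The following are equivalent: 1. $H(M)$ and $H(N)$ are gauge equivalent over $G$. 2. $B(M)$ and $B(N)$ are gauge equivalent over $G$. 3. $M$ and $N$ are gauge equivalent. 4. $(M_C)_C$ and $(N_C)_C$ are gauge equivalent. 5. $(M_C)_C$ and $(N_C)_C$ are uniformly projective equivalent. Moreover, without the requirement that the isomorphism be the identity on $G$: $H(M)$ and $H(N)$ are gauge equivalent if and only if there is an automorphism $\sigma$ of $G$ such that $M$ is gauge equivalent to $\sigma^*N$, and the same criterion holds for $B(M)$ and $B(N)$. Here $\sigma^*N$ is the space $N$ with ${}^g(\sigma^*N)^h={}^{\sigma(g)}N^{\sigma(h)}$, with $f$ acting as $\sigma(f)$ on both sides, and with the 3-cocycle $\Phi'\circ\sigma^{\times3}$.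 -/

import Mathlib

open scoped TensorProduct

noncomputable section

namespace Majid

universe u v

open TensorProduct

/-! ### Three-cocycles and gauge transformations on a group -/

/-- A normalized 3-cocycle on `G` with values in `k^*`. -/
structure Cocycle3 (k : Type u) (G : Type v) [Field k] [Group G] where
  toFun : G → G → G → kˣ
  cocycle : ∀ e f g h : G,
    toFun e f g * toFun e (f * g) h * toFun f g h = toFun (e * f) g h * toFun e f (g * h)
  map_one_left : ∀ e f : G, toFun 1 e f = 1
  map_one_mid : ∀ e f : G, toFun e 1 f = 1
  map_one_right : ∀ e f : G, toFun e f 1 = 1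

instance (k : Type u) (G : Type v) [Field k] [Group G] :
    CoeFun (Cocycle3 k G) (fun _ => G → G → G → kˣ) := ⟨Cocycle3.toFun⟩

/-- A gauge transformation on the group `G`: a normalized 2-cochain with values in `k^*`. -/
structure GroupGauge (k : Type u) (G : Type v) [Field k] [Group G] where
  toFun : G → G → kˣ
  map_one_left : ∀ g : G, toFun 1 g = 1
  map_one_right : ∀ g : G, toFun g 1 = 1

instance (k : Type u) (G : Type v) [Field k] [Group G] :
    CoeFun (GroupGauge k G) (fun _ => G → G → kˣ) := ⟨GroupGauge.toFun⟩

section group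

variable {k : Type u} {G : Type v} [Field k] [Group G]

/-- The 3-cocycle `Φ_F = Φ ∂F`. -/
def Cocycle3.twist (Φ : Cocycle3 k G) (F : GroupGauge k G) : Cocycle3 k G where
  toFun e f g := F e f * F (e * f) g / (F e (f * g) * F f g) * Φ e f g
  cocycle e f g h := by
    have := Φ.cocycle e f g h
    simp only [mul_assoc] at this ⊢
    generalize Φ.toFun e f g = a at *
    generalize Φ.toFun e (f * g) h = b at *
    generalize Φ.toFun f g h = c at *
    generalize Φ.toFun (e * f) g h = d at *
    generalize Φ.toFun e f (g * h) = x at *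
    rw [Units.ext_iff] at this ⊢
    push_cast at this ⊢
    field_simp
    linear_combination this
  map_one_left e f := by simp [Φ.map_one_left, F.map_one_left]
  map_one_mid e f := by simp [Φ.map_one_mid, F.map_one_left, F.map_one_right]
  map_one_right e f := by simp [Φ.map_one_right, F.map_one_right]

/-- The pullback of a 3-cocycle along an automorphism of `G`. -/
def Cocycle3.pullback (Φ : Cocycle3 k G) (σ : G ≃* G) : Cocycle3 k G where
  toFun e f g := Φ (σ e) (σ f) (σ g)
  cocycle e f g h := by simpa using Φ.cocycle (σ e) (σ f) (σ g) (σ h)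
  map_one_left e f := by simp [Φ.map_one_left]
  map_one_mid e f := by simp [Φ.map_one_mid]
  map_one_right e f := by simp [Φ.map_one_right]

/-- The function `Φ̃(e,f,g)` governing the conjugation action. -/
def Cocycle3.tilde (Φ : Cocycle3 k G) (e f g : G) : kˣ :=
  Φ e f g * Φ (e * f) f⁻¹ e⁻¹ * Φ e (f * g) f⁻¹ / (Φ (e * f * g) f⁻¹ e⁻¹ * Φ e f f⁻¹)

end group

/-! ### Majid bimodules over `(kG, Φ)` -/

/-- A `(kG, Φ)`-Majid bimodule structure on the vector space `M`. The `kG`-bicomodule structure is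
recorded as the `G`-bigrading `M = ⨁ ^gM^h`, where `comp (g, h)` is the isotypic component
`^gM^h = {m | δ_L m = g ⊗ m, δ_R m = m ⊗ h}`; `lact f m = f.m` and `ract f m = m.f`. -/
structure Bimodule {k : Type u} {G : Type v} [Field k] [Group G] (Φ : Cocycle3 k G)
    (M : Type*) [AddCommGroup M] [Module k M] where
  comp : G × G → Submodule k M
  indep : iSupIndep comp
  span : iSup comp = ⊤
  lact : G → M →ₗ[k] M
  ract : G → M →ₗ[k] M
  lact_mem : ∀ {f g h : G} {m : M}, m ∈ comp (g, h) → lact f m ∈ comp (f * g, f * h)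
  ract_mem : ∀ {f g h : G} {m : M}, m ∈ comp (g, h) → ract f m ∈ comp (g * f, h * f)
  one_lact : ∀ m : M, lact 1 m = m
  one_ract : ∀ m : M, ract 1 m = m
  lact_lact : ∀ {g h : G} (e f : G) {m : M}, m ∈ comp (g, h) →
    lact e (lact f m) = (Φ e f g / Φ e f h) • lact (e * f) m
  ract_ract : ∀ {g h : G} (e f : G) {m : M}, m ∈ comp (g, h) →
    ract f (ract e m) = (Φ h e f / Φ g e f) • ract (e * f) m
  ract_lact : ∀ {g h : G} (e f : G) {m : M}, m ∈ comp (g, h) →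
    ract f (lact e m) = (Φ e h f / Φ e g f) • lact e (ract f m)

namespace Bimodule

variable {k : Type u} {G : Type v} [Field k] [Group G]

/-- `P` and `Q` are isomorphic Majid bimodules (the condition makes sense for bimodules over
any two 3-cocycles; it is only used when these agree). -/
def IsIso {Φ Ψ : Cocycle3 k G} {M N : Type*} [AddCommGroup M] [Module k M]
    [AddCommGroup N] [Module k N] (P : Bimodule Φ M) (Q : Bimodule Ψ N) : Prop :=
  ∃ φ : M ≃ₗ[k] N, (∀ p m, m ∈ P.comp p ↔ φ m ∈ Q.comp p) ∧
    (∀ f m, φ (P.lact f m) = Q.lact f (φ m)) ∧ (∀ f m, φ (P.ract f m) = Q.ract f (φ m))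

variable {Φ Ψ : Cocycle3 k G} {M N : Type*} [AddCommGroup M] [Module k M]
    [AddCommGroup N] [Module k N]

lemma hom_ext (P : Bimodule Φ M) {V : Type*} [AddCommGroup V] [Module k V] {a b : M →ₗ[k] V}
    (h : ∀ p, ∀ m ∈ P.comp p, a m = b m) : a = b := by
  have : iSup P.comp ≤ LinearMap.eqLocus a b := iSup_le fun p m hm => h p m hm
  rw [P.span] at this
  ext m
  exact this trivial

/-- A fixed basis of `M` consisting of bihomogeneous elements; the elements of degree `(y, x)` will
be the arrows from `x` to `y` of the Hopf quiver. -/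
def basis (P : Bimodule Φ M) :
    Module.Basis (Σ p : G × G, Module.Basis.ofVectorSpaceIndex k (P.comp p)) k M :=
  letI := Classical.decEq (G × G)
  (DirectSum.isInternal_submodule_of_iSupIndep_of_iSup_eq_top P.indep P.span).collectedBasis
    (fun p => Module.Basis.ofVectorSpace k (P.comp p))

lemma basis_apply (P : Bimodule Φ M) (p : G × G)
    (e : Module.Basis.ofVectorSpaceIndex k (P.comp p)) :
    P.basis ⟨p, e⟩ = ((e : P.comp p) : M) := by
  classical
  simp [basis]

lemma basis_mem (P : Bimodule Φ M) (p : G × G)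
    (e : Module.Basis.ofVectorSpaceIndex k (P.comp p)) : P.basis ⟨p, e⟩ ∈ P.comp p := by
  rw [basis_apply]
  exact Subtype.property _

/-- Linear identities on `^gM^h` may be checked on the chosen basis elements. -/
lemma comp_ext (P : Bimodule Φ M) {V : Type*} [AddCommGroup V] [Module k V] {a b : M →ₗ[k] V}
    {p : G × G} (h : ∀ e, a (P.basis ⟨p, e⟩) = b (P.basis ⟨p, e⟩)) {m : M} (hm : m ∈ P.comp p) :
    a m = b m := by
  have : a ∘ₗ (P.comp p).subtype = b ∘ₗ (P.comp p).subtype := by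
    refine (Module.Basis.ofVectorSpace k (P.comp p)).ext fun e => ?_
    have := h e
    rw [basis_apply] at this
    simpa using this
  exact LinearMap.congr_fun this ⟨m, hm⟩

/-- The linear map acting on `^gM^h` as multiplication by the scalar `c (g, h)`. -/
def diag (P : Bimodule Φ M) (c : G × G → kˣ) : M →ₗ[k] M :=
  P.basis.constr k fun a => c a.1 • P.basis a

lemma diag_apply (P : Bimodule Φ M) (c : G × G → kˣ) {p : G × G} {m : M} (hm : m ∈ P.comp p) :
    P.diag c m = c p • m :=
  P.comp_ext (a := P.diag c) (b := (c p : k) • LinearMap.id)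
    (fun e => by simp [diag, Module.Basis.constr_basis, Units.smul_def]) hm

lemma eq_of_comp (P : Bimodule Φ M) {V : Type*} [AddCommGroup V] [Module k V] (a b : M →ₗ[k] V)
    (h : ∀ p, ∀ m ∈ P.comp p, a m = b m) (m : M) : a m = b m := by
  rw [P.hom_ext h]

/-- The `(kG, Φ_F)`-Majid bimodule `M_F`: same space and bicomodule structure, with
`f ._F m = F(f,h)/F(f,g) f.m` and `m ._F f = F(h,f)/F(g,f) m.f` for `m ∈ ^gM^h`. -/
def twist (P : Bimodule Φ M) (F : GroupGauge k G) : Bimodule (Φ.twist F) M where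
  comp := P.comp
  indep := P.indep
  span := P.span
  lact f := P.lact f ∘ₗ P.diag fun p => F f p.2 / F f p.1
  ract f := P.ract f ∘ₗ P.diag fun p => F p.2 f / F p.1 f
  lact_mem {f g h m} hm := by
    simp only [LinearMap.comp_apply, P.diag_apply _ hm, Units.smul_def, map_smul]
    exact Submodule.smul_mem _ _ (P.lact_mem hm)
  ract_mem {f g h m} hm := by
    simp only [LinearMap.comp_apply, P.diag_apply _ hm, Units.smul_def, map_smul]
    exact Submodule.smul_mem _ _ (P.ract_mem hm)
  one_lact := P.eq_of_comp (P.lact 1 ∘ₗ P.diag fun p => F 1 p.2 / F 1 p.1) LinearMap.id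
    fun p m hm => by simp [P.diag_apply _ hm, P.one_lact, F.map_one_left]
  one_ract := P.eq_of_comp (P.ract 1 ∘ₗ P.diag fun p => F p.2 1 / F p.1 1) LinearMap.id
    fun p m hm => by simp [P.diag_apply _ hm, P.one_ract, F.map_one_right]
  lact_lact {g h} e f {m} hm := by
    simp only [LinearMap.comp_apply, P.diag_apply _ hm, Units.smul_def, map_smul,
      P.diag_apply _ (P.lact_mem hm), P.lact_lact e f hm, smul_smul]
    congr 1
    simp only [Cocycle3.twist]
    push_cast
    field_simp
  ract_ract {g h} e f {m} hm := by
    simp only [LinearMap.comp_apply, P.diag_apply _ hm, Units.smul_def, map_smul,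
      P.diag_apply _ (P.ract_mem hm), P.ract_ract e f hm, smul_smul]
    congr 1
    simp only [Cocycle3.twist]
    push_cast
    field_simp
  ract_lact {g h} e f {m} hm := by
    simp only [LinearMap.comp_apply, P.diag_apply _ hm, Units.smul_def, map_smul,
      P.diag_apply _ (P.ract_mem hm), P.diag_apply _ (P.lact_mem hm), P.ract_lact e f hm, smul_smul]
    congr 1
    simp only [Cocycle3.twist]
    push_cast
    field_simp

/-- The pullback of a Majid bimodule along an automorphism of `G`. -/
def pullback (P : Bimodule Φ M) (σ : G ≃* G) : Bimodule (Φ.pullback σ) M where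
  comp p := P.comp (σ p.1, σ p.2)
  indep := P.indep.comp (f := fun p : G × G => (σ p.1, σ p.2)) fun p q h => by
    simpa [Prod.ext_iff] using h
  span := by
    rw [← P.span]
    exact (σ.toEquiv.prodCongr σ.toEquiv).iSup_comp (g := P.comp)
  lact f := P.lact (σ f)
  ract f := P.ract (σ f)
  lact_mem hm := by simpa using P.lact_mem hm
  ract_mem hm := by simpa using P.ract_mem hm
  one_lact m := by simp [P.one_lact]
  one_ract m := by simp [P.one_ract]
  lact_lact e f _ hm := by simpa [Cocycle3.pullback] using P.lact_lact (σ e) (σ f) hm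
  ract_ract e f _ hm := by simpa [Cocycle3.pullback] using P.ract_ract (σ e) (σ f) hm
  ract_lact e f _ hm := by simpa [Cocycle3.pullback] using P.ract_lact (σ e) (σ f) hm

/-- Gauge equivalence of Majid bimodules over `G`: `Φ' = Φ_F` and `M_F ≅ N` for some `F`. -/
def GaugeEquiv (P : Bimodule Φ M) (Q : Bimodule Ψ N) : Prop :=
  ∃ F : GroupGauge k G, Ψ = Φ.twist F ∧ (P.twist F).IsIso Q

/-- The conjugation action `f ▷ v = (f.v).f⁻¹`. -/
def conj (P : Bimodule Φ M) (f : G) : M →ₗ[k] M := P.ract f⁻¹ ∘ₗ P.lact f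

lemma conj_mem (P : Bimodule Φ M) {f g : G} {v : M} (hv : v ∈ P.comp (g, 1)) :
    P.conj f v ∈ P.comp (f * g * f⁻¹, 1) := by
  simpa [conj] using P.ract_mem (f := f⁻¹) (P.lact_mem (f := f) hv)

lemma conj_conj (P : Bimodule Φ M) (e f : G) {g : G} {v : M} (hv : v ∈ P.comp (g, 1)) :
    P.conj e (P.conj f v) = Φ.tilde e f g • P.conj (e * f) v := by
  have h1 := P.lact_mem (f := f) hv
  have h2 := P.lact_mem (f := e) h1
  have h3 := P.ract_lact e f⁻¹ h1
  have h4 := P.ract_ract f⁻¹ e⁻¹ h2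
  have h5 := P.lact_lact e f hv
  have h6 : P.lact e (P.ract f⁻¹ (P.lact f v)) =
      (Φ e (f * g) f⁻¹ / Φ e (f * 1) f⁻¹) • P.ract f⁻¹ (P.lact e (P.lact f v)) := by
    rw [h3, smul_smul, div_mul_div_cancel, div_self', one_smul]
  simp only [conj, LinearMap.comp_apply]
  rw [h6]
  simp only [Units.smul_def, map_smul] at h4 h5 ⊢
  rw [h4, h5]
  simp only [map_smul, smul_smul, mul_inv_rev]
  congr 1
  simp only [Cocycle3.tilde, Φ.map_one_right, mul_one, mul_assoc]
  push_cast
  field_simp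

end Bimodule

/-! ### Projective representations and admissible collections -/

/-- An `α`-representation of the group `Z` on `V`: `ρ(1) = id` and `ρ(g)ρ(h) = α(g,h)ρ(gh)`.
(As `α` has values in `k^*`, each `ρ(g)` is automatically invertible.) -/
structure ProjRep {k : Type u} [Field k] {Z : Type*} [Group Z] (α : Z → Z → kˣ)
    (V : Type*) [AddCommGroup V] [Module k V] where
  ρ : Z → V →ₗ[k] V
  map_one : ρ 1 = LinearMap.id
  map_mul : ∀ g h : Z, ρ g ∘ₗ ρ h = α g h • ρ (g * h)

section collections

variable {k : Type u} {G : Type v} [Field k] [Group G]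

/-- Projective equivalence `ρ₂(g) = μ(g) φ ρ₁(g) φ⁻¹` with prescribed `μ`. -/
def ProjRep.ProjEquivVia {Z : Type*} [Group Z] {α β : Z → Z → kˣ} {V W : Type*}
    [AddCommGroup V] [Module k V] [AddCommGroup W] [Module k W] (μ : Z → kˣ)
    (R : ProjRep α V) (S : ProjRep β W) : Prop :=
  ∃ φ : V ≃ₗ[k] W, ∀ g, S.ρ g = μ g • (φ.toLinearMap ∘ₗ R.ρ g ∘ₗ φ.symm.toLinearMap)

/-- Linear equivalence, i.e. isomorphism, of projective representations. -/
def ProjRep.LinEquiv {Z : Type*} [Group Z] {α β : Z → Z → kˣ} {V W : Type*}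
    [AddCommGroup V] [Module k V] [AddCommGroup W] [Module k W]
    (R : ProjRep α V) (S : ProjRep β W) : Prop :=
  ∃ φ : V ≃ₗ[k] W, ∀ g, φ.toLinearMap ∘ₗ R.ρ g = S.ρ g ∘ₗ φ.toLinearMap

/-- The 2-cocycle `Φ̃_g` on the centralizer `Z_g`. -/
def Cocycle3.tildeAt (Φ : Cocycle3 k G) (g : G) (e f : Subgroup.centralizer {g}) : kˣ :=
  Φ.tilde (e : G) (f : G) g

/-- A choice of an element `g(C)` in every conjugacy class `C`. -/
def ClassReps (G : Type v) [Group G] : Type v :=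
  {r : ConjClasses G → G // ∀ C, ConjClasses.mk (r C) = C}

instance (G : Type v) [Group G] : CoeFun (ClassReps G) (fun _ => ConjClasses G → G) :=
  ⟨Subtype.val⟩

/-- A `Φ`-collection on the spaces `V C`: a `Φ̃_C`-representation of `Z_C` for every conjugacy class
`C`, where `Z_C` is the centralizer of `g(C)`. -/
def Collection (Φ : Cocycle3 k G) (r : ClassReps G) (V : ConjClasses G → Type*)
    [∀ C, AddCommGroup (V C)] [∀ C, Module k (V C)] : Type _ :=
  ∀ C, ProjRep (Φ.tildeAt (r C)) (V C)

/-- The scalars `μ^F_g(f) = F(f,f⁻¹) / (F(f,g) F(fg,f⁻¹))`. -/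
def GroupGauge.mu (F : GroupGauge k G) (g : G) (f : Subgroup.centralizer {g}) : kˣ :=
  F (f : G) (f : G)⁻¹ / (F (f : G) g * F ((f : G) * g) (f : G)⁻¹)

lemma GroupGauge.mu_one (F : GroupGauge k G) (g : G) : F.mu g 1 = 1 := by
  simp [GroupGauge.mu, F.map_one_left, F.map_one_right]

lemma GroupGauge.mu_mul (F : GroupGauge k G) (Φ : Cocycle3 k G) (g : G)
    (e f : Subgroup.centralizer {g}) :
    F.mu g e * F.mu g f * Φ.tildeAt g e f = (Φ.twist F).tildeAt g e f * F.mu g (e * f) := by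
  obtain ⟨e, he⟩ := e
  obtain ⟨f, hf⟩ := f
  have he' : e * g = g * e := ((Subgroup.mem_centralizer_singleton_iff).1 he)
  have hf' : f * g = g * f := ((Subgroup.mem_centralizer_singleton_iff).1 hf)
  have h2 : e * f * f⁻¹ = e := by group
  have h3 : e * f * g * f⁻¹ = e * g := by rw [mul_assoc e, hf']; group
  have h4 : f * g * f⁻¹ = g := by rw [hf']; group
  have h5 : e * (f * g) = e * f * g := by group
  simp only [GroupGauge.mu, Cocycle3.tildeAt, Cocycle3.tilde, Cocycle3.twist, Subgroup.coe_mul,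
    mul_inv_rev, h2, h3, h4, h5, F.map_one_right, mul_inv_cancel]
  rw [Units.ext_iff]
  push_cast
  field_simp

/-- The `Φ_F`-collection `(M^F_C)` obtained from a `Φ`-collection `(M_C)`. -/
def Collection.twist {Φ : Cocycle3 k G} {r : ClassReps G} {V : ConjClasses G → Type*}
    [∀ C, AddCommGroup (V C)] [∀ C, Module k (V C)] (A : Collection Φ r V) (F : GroupGauge k G) :
    Collection (Φ.twist F) r V := fun C =>
  { ρ := fun f => F.mu (r C) f • (A C).ρ f
    map_one := by rw [F.mu_one, (A C).map_one, one_smul]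
    map_mul := fun e f => by
      have h := (A C).map_mul e f
      have h' := F.mu_mul Φ (r C) e f
      simp only [LinearMap.ext_iff, LinearMap.comp_apply, LinearMap.smul_apply,
        Units.smul_def, map_smul] at h ⊢
      intro v
      rw [h v, smul_smul, smul_smul, smul_smul, mul_comm (F.mu (r C) f : k)]
      congr 1
      exact_mod_cast h' }

/-- Gauge equivalence of admissible collections. -/
def Collection.GaugeEquiv {Φ Ψ : Cocycle3 k G} {r : ClassReps G} {V W : ConjClasses G → Type*}
    [∀ C, AddCommGroup (V C)] [∀ C, Module k (V C)] [∀ C, AddCommGroup (W C)]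
    [∀ C, Module k (W C)] (A : Collection Φ r V) (B : Collection Ψ r W) : Prop :=
  ∃ F : GroupGauge k G, Ψ = Φ.twist F ∧ ∀ C, (A.twist F C).LinEquiv (B C)

/-- Uniform projective equivalence of a `Φ`-collection and a `Φ'`-collection: for some gauge
transformation `F` with `Φ' = Φ ∂F`, the members are projectively equivalent via the
mappings `μ^F_C`. -/
def Collection.UniformlyProjEquiv {Φ Ψ : Cocycle3 k G} {r : ClassReps G}
    {V W : ConjClasses G → Type*} [∀ C, AddCommGroup (V C)] [∀ C, Module k (V C)]
    [∀ C, AddCommGroup (W C)] [∀ C, Module k (W C)]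
    (A : Collection Φ r V) (B : Collection Ψ r W) : Prop :=
  ∃ F : GroupGauge k G, Ψ = Φ.twist F ∧
    ∀ C, (A C).ProjEquivVia (F.mu (r C)) (B C)

/-- The admissible collection `(M_C)` of a Majid bimodule `M`: `M_C = ^{g(C)}M^ε` with the
conjugation action of `Z_C`. -/
def Bimodule.collection {Φ : Cocycle3 k G} {M : Type*} [AddCommGroup M] [Module k M]
    (P : Bimodule Φ M) (r : ClassReps G) :
    Collection Φ r (fun C => P.comp (r C, 1)) := fun C =>
  { ρ := fun f => (P.conj (f : G)).restrict fun v hv => by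
      have h := P.conj_mem (f := (f : G)) hv
      have h' : (f : G) * r C = r C * f := (Subgroup.mem_centralizer_singleton_iff).1 f.2
      rwa [h', mul_inv_cancel_right] at h
    map_one := by
      ext v
      simp [Bimodule.conj, P.one_lact, P.one_ract]
    map_mul := fun e f => by
      ext v
      have := P.conj_conj (e : G) (f : G) v.2
      simpa [Cocycle3.tildeAt, Units.smul_def] using this }

end collections

/-! ### Majid algebras and their gauge equivalence -/

section majidAlgebra

variable {k : Type*} [Field k]

/-- Convolution of a linear functional with a linear map: `c ↦ φ(c₁) f(c₂)`. -/
def convL {C V : Type*} [AddCommGroup C] [Module k C] [Coalgebra k C] [AddCommGroup V] [Module k V]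
    (φ : C →ₗ[k] k) (f : C →ₗ[k] V) : C →ₗ[k] V :=
  (TensorProduct.lid k V).toLinearMap ∘ₗ TensorProduct.map φ f ∘ₗ Coalgebra.comul

/-- Convolution of a linear map with a linear functional: `c ↦ f(c₁) φ(c₂)`. -/
def convR {C V : Type*} [AddCommGroup C] [Module k C] [Coalgebra k C] [AddCommGroup V] [Module k V]
    (f : C →ₗ[k] V) (φ : C →ₗ[k] k) : C →ₗ[k] V :=
  (TensorProduct.rid k V).toLinearMap ∘ₗ TensorProduct.map f φ ∘ₗ Coalgebra.comul

/-- The product, unit and reassociator of a Majid algebra with underlying coalgebra `H`. -/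
structure MajidData (k : Type*) (H : Type*) [Field k] [AddCommGroup H] [Module k H] where
  mul : H →ₗ[k] H →ₗ[k] H
  one : H
  reassoc : H ⊗[k] (H ⊗[k] H) →ₗ[k] k

namespace MajidData

variable {H H' : Type*} [AddCommGroup H] [Module k H] [Coalgebra k H]
  [AddCommGroup H'] [Module k H'] [Coalgebra k H']

/-- The product as a linear map on `H ⊗ H`. -/
def mulT (A : MajidData k H) : H ⊗[k] H →ₗ[k] H := TensorProduct.lift A.mul

/-- A gauge transformation on a Majid algebra: a convolution-invertible `F : H ⊗ H → k` with
`F(h,1) = F(1,h) = ε(h)`. -/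
structure Gauge (A : MajidData k H) where
  F : H ⊗[k] H →ₗ[k] k
  inv : H ⊗[k] H →ₗ[k] k
  conv_inv : convL F inv = Coalgebra.counit
  inv_conv : convL inv F = Coalgebra.counit
  apply_one : ∀ h : H, F (h ⊗ₜ A.one) = Coalgebra.counit (R := k) h
  one_apply : ∀ h : H, F (A.one ⊗ₜ h) = Coalgebra.counit (R := k) h

/-- The twisted product, reassociator (and the old unit): the structure of `H_F`.
The product is `F⁻¹(g₁,h₁) g₂h₂ F(g₃,h₃)`; the reassociator `Φ_F(f,g,h)` is
`F⁻¹(g₁,h₁) F⁻¹(f₁,g₂h₂) Φ(f₂,g₃,h₃) F(f₃g₄,h₄) F(f₄,g₅)`. -/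
def twist (A : MajidData k H) (T : A.Gauge) : MajidData k H where
  mul := TensorProduct.curry (convL T.inv (convR A.mulT T.F))
  one := A.one
  reassoc :=
    convL ((TensorProduct.lid k k).toLinearMap ∘ₗ TensorProduct.map Coalgebra.counit T.inv) <|
    convL (T.inv ∘ₗ TensorProduct.map LinearMap.id A.mulT) <|
    convL A.reassoc <|
    convL (T.F ∘ₗ TensorProduct.map A.mulT LinearMap.id ∘ₗ
      (TensorProduct.assoc k H H H).symm.toLinearMap)
    ((TensorProduct.rid k k).toLinearMap ∘ₗ TensorProduct.map T.F Coalgebra.counit ∘ₗ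
      (TensorProduct.assoc k H H H).symm.toLinearMap)

/-- `ψ` is an isomorphism of Majid algebras: an isomorphism of coalgebras that respects products,
units and reassociators. (Quasi-antipodes are unique up to convolution conjugation, so there is
nothing to require of them.) -/
def IsIso (A : MajidData k H) (A' : MajidData k H') (ψ : H ≃ₗc[k] H') : Prop :=
  (∀ x y, ψ (A.mul x y) = A'.mul (ψ x) (ψ y)) ∧ ψ A.one = A'.one ∧
    ∀ x y z, A'.reassoc (ψ x ⊗ₜ (ψ y ⊗ₜ ψ z)) = A.reassoc (x ⊗ₜ (y ⊗ₜ z))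

/-- Gauge equivalence: `H_F ≅ H'` as Majid algebras for some gauge transformation `F` on `H`. -/
def GaugeEquiv (A : MajidData k H) (A' : MajidData k H') : Prop :=
  ∃ (T : A.Gauge) (ψ : H ≃ₗc[k] H'), (A.twist T).IsIso A' ψ

/-- Gauge equivalence over `G`, for Majid algebras containing `kG` through `ι` and `ι'`: the
isomorphism `H_F ≅ H'` can be taken to be the identity on `G`. -/
def GaugeEquivOver {G : Type*} (ι : G → H) (ι' : G → H') (A : MajidData k H)
    (A' : MajidData k H') : Prop :=
  ∃ (T : A.Gauge) (ψ : H ≃ₗc[k] H'), (A.twist T).IsIso A' ψ ∧ ∀ g, ψ (ι g) = ι' g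

/-- The structure induced on a subspace closed under the product and containing the unit. -/
def restrict (A : MajidData k H) (W : Submodule k H) (h1 : A.one ∈ W)
    (hm : ∀ x ∈ W, ∀ y ∈ W, A.mul x y ∈ W) : MajidData k W where
  mul := LinearMap.mk₂ k (fun x y => ⟨A.mul x y, hm x x.2 y y.2⟩)
    (fun _ _ _ => by ext; simp) (fun _ _ _ => by ext; simp)
    (fun _ _ _ => by ext; simp) (fun _ _ _ => by ext; simp)
  one := ⟨A.one, h1⟩
  reassoc := A.reassoc ∘ₗ
    TensorProduct.map W.subtype (TensorProduct.map W.subtype W.subtype)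

end MajidData

section subcoalgebra

variable {H : Type*} [AddCommGroup H] [Module k H]

lemma map_subtype_injective (W : Submodule k H) :
    Function.Injective (TensorProduct.map W.subtype W.subtype) :=
  TensorProduct.map_injective_of_flat_flat _ _ W.subtype_injective W.subtype_injective

variable [Coalgebra k H]

/-- The comultiplication of a subcoalgebra `W`, i.e. of a subspace with `Δ(W) ⊆ W ⊗ W`. -/
def subComul (W : Submodule k H)
    (hW : ∀ x ∈ W, Coalgebra.comul (R := k) x ∈
      LinearMap.range (TensorProduct.map W.subtype W.subtype)) : W →ₗ[k] W ⊗[k] W :=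
  (LinearEquiv.ofInjective _ (map_subtype_injective W)).symm.toLinearMap ∘ₗ
    (Coalgebra.comul ∘ₗ W.subtype).codRestrict _ (fun x => hW x x.2)

lemma map_subComul (W : Submodule k H)
    (hW : ∀ x ∈ W, Coalgebra.comul (R := k) x ∈
      LinearMap.range (TensorProduct.map W.subtype W.subtype)) (x : W) :
    TensorProduct.map W.subtype W.subtype (subComul W hW x) =
      Coalgebra.comul (R := k) (x : H) := by
  have := LinearEquiv.apply_symm_apply (LinearEquiv.ofInjective _ (map_subtype_injective W))
    ⟨Coalgebra.comul (R := k) (x : H), hW x x.2⟩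
  exact congrArg Subtype.val this

/-- A subcoalgebra is a coalgebra. -/
abbrev subCoalgebra (W : Submodule k H)
    (hW : ∀ x ∈ W, Coalgebra.comul (R := k) x ∈
      LinearMap.range (TensorProduct.map W.subtype W.subtype)) : Coalgebra k W where
  comul := subComul W hW
  counit := Coalgebra.counit ∘ₗ W.subtype
  coassoc := by
    have key : TensorProduct.map W.subtype W.subtype ∘ₗ subComul W hW =
        Coalgebra.comul ∘ₗ W.subtype := LinearMap.ext (map_subComul W hW)
    have inj : Function.Injective
        (TensorProduct.map W.subtype (TensorProduct.map W.subtype W.subtype)) :=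
      TensorProduct.map_injective_of_flat_flat _ _ W.subtype_injective (map_subtype_injective W)
    ext x
    apply inj
    have e1 : ∀ t : W ⊗[k] W, TensorProduct.map W.subtype (TensorProduct.map W.subtype W.subtype)
        (TensorProduct.assoc k W W W ((subComul W hW).rTensor W t)) =
        TensorProduct.assoc k H H H ((Coalgebra.comul (R := k) (A := H)).rTensor H
          (TensorProduct.map W.subtype W.subtype t)) := by
      intro t
      rw [← LinearMap.comp_apply (g := TensorProduct.map W.subtype W.subtype),
        LinearMap.rTensor_comp_map, ← key, TensorProduct.map_map_assoc]
      simp [LinearMap.rTensor, ← LinearMap.comp_apply, ← TensorProduct.map_comp]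
    have e2 : ∀ t : W ⊗[k] W, TensorProduct.map W.subtype (TensorProduct.map W.subtype W.subtype)
        ((subComul W hW).lTensor W t) =
        (Coalgebra.comul (R := k) (A := H)).lTensor H
          (TensorProduct.map W.subtype W.subtype t) := by
      intro t
      rw [← LinearMap.comp_apply (g := TensorProduct.map W.subtype W.subtype),
        LinearMap.lTensor_comp_map, ← key]
      simp [LinearMap.lTensor, ← LinearMap.comp_apply, ← TensorProduct.map_comp]
    simp only [LinearMap.comp_apply, LinearEquiv.coe_coe]
    rw [e1, e2, map_subComul, Coalgebra.coassoc_apply]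
  rTensor_counit_comp_comul := by
    ext x
    have inj : Function.Injective (W.subtype.lTensor k) :=
      Module.Flat.lTensor_preserves_injective_linearMap _ W.subtype_injective
    have e : ∀ t : W ⊗[k] W, W.subtype.lTensor k
        ((Coalgebra.counit (R := k) ∘ₗ W.subtype).rTensor W t) =
        (Coalgebra.counit (R := k) (A := H)).rTensor H
          (TensorProduct.map W.subtype W.subtype t) := by
      intro t
      induction t with
      | zero => simp only [map_zero]
      | tmul a b => rfl
      | add a b ha hb => simp only [map_add, ha, hb]
    apply inj
    rw [LinearMap.comp_apply, e, map_subComul, Coalgebra.rTensor_counit_comul]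
    rfl
  lTensor_counit_comp_comul := by
    ext x
    have inj : Function.Injective (W.subtype.rTensor k) :=
      Module.Flat.rTensor_preserves_injective_linearMap _ W.subtype_injective
    have e : ∀ t : W ⊗[k] W, W.subtype.rTensor k
        ((Coalgebra.counit (R := k) ∘ₗ W.subtype).lTensor W t) =
        (Coalgebra.counit (R := k) (A := H)).lTensor H
          (TensorProduct.map W.subtype W.subtype t) := by
      intro t
      induction t with
      | zero => simp only [map_zero]
      | tmul a b => rfl
      | add a b ha hb => simp only [map_add, ha, hb]
    apply inj
    rw [LinearMap.comp_apply, e, map_subComul, Coalgebra.lTensor_counit_comul]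
    rfl

end subcoalgebra

end majidAlgebra

/-! ### The Hopf quiver and the Majid algebra on its path coalgebra -/

section quiver

variable {k : Type*} {G : Type*} [Field k] [Group G] {Φ : Cocycle3 k G} {M : Type*}
  [AddCommGroup M] [Module k M]

/-- The vertices of the Hopf quiver of a Majid bimodule: the elements of `G`. -/
@[ext] structure HopfQuiver (P : Bimodule Φ M) where
  val : G

/-- The arrows from `x` to `y` are the elements of a basis of `^yM^x`. -/
instance (P : Bimodule Φ M) : Quiver (HopfQuiver P) where
  Hom x y := Module.Basis.ofVectorSpaceIndex k (P.comp (y.val, x.val))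

/-- All the paths of the Hopf quiver: a path together with its source and target. -/
abbrev AllPaths (P : Bimodule Φ M) : Type _ :=
  Σ x : HopfQuiver P, Σ y : HopfQuiver P, Quiver.Path x y

/-- The space of the path coalgebra `kQ`; its elements are finite combinations of paths. -/
def PathSpace (P : Bimodule Φ M) : Type _ := AllPaths P →₀ k

namespace PathSpace

variable (P : Bimodule Φ M)

instance : AddCommGroup (PathSpace P) := inferInstanceAs (AddCommGroup (AllPaths P →₀ k))
instance : Module k (PathSpace P) := inferInstanceAs (Module k (AllPaths P →₀ k))

/-- The basis of paths. -/
def pathBasis : Module.Basis (AllPaths P) k (PathSpace P) := Module.Basis.ofRepr (LinearEquiv.refl k _)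

variable {P}

/-- A path as an element of `kQ`. -/
def path {x y : HopfQuiver P} (p : Quiver.Path x y) : PathSpace P := pathBasis P ⟨x, y, p⟩

/-- A vertex as an element of `kQ`. -/
def vertex (x : HopfQuiver P) : PathSpace P := path (Quiver.Path.nil : Quiver.Path x x)

/-- An arrow as an element of `M`. -/
def arrow {x y : HopfQuiver P} (e : x ⟶ y) : M := P.basis ⟨(y.val, x.val), e⟩

lemma arrow_mem {x y : HopfQuiver P} (e : x ⟶ y) : arrow e ∈ P.comp (y.val, x.val) := P.basis_mem _ _

/-- Extend a function on paths to a linear map. -/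
def lin {V : Type*} [AddCommGroup V] [Module k V]
    (f : ∀ (x y : HopfQuiver P), Quiver.Path x y → V) : PathSpace P →ₗ[k] V :=
  (pathBasis P).constr k fun p => f p.1 p.2.1 p.2.2

@[simp] lemma lin_path {V : Type*} [AddCommGroup V] [Module k V]
    (f : ∀ (x y : HopfQuiver P), Quiver.Path x y → V) {x y : HopfQuiver P} (p : Quiver.Path x y) :
    lin f (path p) = f x y p := by
  simp [lin, path, Module.Basis.constr_basis]

lemma hom_ext {V : Type*} [AddCommGroup V] [Module k V] {a b : PathSpace P →ₗ[k] V}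
    (h : ∀ (x y : HopfQuiver P) (p : Quiver.Path x y), a (path p) = b (path p)) : a = b :=
  (pathBasis P).ext fun p => h p.1 p.2.1 p.2.2

open Classical in
/-- Concatenation with an arrow on the left (i.e. at the target): `p ↦ e p` if the path `p` ends at
the source of `e`, and `p ↦ 0` otherwise. -/
def append {w z : HopfQuiver P} (e : w ⟶ z) : PathSpace P →ₗ[k] PathSpace P :=
  lin fun _ y p => if h : y = w then path ((h ▸ p).cons e) else 0

/-- Concatenation `m p` with an element of `M = kQ_1` on the left. -/
def concat : M →ₗ[k] PathSpace P →ₗ[k] PathSpace P :=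
  P.basis.constr k fun a => append (P := P) (w := ⟨a.1.2⟩) (z := ⟨a.1.1⟩) a.2

/-- The comultiplication on paths: `Δ(p) = ∑ p'' ⊗ p'` over all the factorizations `p = p'' p'`. -/
def comulPath {x : HopfQuiver P} :
    ∀ {y : HopfQuiver P}, Quiver.Path x y → PathSpace P ⊗[k] PathSpace P
  | _, .nil => vertex x ⊗ₜ vertex x
  | y, .cons p e => vertex y ⊗ₜ path (p.cons e) + (append e).rTensor _ (comulPath p)

/-- The product of paths: the quantum shuffle product
`α · β = ∑_d [(dα)_{m+n} . (d̄β)_{m+n}] ⋯ [(dα)_1 . (d̄β)_1]`, sorted by whether the last bracket is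
an arrow of `α` times a vertex or a vertex times an arrow of `β`. -/
def mulPath : ∀ {x y x' y' : HopfQuiver P}, Quiver.Path x y → Quiver.Path x' y' → PathSpace P
  | x, _, x', _, .nil, .nil => vertex ⟨x.val * x'.val⟩
  | x, _, _, _, .nil, .cons q b => concat (P.lact x.val (arrow b)) (mulPath (.nil : Quiver.Path x x) q)
  | _, _, x', _, .cons p a, .nil =>
      concat (P.ract x'.val (arrow a)) (mulPath p (.nil : Quiver.Path x' x'))
  | _, y, _, y', .cons p a, .cons q b =>
      concat (P.ract y'.val (arrow a)) (mulPath p (q.cons b)) +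
        concat (P.lact y.val (arrow b)) (mulPath (p.cons a) q)
termination_by _ _ _ _ p q => p.length + q.length

/-- The product of `H(M)`. -/
def mul : PathSpace P →ₗ[k] PathSpace P →ₗ[k] PathSpace P :=
  lin fun _ _ p => lin fun _ _ q => mulPath p q

@[simp] lemma mul_path {x y x' y' : HopfQuiver P} (p : Quiver.Path x y) (q : Quiver.Path x' y') :
    mul (path p) (path q) = mulPath p q := by
  simp [mul]

lemma append_cons {x w z : HopfQuiver P} (p : Quiver.Path x w) (e : w ⟶ z) :
    append e (path p) = path (p.cons e) := by
  simp [append]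

lemma append_of_ne {x y w z : HopfQuiver P} (p : Quiver.Path x y) (e : w ⟶ z) (h : y ≠ w) :
    append e (path p) = 0 := by
  simp [append, h]

@[simp] lemma concat_arrow {w z : HopfQuiver P} (e : w ⟶ z) : concat (arrow e) = append e := by
  simp [concat, arrow, Module.Basis.constr_basis]

open Classical in
/-- The projection onto the span of the paths ending at `w`. -/
def proj (w : HopfQuiver P) : PathSpace P →ₗ[k] PathSpace P :=
  lin fun _ y p => if y = w then path p else 0

lemma proj_path {x w : HopfQuiver P} (p : Quiver.Path x w) : proj w (path p) = path p := by
  simp [proj]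

lemma proj_of_ne {x y w : HopfQuiver P} (p : Quiver.Path x y) (h : y ≠ w) :
    proj w (path p) = 0 := by
  simp [proj, h]

lemma append_append {u v w z : HopfQuiver P} (b : u ⟶ v) (e : w ⟶ z) (h : v ≠ w) :
    append e ∘ₗ append b = 0 := by
  refine hom_ext fun x y p => ?_
  by_cases hy : y = u
  · subst hy
    simp [append_cons, append_of_ne _ _ h]
  · simp [append_of_ne _ _ hy]

/-- The comultiplication of the path coalgebra. -/
def comul : PathSpace P →ₗ[k] PathSpace P ⊗[k] PathSpace P := lin fun _ _ p => comulPath p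

/-- The counit: `1` on vertices and `0` on paths of positive length. -/
def counit : PathSpace P →ₗ[k] k := lin fun _ _ p => if p.length = 0 then 1 else 0

lemma comul_vertex (x : HopfQuiver P) : comul (vertex x) = vertex x ⊗ₜ vertex x := by
  simp [comul, vertex, comulPath]

lemma comul_cons {x y z : HopfQuiver P} (p : Quiver.Path x y) (e : y ⟶ z) :
    comul (path (p.cons e)) = vertex z ⊗ₜ path (p.cons e) +
      (append e).rTensor _ (comul (path p)) := by
  simp [comul, comulPath]

lemma counit_vertex (x : HopfQuiver P) : counit (vertex x) = 1 := by
  simp [counit, vertex]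

lemma counit_cons {x y z : HopfQuiver P} (p : Quiver.Path x y) (e : y ⟶ z) :
    counit (path (p.cons e)) = 0 := by
  simp [counit]

lemma counit_append {w z : HopfQuiver P} (e : w ⟶ z) : counit ∘ₗ append e = 0 := by
  refine hom_ext fun x y p => ?_
  by_cases hy : y = w
  · subst hy
    simp [append_cons, counit_cons]
  · simp [append_of_ne _ _ hy]

lemma comul_append {w z : HopfQuiver P} (e : w ⟶ z) :
    comul ∘ₗ append e =
      TensorProduct.mk k _ _ (vertex z) ∘ₗ append e + (append e).rTensor _ ∘ₗ comul := by
  refine hom_ext fun x y p => ?_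
  by_cases hy : y = w
  · subst hy
    simp [append_cons, comul_cons]
  · cases p with
    | nil =>
      have h1 : append e (vertex x) = 0 := append_of_ne _ _ hy
      have h2 := comul_vertex x
      simp only [LinearMap.comp_apply, LinearMap.add_apply, append_of_ne _ _ hy, map_zero]
      change 0 = 0 + (append e).rTensor _ (comul (vertex x))
      rw [h2]
      simp [h1]
    | cons p b =>
      have h1 : append e (vertex y) = 0 := append_of_ne _ _ hy
      simp only [LinearMap.comp_apply, LinearMap.add_apply, append_of_ne _ _ hy, map_zero,
        comul_cons, map_add, LinearMap.rTensor_tmul, h1, TensorProduct.zero_tmul, zero_add]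
      rw [← LinearMap.comp_apply, ← LinearMap.rTensor_comp, append_append _ _ hy]
      simp

instance : Coalgebra k (PathSpace P) where
  comul := comul
  counit := counit
  coassoc := by
    refine hom_ext fun x y p => ?_
    induction p with
    | nil =>
      have := comul_vertex x
      simp only [vertex] at this
      simp [this]
    | @cons y z p e ih =>
      simp only [LinearMap.comp_apply, LinearEquiv.coe_coe] at ih ⊢
      rw [comul_cons]
      have e1 : ∀ t : PathSpace P ⊗[k] PathSpace P,
          TensorProduct.assoc k _ _ _ ((comul (P := P)).rTensor _ ((append e).rTensor _ t)) =
          vertex z ⊗ₜ ((append e).rTensor _ t) +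
            (append e).rTensor _ (TensorProduct.assoc k _ _ _ ((comul (P := P)).rTensor _ t)) := by
        intro t
        induction t with
        | zero => simp
        | tmul a b =>
          have := LinearMap.congr_fun (comul_append e) a
          simp only [LinearMap.comp_apply, LinearMap.add_apply, TensorProduct.mk_apply] at this
          simp only [LinearMap.rTensor_tmul, this, TensorProduct.add_tmul, map_add,
            TensorProduct.assoc_tmul]
          congr 1
          generalize comul a = s
          induction s with
          | zero => simp
          | tmul c d => simp
          | add c d hc hd => simp only [map_add, TensorProduct.add_tmul, hc, hd]
        | add a b ha hb => simp only [map_add, TensorProduct.tmul_add, ha, hb]; abel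
      have e2 : ∀ t : PathSpace P ⊗[k] PathSpace P,
          (comul (P := P)).lTensor _ ((append e).rTensor _ t) =
            (append e).rTensor _ ((comul (P := P)).lTensor _ t) := by
        intro t
        rw [← LinearMap.comp_apply, LinearMap.lTensor_comp_rTensor, ← LinearMap.rTensor_comp_lTensor,
          LinearMap.comp_apply]
      simp only [map_add]
      rw [e1, e2, ih]
      simp only [LinearMap.rTensor_tmul, LinearMap.lTensor_tmul, comul_vertex,
        TensorProduct.assoc_tmul, comul_cons, TensorProduct.tmul_add]
      abel
  rTensor_counit_comp_comul := by
    refine hom_ext fun x y p => ?_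
    cases p with
    | nil =>
      have := comul_vertex x
      have h := counit_vertex x
      simp only [vertex] at this h
      simp [this, h]
    | cons p e =>
      simp only [LinearMap.comp_apply, comul_cons, map_add, LinearMap.rTensor_tmul, counit_vertex]
      rw [← LinearMap.comp_apply (f := LinearMap.rTensor _ counit), ← LinearMap.rTensor_comp,
        counit_append]
      simp
  lTensor_counit_comp_comul := by
    refine hom_ext fun x y p => ?_
    induction p with
    | nil =>
      have := comul_vertex x
      have h := counit_vertex x
      simp only [vertex] at this h
      simp [this, h]
    | cons p e ih =>
      simp only [LinearMap.comp_apply] at ih ⊢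
      rw [comul_cons, map_add, LinearMap.lTensor_tmul, counit_cons,
        ← LinearMap.comp_apply (f := LinearMap.lTensor _ counit), LinearMap.lTensor_comp_rTensor,
        ← LinearMap.rTensor_comp_lTensor, LinearMap.comp_apply, ih]
      simp [append_cons]

end PathSpace
variable {P : Bimodule Φ M}

namespace PathSpace

lemma comul_concat {z w : G} {m : M} (hm : m ∈ P.comp (z, w)) (u : PathSpace P) :
    comul (concat m u) =
      vertex ⟨z⟩ ⊗ₜ concat m u + (concat (P := P) m).rTensor _ (comul u) := by
  refine P.comp_ext (a := comul ∘ₗ (concat (P := P)).flip u)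
    (b := TensorProduct.mk k _ _ (vertex ⟨z⟩) ∘ₗ (concat (P := P)).flip u +
      (TensorProduct.map₂ (concat (P := P)) (LinearMap.lsmul k _)).flip (comul u) ∘ₗ
        (TensorProduct.mk k M k).flip 1) (fun e => ?_) hm |>.trans ?_
  · have h := LinearMap.congr_fun (comul_append (P := P) (w := ⟨w⟩) (z := ⟨z⟩) e) u
    have h2 : concat (P.basis ⟨(z, w), e⟩) = append (P := P) (w := ⟨w⟩) (z := ⟨z⟩) e :=
      concat_arrow _
    simp only [LinearMap.comp_apply, LinearMap.add_apply, LinearMap.flip_apply, h2,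
      TensorProduct.mk_apply] at h ⊢
    rw [h]
    congr 1
    generalize comul u = t
    induction t with
    | zero => simp
    | tmul a b => simp [h2]
    | add a b ha hb => simp only [map_add, ha, hb]
  · simp only [LinearMap.comp_apply, LinearMap.add_apply, LinearMap.flip_apply,
      TensorProduct.mk_apply]
    congr 1
    generalize comul u = t
    induction t with
    | zero => simp
    | tmul a b => simp
    | add a b ha hb => simp only [map_add, ha, hb]

lemma mulPath_nil_nil (x x' : HopfQuiver P) :
    mulPath (.nil : Quiver.Path x x) (.nil : Quiver.Path x' x') = vertex ⟨x.val * x'.val⟩ := by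
  rw [mulPath]

lemma mulPath_nil_cons (x : HopfQuiver P) {x' y' z' : HopfQuiver P} (q : Quiver.Path x' y')
    (b : y' ⟶ z') : mulPath (.nil : Quiver.Path x x) (q.cons b) =
      concat (P.lact x.val (arrow b)) (mulPath (.nil : Quiver.Path x x) q) := by
  rw [mulPath]

lemma mulPath_cons_nil {x y z : HopfQuiver P} (p : Quiver.Path x y) (a : y ⟶ z)
    (x' : HopfQuiver P) : mulPath (p.cons a) (.nil : Quiver.Path x' x') =
      concat (P.ract x'.val (arrow a)) (mulPath p (.nil : Quiver.Path x' x')) := by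
  rw [mulPath]

lemma mulPath_cons_cons {x y z x' y' z' : HopfQuiver P} (p : Quiver.Path x y) (a : y ⟶ z)
    (q : Quiver.Path x' y') (b : y' ⟶ z') : mulPath (p.cons a) (q.cons b) =
      concat (P.ract z'.val (arrow a)) (mulPath p (q.cons b)) +
        concat (P.lact z.val (arrow b)) (mulPath (p.cons a) q) := by
  rw [mulPath]

lemma mul_append_append {w z w' z' : HopfQuiver P} (a : w ⟶ z) (b : w' ⟶ z') (u v : PathSpace P) :
    mul (append a u) (append b v) =
      concat (P.ract z'.val (arrow a)) (mul (proj w u) (append b v)) +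
        concat (P.lact z.val (arrow b)) (mul (append a u) (proj w' v)) := by
  have : mul.compl₁₂ (append a) (append b) =
      (mul.compl₁₂ (proj w) (append b)).compr₂ (concat (P.ract z'.val (arrow a))) +
      (mul.compl₁₂ (append a) (proj w')).compr₂ (concat (P.lact z.val (arrow b))) := by
    refine hom_ext fun x y p => hom_ext fun x' y' q => ?_
    simp only [LinearMap.compl₁₂_apply, LinearMap.compr₂_apply, LinearMap.add_apply]
    by_cases hy : y = w
    · subst hy
      by_cases hy' : y' = w'
      · subst hy'
        simp [append_cons, proj_path, mulPath_cons_cons]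
      · simp [append_of_ne _ _ hy', proj_of_ne _ hy']
    · simp [append_of_ne _ _ hy, proj_of_ne _ hy]
  exact LinearMap.congr_fun₂ this u v

lemma mul_append_vertex {w z : HopfQuiver P} (a : w ⟶ z) (x' : HopfQuiver P) (u : PathSpace P) :
    mul (append a u) (vertex x') =
      concat (P.ract x'.val (arrow a)) (mul (proj w u) (vertex x')) := by
  have : mul.flip (vertex x') ∘ₗ append a =
      concat (P.ract x'.val (arrow a)) ∘ₗ mul.flip (vertex x') ∘ₗ proj w := by
    refine hom_ext fun x y p => ?_
    simp only [LinearMap.comp_apply, LinearMap.flip_apply]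
    by_cases hy : y = w
    · subst hy
      simp [append_cons, proj_path, vertex, mulPath_cons_nil]
    · simp [append_of_ne _ _ hy, proj_of_ne _ hy]
  exact LinearMap.congr_fun this u

lemma mul_vertex_append {w z : HopfQuiver P} (x : HopfQuiver P) (b : w ⟶ z) (v : PathSpace P) :
    mul (vertex x) (append b v) =
      concat (P.lact x.val (arrow b)) (mul (vertex x) (proj w v)) := by
  have : mul (vertex x) ∘ₗ append b =
      concat (P.lact x.val (arrow b)) ∘ₗ mul (vertex x) ∘ₗ proj w := by
    refine hom_ext fun x y p => ?_
    simp only [LinearMap.comp_apply]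
    by_cases hy : y = w
    · subst hy
      simp [append_cons, proj_path, vertex, mulPath_nil_cons]
    · simp [append_of_ne _ _ hy, proj_of_ne _ hy]
  exact LinearMap.congr_fun this v

lemma mul_vertex_vertex (x x' : HopfQuiver P) :
    mul (vertex x) (vertex x') = vertex ⟨x.val * x'.val⟩ := by
  rw [← mulPath_nil_nil, ← mul_path]
  rfl

lemma proj_append {w z : HopfQuiver P} (e : w ⟶ z) : proj z ∘ₗ append e = append e := by
  refine hom_ext fun x y p => ?_
  by_cases hy : y = w
  · subst hy
    simp [append_cons, proj_path]
  · simp [append_of_ne _ _ hy]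

lemma proj_comul {x y : HopfQuiver P} (p : Quiver.Path x y) :
    (proj y).rTensor _ (comul (path p)) = comul (path p) := by
  cases p with
  | nil =>
    have := comul_vertex x
    have h : proj x (vertex x) = vertex x := proj_path _
    change (proj x).rTensor _ (comul (vertex x)) = comul (vertex x)
    rw [this, LinearMap.rTensor_tmul, h]
  | cons p e =>
    have h : proj y (vertex y) = vertex y := proj_path _
    rw [comul_cons, map_add, LinearMap.rTensor_tmul, h, ← LinearMap.comp_apply,
      ← LinearMap.rTensor_comp, proj_append]

/-- The product of `kQ ⊗ kQ`. -/
abbrev mul₂ : PathSpace P ⊗[k] PathSpace P →ₗ[k] PathSpace P ⊗[k] PathSpace P →ₗ[k]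
    PathSpace P ⊗[k] PathSpace P := TensorProduct.map₂ mul mul

lemma mul₂_append_append {w z w' z' : HopfQuiver P} (a : w ⟶ z) (b : w' ⟶ z')
    (U V : PathSpace P ⊗[k] PathSpace P) :
    mul₂ ((append a).rTensor _ U) ((append b).rTensor _ V) =
      (concat (P.ract z'.val (arrow a))).rTensor _
        (mul₂ ((proj w).rTensor _ U) ((append b).rTensor _ V)) +
      (concat (P.lact z.val (arrow b))).rTensor _
        (mul₂ ((append a).rTensor _ U) ((proj w').rTensor _ V)) := by
  induction U with
  | zero => simp only [map_zero, LinearMap.zero_apply, add_zero]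
  | add U₁ U₂ h₁ h₂ => simp only [map_add, LinearMap.add_apply, h₁, h₂]; abel
  | tmul c d =>
    induction V with
    | zero => simp only [map_zero, add_zero]
    | add V₁ V₂ h₁ h₂ => simp only [map_add, h₁, h₂]; abel
    | tmul c' d' =>
      simp only [LinearMap.rTensor_tmul, TensorProduct.map₂_apply_tmul, TensorProduct.map_tmul, mul_append_append,
        TensorProduct.add_tmul]

lemma mul₂_append_vertex {w z : HopfQuiver P} (a : w ⟶ z) (x' : HopfQuiver P) (d : PathSpace P)
    (U : PathSpace P ⊗[k] PathSpace P) :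
    mul₂ ((append a).rTensor _ U) (vertex x' ⊗ₜ d) =
      (concat (P.ract x'.val (arrow a))).rTensor _
        (mul₂ ((proj w).rTensor _ U) (vertex x' ⊗ₜ d)) := by
  induction U with
  | zero => simp only [map_zero, LinearMap.zero_apply]
  | add U₁ U₂ h₁ h₂ => simp only [map_add, LinearMap.add_apply, h₁, h₂]
  | tmul c d =>
    simp only [LinearMap.rTensor_tmul, TensorProduct.map₂_apply_tmul, TensorProduct.map_tmul, mul_append_vertex]

lemma mul₂_vertex_append {w z : HopfQuiver P} (b : w ⟶ z) (x : HopfQuiver P) (d : PathSpace P)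
    (U : PathSpace P ⊗[k] PathSpace P) :
    mul₂ (vertex x ⊗ₜ d) ((append b).rTensor _ U) =
      (concat (P.lact x.val (arrow b))).rTensor _
        (mul₂ (vertex x ⊗ₜ d) ((proj w).rTensor _ U)) := by
  induction U with
  | zero => simp only [map_zero]
  | add U₁ U₂ h₁ h₂ => simp only [map_add, h₁, h₂]
  | tmul c d =>
    simp only [LinearMap.rTensor_tmul, TensorProduct.map₂_apply_tmul, TensorProduct.map_tmul, mul_vertex_append]

/-- The product is multiplicative for the comultiplication, on paths. -/
lemma comul_mulPath {x y x' y' : HopfQuiver P} (p : Quiver.Path x y) (q : Quiver.Path x' y') :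
    comul (mulPath p q) = mul₂ (comul (path p)) (comul (path q)) := by
  induction p generalizing y' with
  | nil =>
    induction q with
    | nil =>
      rw [mulPath_nil_nil]
      change _ = mul₂ (comul (vertex x)) (comul (vertex x'))
      simp only [comul_vertex, TensorProduct.map₂_apply_tmul, TensorProduct.map_tmul, mul_vertex_vertex]
    | @cons y' z' q b ih =>
      have hx : comul (path (.nil : Quiver.Path x x)) = vertex x ⊗ₜ vertex x := comul_vertex x
      have hm : mul (vertex x) (path (q.cons b)) = concat (P.lact x.val (arrow b))
          (mulPath (.nil : Quiver.Path x x) q) := by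
        rw [← mulPath_nil_cons, ← mul_path]; rfl
      rw [mulPath_nil_cons, comul_concat (P.lact_mem (arrow_mem b)), ih, comul_cons, map_add, hx,
        mul₂_vertex_append, proj_comul, TensorProduct.map₂_apply_tmul, TensorProduct.map_tmul, mul_vertex_vertex, hm]
  | @cons y z p a ihp =>
    induction q with
    | nil =>
      have hx : comul (path (.nil : Quiver.Path x' x')) = vertex x' ⊗ₜ vertex x' := comul_vertex x'
      have hm : mul (path (p.cons a)) (vertex x') = concat (P.ract x'.val (arrow a))
          (mulPath p (.nil : Quiver.Path x' x')) := by
        rw [← mulPath_cons_nil, ← mul_path]; rfl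
      rw [mulPath_cons_nil, comul_concat (P.ract_mem (arrow_mem a)), ihp, comul_cons, map_add, hx,
        LinearMap.add_apply, mul₂_append_vertex, proj_comul, TensorProduct.map₂_apply_tmul,
        TensorProduct.map_tmul, mul_vertex_vertex, hm]
    | @cons y' z' q b ihq =>
      have hm : mul (path (p.cons a)) (path (q.cons b)) = _ :=
        (mul_path _ _).trans (mulPath_cons_cons p a q b)
      rw [mulPath_cons_cons, map_add, comul_concat (P.ract_mem (arrow_mem a)),
        comul_concat (P.lact_mem (arrow_mem b)), ihp, ihq, comul_cons p a, comul_cons q b]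
      simp only [map_add, LinearMap.add_apply]
      rw [mul₂_append_append, mul₂_append_vertex, mul₂_vertex_append, proj_comul, proj_comul,
        TensorProduct.map₂_apply_tmul, TensorProduct.map_tmul, mul_vertex_vertex, hm]
      simp only [TensorProduct.tmul_add]
      abel

lemma comul_mul (u v : PathSpace P) : comul (mul u v) = mul₂ (comul u) (comul v) := by
  have : (mul (P := P)).compr₂ comul = mul₂.compl₁₂ comul comul := by
    refine hom_ext fun x y p => hom_ext fun x' y' q => ?_
    simp [comul_mulPath]
  exact LinearMap.congr_fun₂ this u v

variable (P) in
/-- The reassociator: `Φ` on vertices, extended by `0` to paths of positive length. -/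
def reassoc : PathSpace P ⊗[k] (PathSpace P ⊗[k] PathSpace P) →ₗ[k] k :=
  TensorProduct.lift <| lin fun x _ p => TensorProduct.lift <| lin fun y _ q => lin fun z _ r =>
    if p.length + q.length + r.length = 0 then (Φ x.val y.val z.val : k) else 0

end PathSpace

variable (P)

/-- The graded Majid algebra `H(M)` on the path coalgebra of the Hopf quiver of `M`. -/
def Bimodule.H : MajidData k (PathSpace P) where
  mul := PathSpace.mul
  one := PathSpace.vertex ⟨1⟩
  reassoc := PathSpace.reassoc P

/-- The underlying space of `B(M)`: the smallest subspace of `H(M)` that is closed under the product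
and contains the vertices and the arrows. It is a subcoalgebra, hence it is the smallest sub Majid
algebra containing `G` and `M`. -/
def Bimodule.BSpace : Submodule k (PathSpace P) :=
  sInf {W | (∀ x : HopfQuiver P, PathSpace.vertex x ∈ W) ∧
    (∀ (x y : HopfQuiver P) (e : x ⟶ y), PathSpace.path e.toPath ∈ W) ∧
    ∀ u ∈ W, ∀ v ∈ W, P.H.mul u v ∈ W}

lemma Bimodule.vertex_mem (x : HopfQuiver P) : PathSpace.vertex x ∈ P.BSpace :=
  Submodule.mem_sInf.2 fun _ hW => hW.1 x

lemma Bimodule.arrow_mem_BSpace {x y : HopfQuiver P} (e : x ⟶ y) :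
    PathSpace.path e.toPath ∈ P.BSpace :=
  Submodule.mem_sInf.2 fun _ hW => hW.2.1 x y e

lemma Bimodule.mul_mem {u v : PathSpace P} (hu : u ∈ P.BSpace) (hv : v ∈ P.BSpace) :
    P.H.mul u v ∈ P.BSpace :=
  Submodule.mem_sInf.2 fun W hW =>
    hW.2.2 u (Submodule.mem_sInf.1 hu W hW) v (Submodule.mem_sInf.1 hv W hW)

lemma Bimodule.comul_mem (u : PathSpace P) (hu : u ∈ P.BSpace) :
    Coalgebra.comul (R := k) u ∈
      LinearMap.range (TensorProduct.map P.BSpace.subtype P.BSpace.subtype) := by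
  have key : ∀ {a b : PathSpace P}, a ∈ P.BSpace → b ∈ P.BSpace → a ⊗ₜ[k] b ∈
      LinearMap.range (TensorProduct.map P.BSpace.subtype P.BSpace.subtype) :=
    fun ha hb => ⟨⟨_, ha⟩ ⊗ₜ ⟨_, hb⟩, rfl⟩
  refine Submodule.mem_sInf.1 hu ((LinearMap.range (TensorProduct.map P.BSpace.subtype
    P.BSpace.subtype)).comap PathSpace.comul) ⟨fun x => ?_, fun x y e => ?_, fun u hu v hv => ?_⟩
  · rw [Submodule.mem_comap, PathSpace.comul_vertex]
    exact key (P.vertex_mem x) (P.vertex_mem x)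
  · have h : PathSpace.comul (PathSpace.path e.toPath) =
        PathSpace.vertex y ⊗ₜ[k] PathSpace.path e.toPath +
          PathSpace.path e.toPath ⊗ₜ[k] PathSpace.vertex x := by
      have h1 := PathSpace.comul_cons (P := P) Quiver.Path.nil e
      have h2 := PathSpace.comul_vertex x
      have h3 := PathSpace.append_cons (P := P) Quiver.Path.nil e
      simp only [PathSpace.vertex] at h2
      rw [h2, LinearMap.rTensor_tmul, h3] at h1
      exact h1
    rw [Submodule.mem_comap, h]
    exact add_mem (key (P.vertex_mem y) (P.arrow_mem_BSpace e))
      (key (P.arrow_mem_BSpace e) (P.vertex_mem x))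
  · rw [Submodule.mem_comap] at hu hv ⊢
    change PathSpace.comul (PathSpace.mul u v) ∈ _
    rw [PathSpace.comul_mul]
    obtain ⟨s, hs⟩ := hu
    obtain ⟨t, ht⟩ := hv
    rw [← hs, ← ht]
    clear hs ht
    induction s with
    | zero => simp
    | add s₁ s₂ h₁ h₂ =>
      simp only [map_add, LinearMap.add_apply]
      exact add_mem h₁ h₂
    | tmul a b =>
      induction t with
      | zero => simp
      | add t₁ t₂ h₁ h₂ =>
        simp only [map_add]
        exact add_mem h₁ h₂
      | tmul c d =>
        simp only [TensorProduct.map_tmul, TensorProduct.map₂_apply_tmul]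
        exact key (P.mul_mem a.2 c.2) (P.mul_mem b.2 d.2)

instance : Coalgebra k P.BSpace := subCoalgebra P.BSpace P.comul_mem

/-- The Majid algebra `B(M)`, generated by `H(M)` in degrees `0` and `1`. -/
def Bimodule.B : MajidData k P.BSpace :=
  P.H.restrict P.BSpace (P.vertex_mem _) fun _ hu _ hv => P.mul_mem hu hv

/-- The inclusion of `G` into `H(M)`. -/
def Bimodule.inclH (g : G) : PathSpace P := PathSpace.vertex ⟨g⟩

/-- The inclusion of `G` into `B(M)`. -/
def Bimodule.inclB (g : G) : P.BSpace := ⟨PathSpace.vertex ⟨g⟩, P.vertex_mem _⟩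

end quiver

end Majid

end

/-!
# Gauge equivalence of the Majid algebras `H(M)` and `B(M)`

The comparison of Majid algebras with bimodules only sees degrees zero and one of the path
coalgebra.

*From algebras to bimodules.* The group-like elements of the path coalgebra are the vertices
(`PathSpace.eq_vertex_of_isGroupLikeElem`), and an element with `Δ u = y ⊗ u + u ⊗ x` for vertices
`x`, `y` is the sum of a combination of vertices and an element of `^yM^x`
(`PathSpace.SkewPrimitive.eq_base_add_incl`). Hence an isomorphism `H_F ≅ H'` permutes the vertices
by an automorphism `σ` of `G` and induces in degree one, modulo vertices, a bigraded bijection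
`M → N` over `σ` (`Realization.arrowPart`). Up to vertices, the twisted product of a vertex with an
arrow is the old one multiplied by the scalar of the twisted bimodule, so that this bijection is an
isomorphism of bimodules from the twist of `M` by the restriction of `F` to `G`
(`Realization.gaugeEquiv_pullback`). The argument applies to every subcoalgebra that contains
vertices and arrows; `Realization` records what it uses, so that `H(M)` and `B(M)` are treated
together.

*From bimodules to algebras.* A gauge transformation `F` on `G`, extended by zero to paths of
positive length, is a gauge transformation on `H(M)`. It multiplies the product of a path from `x`
to `y` with a path from `x'` to `y'` by `F(x,x') / F(y,y')`. An isomorphism `M_F ≅ N` over `σ`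
induces an isomorphism of path coalgebras, and the recursion for the quantum shuffle product shows
that it is an isomorphism `H(M)_F ≅ H(N)` (`PathSpace.isHom_mapEquiv`). It maps `B(M)` onto `B(N)`
since both are generated by vertices and arrows.

*Bimodules and collections.* Every homogeneous element of `M` is of the form `(a.v).b` with `v` in
some `M_C`. Moving group elements through such expressions produces scalars that depend on the
cocycle only, so that isomorphisms between the members of two collections over the same cocycle
extend to an isomorphism of bimodules (`Bimodule.isIso_of_collection`).
-/

open scoped TensorProduct

noncomputable section

namespace Majid

open TensorProduct

/-! ### Convolution -/

section convolution

variable {k C D V W : Type*} [Field k] [AddCommGroup C] [Module k C] [Coalgebra k C]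
  [AddCommGroup D] [Module k D] [Coalgebra k D] [AddCommGroup V] [Module k V]
  [AddCommGroup W] [Module k W]

lemma convL_comp (g : C →ₗc[k] D) (φ : D →ₗ[k] k) (f : D →ₗ[k] V) :
    convL (φ ∘ₗ g.toLinearMap) (f ∘ₗ g.toLinearMap) = convL φ f ∘ₗ g.toLinearMap := by
  rw [convL, convL, TensorProduct.map_comp, LinearMap.comp_assoc, LinearMap.comp_assoc,
    LinearMap.comp_assoc, g.map_comp_comul]

lemma convR_comp (g : C →ₗc[k] D) (f : D →ₗ[k] V) (φ : D →ₗ[k] k) :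
    convR (f ∘ₗ g.toLinearMap) (φ ∘ₗ g.toLinearMap) = convR f φ ∘ₗ g.toLinearMap := by
  rw [convR, convR, TensorProduct.map_comp, LinearMap.comp_assoc, LinearMap.comp_assoc,
    LinearMap.comp_assoc, g.map_comp_comul]

lemma comp_convL (h : V →ₗ[k] W) (φ : C →ₗ[k] k) (f : C →ₗ[k] V) :
    convL φ (h ∘ₗ f) = h ∘ₗ convL φ f := by
  have : ∀ t, (TensorProduct.lid k W) (TensorProduct.map φ (h ∘ₗ f) t) =
      h (TensorProduct.lid k V (TensorProduct.map φ f t)) := by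
    intro t
    induction t with
    | zero => simp
    | tmul a b => simp
    | add a b ha hb => simp only [map_add, ha, hb]
  ext c
  exact this _

lemma comp_convR (h : V →ₗ[k] W) (f : C →ₗ[k] V) (φ : C →ₗ[k] k) :
    convR (h ∘ₗ f) φ = h ∘ₗ convR f φ := by
  have : ∀ t, (TensorProduct.rid k W) (TensorProduct.map (h ∘ₗ f) φ t) =
      h (TensorProduct.rid k V (TensorProduct.map f φ t)) := by
    intro t
    induction t with
    | zero => simp
    | tmul a b => simp
    | add a b ha hb => simp only [map_add, ha, hb]
  ext c
  exact this _

lemma convL_groupLike {c : C} (hc : IsGroupLikeElem k c) (φ : C →ₗ[k] k) (f : C →ₗ[k] V) :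
    convL φ f c = φ c • f c := by
  simp [convL, hc.comul_eq_tmul_self]

lemma convR_groupLike {c : C} (hc : IsGroupLikeElem k c) (f : C →ₗ[k] V) (φ : C →ₗ[k] k) :
    convR f φ c = φ c • f c := by
  simp [convR, hc.comul_eq_tmul_self]

/-- `Δ c = a ⊗ c + c ⊗ b`: the element `c` is skew-primitive with respect to `a` and `b`. -/
def SkewPrimitive (k : Type*) {C : Type*} [Field k] [AddCommGroup C] [Module k C] [Coalgebra k C]
    (a b c : C) : Prop :=
  Coalgebra.comul (R := k) c = a ⊗ₜ[k] c + c ⊗ₜ[k] b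

lemma SkewPrimitive.convL_convR {a b c : C} (hb : IsGroupLikeElem k b) (hc : SkewPrimitive k a b c)
    (φ χ : C →ₗ[k] k) (f : C →ₗ[k] V) :
    convL φ (convR f χ) c =
      (φ a * χ b) • f c + (φ a * χ c) • f a + (φ c * χ b) • f b := by
  have h1 : convR f χ c = χ c • f a + χ b • f c := by
    rw [SkewPrimitive] at hc
    simp [convR, hc]
  have h2 : convL φ (convR f χ) c = φ a • convR f χ c + φ c • convR f χ b := by
    rw [SkewPrimitive] at hc
    conv_lhs => rw [convL, LinearMap.comp_apply, LinearMap.comp_apply, hc]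
    simp
  rw [h2, h1, convR_groupLike hb]
  simp only [smul_add, smul_smul]
  abel

lemma SkewPrimitive.map {a b c : C} (hc : SkewPrimitive k a b c) (g : C →ₗc[k] D) :
    SkewPrimitive k (g a) (g b) (g c) := by
  rw [SkewPrimitive] at hc ⊢
  rw [← CoalgHomClass.map_comp_comul_apply, hc]
  simp

lemma isGroupLikeElem_tmul {c : C} {d : D} (hc : IsGroupLikeElem k c) (hd : IsGroupLikeElem k d) :
    IsGroupLikeElem k (c ⊗ₜ[k] d) where
  counit_eq_one := by simp [hc.counit_eq_one, hd.counit_eq_one]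
  comul_eq_tmul_self := by simp [hc.comul_eq_tmul_self, hd.comul_eq_tmul_self]

lemma SkewPrimitive.groupLike_tmul {a b c : C} {d : D} (hc : SkewPrimitive k a b c)
    (hd : IsGroupLikeElem k d) : SkewPrimitive k (d ⊗ₜ[k] a) (d ⊗ₜ[k] b) (d ⊗ₜ[k] c) := by
  rw [SkewPrimitive] at hc ⊢
  simp [hc, hd.comul_eq_tmul_self, tmul_add]

lemma SkewPrimitive.tmul_groupLike {a b c : C} {d : D} (hc : SkewPrimitive k a b c)
    (hd : IsGroupLikeElem k d) : SkewPrimitive k (a ⊗ₜ[k] d) (b ⊗ₜ[k] d) (c ⊗ₜ[k] d) := by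
  rw [SkewPrimitive] at hc ⊢
  simp [hc, hd.comul_eq_tmul_self, add_tmul]

lemma convL_of_rTensor {π : C →ₗ[k] C} {g c : C}
    (h : π.rTensor C (Coalgebra.comul (R := k) c) = g ⊗ₜ[k] c) (φ : C →ₗ[k] k) (f : C →ₗ[k] V) :
    convL (φ ∘ₗ π) f c = φ g • f c := by
  have := congrArg (fun t => TensorProduct.lid k V (TensorProduct.map φ f t)) h
  simp only [← LinearMap.comp_apply (TensorProduct.map φ f), LinearMap.map_comp_rTensor] at this
  simpa [convL] using this

lemma convR_of_lTensor {π : C →ₗ[k] C} {g c : C}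
    (h : π.lTensor C (Coalgebra.comul (R := k) c) = c ⊗ₜ[k] g) (f : C →ₗ[k] V) (φ : C →ₗ[k] k) :
    convR f (φ ∘ₗ π) c = φ g • f c := by
  have := congrArg (fun t => TensorProduct.rid k V (TensorProduct.map f φ t)) h
  simp only [← LinearMap.comp_apply (TensorProduct.map f φ), LinearMap.map_comp_lTensor] at this
  simpa [convR] using this

lemma rTensor_map_comul_tmul {π : C →ₗ[k] C} {ρ : D →ₗ[k] D} {g c : C} {h d : D}
    (hc : π.rTensor C (Coalgebra.comul (R := k) c) = g ⊗ₜ[k] c)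
    (hd : ρ.rTensor D (Coalgebra.comul (R := k) d) = h ⊗ₜ[k] d) :
    (TensorProduct.map π ρ).rTensor (C ⊗[k] D) (Coalgebra.comul (R := k) (c ⊗ₜ[k] d)) =
      (g ⊗ₜ[k] h) ⊗ₜ[k] (c ⊗ₜ[k] d) := by
  have key : ∀ (s : C ⊗[k] C) (t : D ⊗[k] D),
      (TensorProduct.map π ρ).rTensor (C ⊗[k] D)
        (AlgebraTensorModule.tensorTensorTensorComm k k k k C C D D (s ⊗ₜ t)) =
      AlgebraTensorModule.tensorTensorTensorComm k k k k C C D D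
        (π.rTensor C s ⊗ₜ ρ.rTensor D t) := by
    intro s t
    induction s with
    | zero => simp
    | add a b ha hb => simp only [add_tmul, map_add, ha, hb]
    | tmul a b =>
      induction t with
      | zero => simp
      | add a b ha hb => simp only [tmul_add, map_add, ha, hb]
      | tmul a b => simp
  rw [TensorProduct.comul_tmul, key, hc, hd]
  simp

lemma lTensor_map_comul_tmul {π : C →ₗ[k] C} {ρ : D →ₗ[k] D} {g c : C} {h d : D}
    (hc : π.lTensor C (Coalgebra.comul (R := k) c) = c ⊗ₜ[k] g)
    (hd : ρ.lTensor D (Coalgebra.comul (R := k) d) = d ⊗ₜ[k] h) :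
    (TensorProduct.map π ρ).lTensor (C ⊗[k] D) (Coalgebra.comul (R := k) (c ⊗ₜ[k] d)) =
      (c ⊗ₜ[k] d) ⊗ₜ[k] (g ⊗ₜ[k] h) := by
  have key : ∀ (s : C ⊗[k] C) (t : D ⊗[k] D),
      (TensorProduct.map π ρ).lTensor (C ⊗[k] D)
        (AlgebraTensorModule.tensorTensorTensorComm k k k k C C D D (s ⊗ₜ t)) =
      AlgebraTensorModule.tensorTensorTensorComm k k k k C C D D
        (π.lTensor C s ⊗ₜ ρ.lTensor D t) := by
    intro s t
    induction s with
    | zero => simp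
    | add a b ha hb => simp only [add_tmul, map_add, ha, hb]
    | tmul a b =>
      induction t with
      | zero => simp
      | add a b ha hb => simp only [tmul_add, map_add, ha, hb]
      | tmul a b => simp
  rw [TensorProduct.comul_tmul, key, hc, hd]
  simp

end convolution

/-! ### Degrees zero and one of the path coalgebra -/

section pathCoalgebra

variable {k : Type*} {G : Type*} [Field k] [Group G] {Φ : Cocycle3 k G} {M : Type*}
  [AddCommGroup M] [Module k M] {P : Bimodule Φ M}

namespace PathSpace

lemma arrow_ext {V : Type*} [AddCommGroup V] [Module k V] {a b : M →ₗ[k] V}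
    (h : ∀ (x y : HopfQuiver P) (e : x ⟶ y), a (arrow e) = b (arrow e)) : a = b :=
  P.basis.ext fun i => h ⟨i.1.2⟩ ⟨i.1.1⟩ i.2

lemma append_proj {w z : HopfQuiver P} (e : w ⟶ z) : append e ∘ₗ proj w = append e := by
  refine hom_ext fun x y p => ?_
  by_cases hy : y = w
  · subst hy
    simp [proj_path]
  · simp [proj_of_ne _ hy, append_of_ne _ _ hy]

/-- Homogeneous elements of `M` only concatenate with paths that end at their source. -/
lemma concat_proj {z w : G} {m : M} (hm : m ∈ P.comp (z, w)) (u : PathSpace P) :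
    concat m (proj ⟨w⟩ u) = concat m u := by
  refine P.comp_ext (a := (concat (P := P)).flip (proj ⟨w⟩ u)) (b := (concat (P := P)).flip u)
    (fun e => ?_) hm
  have h2 : concat (P.basis ⟨(z, w), e⟩) = append (P := P) (w := ⟨w⟩) (z := ⟨z⟩) e :=
    concat_arrow _
  simp only [LinearMap.flip_apply, h2]
  exact LinearMap.congr_fun (append_proj (P := P) (w := ⟨w⟩) (z := ⟨z⟩) e) u

lemma proj_concat {z w : G} {m : M} (hm : m ∈ P.comp (z, w)) (u : PathSpace P) :
    proj ⟨z⟩ (concat m u) = concat m u := by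
  refine P.comp_ext (a := proj ⟨z⟩ ∘ₗ (concat (P := P)).flip u) (b := (concat (P := P)).flip u)
    (fun e => ?_) hm
  have h2 : concat (P.basis ⟨(z, w), e⟩) = append (P := P) (w := ⟨w⟩) (z := ⟨z⟩) e :=
    concat_arrow _
  simp only [LinearMap.flip_apply, h2, LinearMap.comp_apply]
  exact LinearMap.congr_fun (proj_append (P := P) (w := ⟨w⟩) (z := ⟨z⟩) e) u

/-- Linear maps vanish on all `m u` as soon as they vanish on concatenations with arrows. -/
lemma comp_concat_eq_zero {V : Type*} [AddCommGroup V] [Module k V] {a : PathSpace P →ₗ[k] V}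
    (h : ∀ (w z : HopfQuiver P) (e : w ⟶ z), a ∘ₗ append e = 0) (m : M) (u : PathSpace P) :
    a (concat m u) = 0 := by
  have : a ∘ₗ (concat (P := P)).flip u = 0 := arrow_ext (P := P) fun x y e => by
    simpa using LinearMap.congr_fun (h x y e) u
  exact LinearMap.congr_fun this m

/-- The projection onto the span of the vertices. -/
def base : PathSpace P →ₗ[k] PathSpace P := lin fun _ _ p => if p.length = 0 then path p else 0

lemma base_vertex (x : HopfQuiver P) : base (vertex x) = vertex x := by
  simp [base, vertex]

lemma base_cons {x y z : HopfQuiver P} (p : Quiver.Path x y) (e : y ⟶ z) :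
    base (path (p.cons e)) = 0 := by
  simp [base]

lemma base_append {w z : HopfQuiver P} (e : w ⟶ z) : base ∘ₗ append e = 0 := by
  refine hom_ext fun x y p => ?_
  by_cases hy : y = w
  · subst hy
    simp [append_cons, base_cons]
  · simp [append_of_ne _ _ hy]

lemma base_concat (m : M) (u : PathSpace P) : base (concat m u) = 0 :=
  comp_concat_eq_zero (fun _ _ => base_append) m u

/-- The projection onto the vertices is a map of coalgebras. -/
def baseHom : PathSpace P →ₗc[k] PathSpace P where
  toLinearMap := base
  counit_comp := hom_ext fun x y p => by
    cases p with
    | nil => exact congrArg counit (base_vertex x)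
    | cons p e =>
      change counit (base (path (p.cons e))) = counit (path (p.cons e))
      rw [base_cons, counit_cons, map_zero]
  map_comp_comul := hom_ext fun x y p => by
    change TensorProduct.map base base (comul (path p)) = comul (base (path p))
    cases p with
    | nil =>
      change TensorProduct.map base base (comul (vertex x)) = comul (base (vertex x))
      rw [base_vertex, comul_vertex, TensorProduct.map_tmul, base_vertex]
    | cons p e =>
      rw [base_cons, comul_cons, map_add, TensorProduct.map_tmul, base_cons, tmul_zero, zero_add,
        ← LinearMap.comp_apply, LinearMap.map_comp_rTensor, base_append]
      simp

lemma base_mulPath_of_length {x y x' y' : HopfQuiver P} (p : Quiver.Path x y)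
    (q : Quiver.Path x' y') (h : p.length + q.length ≠ 0) : base (mulPath p q) = 0 := by
  cases p with
  | nil =>
    cases q with
    | nil => simp at h
    | cons q b => rw [mulPath_nil_cons, base_concat]
  | cons p a =>
    cases q with
    | nil => rw [mulPath_cons_nil, base_concat]
    | cons q b => rw [mulPath_cons_cons, map_add, base_concat, base_concat, add_zero]

/-- The projection onto the vertices respects the product. -/
lemma base_mul (u v : PathSpace P) : base (mul u v) = mul (base u) (base v) := by
  have : (mul (P := P)).compr₂ base = mul.compl₁₂ base base := by
    refine hom_ext fun x y p => hom_ext fun x' y' q => ?_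
    simp only [LinearMap.compr₂_apply, LinearMap.compl₁₂_apply]
    cases p with
    | nil =>
      cases q with
      | nil =>
        change base (mul (vertex x) (vertex x')) = mul (base (vertex x)) (base (vertex x'))
        rw [mul_vertex_vertex, base_vertex, base_vertex, base_vertex, mul_vertex_vertex]
      | cons q b => rw [base_cons, mul_path, base_mulPath_of_length _ _ (by simp), map_zero]
    | cons p a =>
      rw [base_cons, mul_path, base_mulPath_of_length _ _ (by simp), map_zero,
        LinearMap.zero_apply]
  exact LinearMap.congr_fun₂ this u v

lemma base_rTensor_comul {x y : HopfQuiver P} (p : Quiver.Path x y) :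
    (base (P := P)).rTensor _ (comul (path p)) = vertex y ⊗ₜ path p := by
  cases p with
  | nil =>
    change (base (P := P)).rTensor _ (comul (vertex x)) = vertex x ⊗ₜ vertex x
    rw [comul_vertex, LinearMap.rTensor_tmul, base_vertex]
  | cons p e =>
    rw [comul_cons, map_add, LinearMap.rTensor_tmul, base_vertex, ← LinearMap.comp_apply,
      ← LinearMap.rTensor_comp, base_append]
    simp

lemma base_lTensor_comul {x y : HopfQuiver P} (p : Quiver.Path x y) :
    (base (P := P)).lTensor _ (comul (path p)) = path p ⊗ₜ vertex x := by
  induction p with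
  | nil =>
    change (base (P := P)).lTensor _ (comul (vertex x)) = vertex x ⊗ₜ vertex x
    rw [comul_vertex, LinearMap.lTensor_tmul, base_vertex]
  | cons p e ih =>
    rw [comul_cons, map_add, LinearMap.lTensor_tmul, base_cons, tmul_zero, zero_add,
      ← LinearMap.comp_apply, LinearMap.lTensor_comp_rTensor, ← LinearMap.rTensor_comp_lTensor,
      LinearMap.comp_apply, ih, LinearMap.rTensor_tmul, append_cons]

/-- The arrow of a path of length one, as an element of `M`; zero for all other paths. -/
def deg1Path : ∀ {x y : HopfQuiver P}, Quiver.Path x y → M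
  | _, _, .nil => 0
  | _, _, .cons .nil e => arrow e
  | _, _, .cons (.cons _ _) _ => 0

/-- The projection `kQ → kQ_1 = M` onto degree one. -/
def deg1 : PathSpace P →ₗ[k] M := lin fun _ _ p => deg1Path p

lemma deg1_vertex (x : HopfQuiver P) : deg1 (vertex x) = 0 := by
  simp [deg1, vertex, deg1Path]

lemma deg1_base (u : PathSpace P) : deg1 (base u) = 0 := by
  refine LinearMap.congr_fun (f := deg1 ∘ₗ base) (g := 0) (hom_ext fun x y p => ?_) u
  cases p with
  | nil => exact (congrArg deg1 (base_vertex x)).trans (deg1_vertex x)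
  | cons p e => simp [base_cons]

/-- The inclusion `M = kQ_1 → kQ`. -/
def incl : M →ₗ[k] PathSpace P :=
  P.basis.constr k fun a =>
    path (Quiver.Hom.toPath (a := (⟨a.1.2⟩ : HopfQuiver P)) (b := ⟨a.1.1⟩) a.2)

lemma incl_arrow {x y : HopfQuiver P} (e : x ⟶ y) : incl (arrow e) = path e.toPath := by
  simp [incl, arrow, Module.Basis.constr_basis]

lemma incl_eq_concat {y x : G} {m : M} (hm : m ∈ P.comp (y, x)) :
    incl (P := P) m = concat m (vertex ⟨x⟩) := by
  refine P.comp_ext (a := incl) (b := (concat (P := P)).flip (vertex ⟨x⟩)) (fun e => ?_) hm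
  have h1 := incl_arrow (P := P) (x := ⟨x⟩) (y := ⟨y⟩) e
  have h2 : concat (P.basis ⟨(y, x), e⟩) = append (P := P) (w := ⟨x⟩) (z := ⟨y⟩) e :=
    concat_arrow _
  rw [LinearMap.flip_apply, h2]
  exact h1.trans (append_cons _ _).symm

lemma deg1_incl (m : M) : deg1 (incl (P := P) m) = m := by
  refine LinearMap.congr_fun (f := deg1 ∘ₗ incl) (g := LinearMap.id)
    (arrow_ext (P := P) fun x y e => ?_) m
  simp [incl_arrow, deg1, Quiver.Hom.toPath, deg1Path]

lemma isGroupLikeElem_vertex (x : HopfQuiver P) : IsGroupLikeElem k (vertex x) where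
  counit_eq_one := counit_vertex x
  comul_eq_tmul_self := comul_vertex x

lemma skewPrimitive_incl {y x : G} {m : M} (hm : m ∈ P.comp (y, x)) :
    SkewPrimitive k (vertex (P := P) ⟨y⟩) (vertex ⟨x⟩) (incl m) := by
  change comul _ = _
  rw [incl_eq_concat hm, comul_concat hm, comul_vertex, LinearMap.rTensor_tmul]

lemma mul_vertex_incl (f : G) (m : M) :
    mul (vertex (P := P) ⟨f⟩) (incl m) = incl (P.lact f m) := by
  refine LinearMap.congr_fun (f := mul (vertex ⟨f⟩) ∘ₗ incl) (g := incl ∘ₗ P.lact f)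
    (arrow_ext (P := P) fun x y e => ?_) m
  rw [LinearMap.comp_apply, LinearMap.comp_apply, incl_arrow,
    incl_eq_concat (P.lact_mem (arrow_mem e)), vertex, mul_path, Quiver.Hom.toPath,
    mulPath_nil_cons, mulPath_nil_nil]

lemma mul_incl_vertex (f : G) (m : M) :
    mul (incl m) (vertex (P := P) ⟨f⟩) = incl (P.ract f m) := by
  refine LinearMap.congr_fun (f := mul.flip (vertex ⟨f⟩) ∘ₗ incl) (g := incl ∘ₗ P.ract f)
    (arrow_ext (P := P) fun x y e => ?_) m
  rw [LinearMap.comp_apply, LinearMap.comp_apply, incl_arrow, LinearMap.flip_apply,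
    incl_eq_concat (P.ract_mem (arrow_mem e)), vertex, mul_path, Quiver.Hom.toPath,
    mulPath_cons_nil, mulPath_nil_nil]

/-- Splitting off the last arrow of every path and gluing it back recovers the part of positive
degree. -/
lemma concat_deg1_comul (u : PathSpace P) :
    TensorProduct.lift (concat ∘ₗ deg1) (comul u) = u - base u := by
  refine LinearMap.congr_fun (f := TensorProduct.lift (concat ∘ₗ deg1) ∘ₗ comul)
    (g := LinearMap.id - base) (hom_ext fun x y p => ?_) u
  cases p with
  | nil =>
    change TensorProduct.lift (concat ∘ₗ deg1) (comul (vertex x)) = vertex x - base (vertex x)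
    rw [comul_vertex, base_vertex, TensorProduct.lift.tmul, LinearMap.comp_apply, deg1_vertex]
    simp
  | @cons y z p e =>
    rw [LinearMap.comp_apply, comul_cons, map_add, TensorProduct.lift.tmul, LinearMap.comp_apply,
      deg1_vertex, map_zero, LinearMap.zero_apply, zero_add, LinearMap.sub_apply, base_cons,
      sub_zero, LinearMap.id_apply]
    -- after `append e`, only the vertex at the source of `e` contributes in degree one
    have key : ∀ t : PathSpace P ⊗[k] PathSpace P,
        TensorProduct.lift (concat ∘ₗ deg1) ((append e).rTensor _ t) =
          TensorProduct.lift (concat ∘ₗ deg1)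
            ((append e).rTensor _ ((base (P := P)).rTensor _ t)) := by
      have h : deg1 ∘ₗ append e ∘ₗ base = deg1 ∘ₗ append e := hom_ext fun x y' p => by
        cases p with
        | nil => exact congrArg (fun t => deg1 (append e t)) (base_vertex x)
        | cons p b =>
          by_cases hw : y' = y
          · subst hw
            simp [base_cons, append_cons, deg1, deg1Path]
          · simp [base_cons, append_of_ne _ _ hw]
      intro t
      induction t with
      | zero => simp
      | add a b ha hb => simp only [map_add, ha, hb]
      | tmul a b => simpa using congrArg (fun m => concat m b) (LinearMap.congr_fun h a).symm
    rw [key, base_rTensor_comul, LinearMap.rTensor_tmul, TensorProduct.lift.tmul,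
      LinearMap.comp_apply]
    have h3 : append e (vertex y) = path e.toPath := append_cons _ _
    rw [h3, ← incl_arrow, deg1_incl, concat_arrow, append_cons]

open Classical in
/-- The coefficient of the vertex `g`. -/
def coeff (g : HopfQuiver P) : PathSpace P →ₗ[k] k :=
  lin fun _ y p => if p.length = 0 ∧ y = g then 1 else 0

lemma coeff_vertex_self (g : HopfQuiver P) : coeff g (vertex g) = 1 := by
  simp [coeff, vertex]

lemma coeff_vertex_of_ne {g h : HopfQuiver P} (hgh : h ≠ g) : coeff g (vertex h) = 0 := by
  simp [coeff, vertex, hgh]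

lemma coeff_comp_base (g : HopfQuiver P) : coeff g ∘ₗ base = coeff g := by
  refine hom_ext fun x y p => ?_
  cases p with
  | nil => exact congrArg (coeff g) (base_vertex x)
  | cons p e => simp [base_cons, coeff]

lemma convL_coeff (g : HopfQuiver P) : convL (coeff g) LinearMap.id = proj g := by
  refine hom_ext fun x y p => ?_
  rw [← coeff_comp_base, convL_of_rTensor (base_rTensor_comul p)]
  by_cases h : y = g
  · subst h
    simp [coeff_vertex_self, proj_path]
  · simp [coeff_vertex_of_ne h, proj_of_ne _ h]

open Classical in
/-- The projection onto the span of the paths starting at `w`. -/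
def projSource (w : HopfQuiver P) : PathSpace P →ₗ[k] PathSpace P :=
  lin fun x _ p => if x = w then path p else 0

lemma convR_coeff (g : HopfQuiver P) : convR LinearMap.id (coeff g) = projSource g := by
  refine hom_ext fun x y p => ?_
  rw [← coeff_comp_base, convR_of_lTensor (base_lTensor_comul p)]
  by_cases h : x = g
  · subst h
    simp [coeff_vertex_self, projSource]
  · simp [coeff_vertex_of_ne h, projSource, h]

lemma deg1_mem (y x : G) (u : PathSpace P) :
    deg1 (projSource (P := P) ⟨x⟩ (proj ⟨y⟩ u)) ∈ P.comp (y, x) := by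
  have : (P.comp (y, x)).mkQ ∘ₗ deg1 ∘ₗ projSource (P := P) ⟨x⟩ ∘ₗ proj ⟨y⟩ = 0 := hom_ext fun x' y' p => by
    simp only [LinearMap.comp_apply, LinearMap.zero_apply, Submodule.mkQ_apply,
      Submodule.Quotient.mk_eq_zero]
    by_cases hy : y' = ⟨y⟩
    · subst hy
      rw [proj_path]
      by_cases hx : x' = ⟨x⟩
      · subst hx
        simp only [projSource, lin_path, if_true, deg1]
        match p with
        | .cons .nil e => exact arrow_mem e
        | .nil => exact zero_mem _
        | .cons (.cons _ _) _ => exact zero_mem _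
      · simp [projSource, hx]
    · simp [proj_of_ne _ hy]
  simpa using LinearMap.congr_fun this u

/-- The degree-one part of a skew-primitive element is a combination of arrows between the two
vertices. -/
lemma SkewPrimitive.deg1_mem {y x : G} {u : PathSpace P}
    (hu : SkewPrimitive k (vertex (P := P) ⟨y⟩) (vertex ⟨x⟩) u) : deg1 u ∈ P.comp (y, x) := by
  have h1 : proj ⟨y⟩ u = u + coeff ⟨y⟩ u • vertex ⟨x⟩ := by
    rw [SkewPrimitive] at hu
    simp [← convL_coeff, convL, hu, coeff_vertex_self]
  have h2 : projSource ⟨x⟩ u = coeff ⟨x⟩ u • vertex ⟨y⟩ + u := by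
    rw [SkewPrimitive] at hu
    simp [← convR_coeff, convR, hu, coeff_vertex_self]
  have h3 : projSource ⟨x⟩ (vertex ⟨x⟩) = vertex (P := P) ⟨x⟩ := by
    simp [projSource, vertex]
  have := PathSpace.deg1_mem y x u
  rwa [h1, map_add, h2, map_smul, h3, map_add, map_add, map_smul, map_smul, deg1_vertex,
    deg1_vertex, smul_zero, smul_zero, zero_add, add_zero] at this

/-- A skew-primitive element has no components in degrees greater than one. -/
lemma SkewPrimitive.eq_base_add_incl {y x : G} {u : PathSpace P}
    (hu : SkewPrimitive k (vertex (P := P) ⟨y⟩) (vertex ⟨x⟩) u) : u = base u + incl (deg1 u) := by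
  have h := concat_deg1_comul u
  have hu' : comul u = _ := hu
  rw [hu', map_add, TensorProduct.lift.tmul, TensorProduct.lift.tmul, LinearMap.comp_apply,
    LinearMap.comp_apply, deg1_vertex, map_zero, LinearMap.zero_apply, zero_add,
    ← incl_eq_concat (SkewPrimitive.deg1_mem hu)] at h
  rw [h]
  abel

/-! ### Group-like elements of the path coalgebra -/

/-- The projection onto the span of the paths of length `n`. -/
def degProj (n : ℕ) : PathSpace P →ₗ[k] PathSpace P :=
  lin fun _ _ p => if p.length = n then path p else 0

lemma degProj_zero : degProj (P := P) 0 = base := rfl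

lemma degProj_succ_append {w z : HopfQuiver P} (e : w ⟶ z) (n : ℕ) :
    degProj (n + 1) ∘ₗ append e = append e ∘ₗ degProj n := by
  refine hom_ext fun x y p => ?_
  by_cases hy : y = w
  · subst hy
    by_cases h : p.length = n <;> simp [append_cons, degProj, h]
  · by_cases h : p.length = n <;> simp [append_of_ne _ _ hy, degProj, h]

lemma degProj_comulPath {x y : HopfQuiver P} (p : Quiver.Path x y) (i j : ℕ)
    (h : i + j ≠ p.length) : TensorProduct.map (degProj i) (degProj j) (comul (path p)) = 0 := by
  induction p generalizing i with
  | nil =>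
    change TensorProduct.map (degProj i) (degProj j) (comul (vertex x)) = 0
    rw [comul_vertex, TensorProduct.map_tmul]
    rw [Quiver.Path.length_nil] at h
    rcases Nat.eq_zero_or_pos i with hi | hi
    · have : (0 : ℕ) ≠ j := by omega
      simp [degProj, vertex, this]
    · simp [degProj, vertex, hi.ne]
  | cons p e ih =>
    rw [Quiver.Path.length_cons] at h
    rw [comul_cons, map_add, TensorProduct.map_tmul, ← LinearMap.comp_apply,
      LinearMap.map_comp_rTensor]
    cases i with
    | zero =>
      have : p.length + 1 ≠ j := by omega
      rw [degProj_zero, base_append]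
      simp [degProj, this]
    | succ i =>
      rw [degProj_succ_append, ← LinearMap.rTensor_comp_map, LinearMap.comp_apply,
        ih i (by omega)]
      simp [degProj, vertex]

lemma degProj_comul (u : PathSpace P) (i j : ℕ) :
    TensorProduct.map (degProj i) (degProj j) (comul u) =
      TensorProduct.map (degProj i) (degProj j) (comul (degProj (i + j) u)) := by
  refine LinearMap.congr_fun (f := TensorProduct.map (degProj i) (degProj j) ∘ₗ comul)
    (g := TensorProduct.map (degProj i) (degProj j) ∘ₗ comul ∘ₗ degProj (i + j))
    (hom_ext fun x y p => ?_) u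
  by_cases h : p.length = i + j
  · simp [degProj, h]
  · have := degProj_comulPath p i j (Ne.symm h)
    simp only [LinearMap.comp_apply, this]
    simp [degProj, h]

lemma exists_degProj_eq_zero (u : PathSpace P) :
    ∃ N, ∀ n, N ≤ n → degProj n u = 0 := by
  have : u ∈ Submodule.span k (Set.range (pathBasis P)) := by
    rw [(pathBasis P).span_eq]; trivial
  induction this using Submodule.span_induction with
  | mem u hu =>
    obtain ⟨⟨x, y, p⟩, rfl⟩ := hu
    refine ⟨p.length + 1, fun n hn => ?_⟩
    change degProj n (path p) = 0
    have : p.length ≠ n := by omega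
    simp [degProj, this]
  | zero => exact ⟨0, fun _ _ => map_zero _⟩
  | add u v _ _ hu hv =>
    obtain ⟨N, hN⟩ := hu
    obtain ⟨N', hN'⟩ := hv
    refine ⟨N + N', fun n hn => ?_⟩
    rw [map_add, hN n (by omega), hN' n (by omega), add_zero]
  | smul c u _ hu =>
    obtain ⟨N, hN⟩ := hu
    exact ⟨N, fun n hn => by rw [map_smul, hN n hn, smul_zero]⟩

lemma eq_zero_of_degProj_eq_zero {u : PathSpace P} (h : ∀ n, degProj n u = 0) : u = 0 := by
  refine (pathBasis P).ext_elem fun q => ?_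
  have key : ((pathBasis P).coord q) ∘ₗ degProj q.2.2.length = (pathBasis P).coord q := by
    refine hom_ext fun x y p => ?_
    by_cases hp : p.length = q.2.2.length
    · simp [degProj, hp]
    · have : (⟨x, y, p⟩ : AllPaths P) ≠ q := by rintro rfl; exact hp rfl
      have h2 : (pathBasis P).coord q (path p) = 0 := by
        simp [path, Finsupp.single_eq_of_ne' this]
      rw [h2, LinearMap.comp_apply, degProj, lin_path, if_neg hp, map_zero]
  have := LinearMap.congr_fun key u
  rw [LinearMap.comp_apply, h, map_zero] at this
  simpa using this.symm

/-- Group-like elements live in degree zero: a top-degree component `u_n` with `n > 0` would give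
the nonzero component `u_n ⊗ u_n` of `Δ u` in total degree `2 n`. -/
lemma degProj_groupLike {u : PathSpace P} (hu : IsGroupLikeElem k u) {n : ℕ} (hn : n ≠ 0) :
    degProj n u = 0 := by
  obtain ⟨N, hN⟩ := exists_degProj_eq_zero u
  induction h : N - n using Nat.strong_induction_on generalizing n with
  | _ d ih =>
    by_cases hle : N ≤ n
    · exact hN n hle
    have h2 : degProj (n + n) u = 0 := ih (N - (n + n)) (by omega) (by omega) rfl
    have h3 := degProj_comul u n n
    have hu' : comul u = u ⊗ₜ u := hu.comul_eq_tmul_self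
    rw [h2, map_zero, map_zero, hu', TensorProduct.map_tmul] at h3
    refine (pathBasis P).ext_elem fun q => ?_
    have h4 := congrArg (fun t => TensorProduct.lid k k
      (TensorProduct.map ((pathBasis P).coord q) ((pathBasis P).coord q) t)) h3
    simpa using h4

lemma eq_vertex_of_isGroupLikeElem {u : PathSpace P} (hu : IsGroupLikeElem k u) :
    ∃ x, u = vertex x := by
  have hb : u = base u := by
    rw [← sub_eq_zero]
    refine eq_zero_of_degProj_eq_zero fun n => ?_
    rw [map_sub, sub_eq_zero]
    by_cases hn : n = 0
    · subst hn
      rw [degProj_zero]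
      refine LinearMap.congr_fun (f := base) (g := base ∘ₗ base) (hom_ext fun x y p => ?_) u
      by_cases h : p.length = 0 <;> simp [base, h]
    · rw [degProj_groupLike hu hn]
      refine (LinearMap.congr_fun (f := degProj n ∘ₗ base) (g := 0)
        (hom_ext fun x y p => ?_) u).symm
      by_cases h : p.length = 0
      · simp [base, degProj, h, Ne.symm hn]
      · simp [base, h]
  have hproj : ∀ g, proj g u = coeff g u • u := fun g => by
    rw [← convL_coeff, convL_groupLike hu, LinearMap.id_apply]
  obtain ⟨g, hg⟩ : ∃ g, coeff g u ≠ 0 := by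
    by_contra! h0
    apply hu.ne_zero
    rw [hb]
    refine (pathBasis P).ext_elem fun q => ?_
    have key : ∃ c : k, (pathBasis P).coord q ∘ₗ base = c • coeff q.1 := by
      obtain ⟨x, y, q⟩ := q
      cases q with
      | nil =>
        refine ⟨1, hom_ext fun x' y' p => ?_⟩
        cases p with
        | nil =>
          by_cases h : x' = x
          · subst h
            change (pathBasis P).coord _ (base (vertex x')) = ((1 : k) • coeff x') (vertex x')
            rw [base_vertex, LinearMap.smul_apply, coeff_vertex_self]
            simp [vertex, path]
          · have : (⟨x', x', .nil⟩ : AllPaths P) ≠ ⟨x, x, .nil⟩ :=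
              fun h' => h (congrArg Sigma.fst h')
            change (pathBasis P).coord _ (base (vertex x')) = ((1 : k) • coeff x) (vertex x')
            rw [base_vertex, LinearMap.smul_apply, coeff_vertex_of_ne h]
            simp [vertex, path, Finsupp.single_eq_of_ne' this]
        | cons p e => simp [base, coeff]
      | cons q b =>
        refine ⟨0, hom_ext fun x' y' p => ?_⟩
        cases p with
        | nil =>
          have : (⟨x', x', .nil⟩ : AllPaths P) ≠ ⟨x, y, q.cons b⟩ := fun h' => by
            have := congrArg (fun r : AllPaths P => r.2.2.length) h'
            simp at this
          change (pathBasis P).coord _ (base (vertex x')) = _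
          rw [base_vertex]
          simp [vertex, path, Finsupp.single_eq_of_ne' this]
        | cons p e => simp [base]
    obtain ⟨c, hc⟩ := key
    have := LinearMap.congr_fun hc u
    rw [LinearMap.smul_apply, h0, smul_zero] at this
    simpa using this
  have h1 : proj g u = u := by
    have h2 : proj g (proj g u) = proj g u := by
      refine LinearMap.congr_fun (f := proj g ∘ₗ proj g) (g := proj g)
        (hom_ext fun x y p => ?_) u
      by_cases h : y = g <;> simp [proj, h]
    rw [hproj, map_smul, hproj, smul_smul] at h2
    have h3 := smul_left_injective k hu.ne_zero h2
    have h4 : coeff g u = 1 := mul_right_cancel₀ hg (by rw [one_mul]; exact h3)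
    rw [hproj, h4, one_smul]
  refine ⟨g, ?_⟩
  have h5 : base (proj g u) = coeff g u • vertex g := by
    refine LinearMap.congr_fun (f := base ∘ₗ proj g)
      (g := (coeff g).smulRight (vertex g)) (hom_ext fun x y p => ?_) u
    by_cases h : y = g
    · subst h
      cases p with
      | nil => simp [proj, base, coeff, vertex]
      | cons p e => simp [proj, base, coeff]
    · simp [proj, coeff, h]
  have h6 : coeff g u = 1 := by
    have := hproj g
    rw [h1] at this
    exact smul_left_injective k hu.ne_zero (by simpa using this.symm)
  rw [h1, h6, one_smul] at h5
  rw [hb, h5]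

end PathSpace

end pathCoalgebra

/-! ### Isomorphisms out of a twisted bimodule -/

section twistedBimodule

variable {k : Type*} {G : Type*} [Field k] [Group G] {Φ Φ' : Cocycle3 k G} {M N : Type*}
  [AddCommGroup M] [Module k M] [AddCommGroup N] [Module k N]

namespace Bimodule

lemma twist_lact_apply (P : Bimodule Φ M) (F : GroupGauge k G) (f : G) {y x : G} {m : M}
    (hm : m ∈ P.comp (y, x)) :
    (P.twist F).lact f m = ((F f x / F f y : kˣ) : k) • P.lact f m := by
  simp only [twist, LinearMap.comp_apply, P.diag_apply _ hm, Units.smul_def, map_smul]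

lemma twist_ract_apply (P : Bimodule Φ M) (F : GroupGauge k G) (f : G) {y x : G} {m : M}
    (hm : m ∈ P.comp (y, x)) :
    (P.twist F).ract f m = ((F x f / F y f : kˣ) : k) • P.ract f m := by
  simp only [twist, LinearMap.comp_apply, P.diag_apply _ hm, Units.smul_def, map_smul]

lemma isIso_twist_iff (P : Bimodule Φ M) (Q : Bimodule Φ' N) (F : GroupGauge k G) :
    (P.twist F).IsIso Q ↔ ∃ φ : M ≃ₗ[k] N, (∀ p m, m ∈ P.comp p ↔ φ m ∈ Q.comp p) ∧
      (∀ f y x m, m ∈ P.comp (y, x) →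
        ((F f x / F f y : kˣ) : k) • φ (P.lact f m) = Q.lact f (φ m)) ∧
      (∀ f y x m, m ∈ P.comp (y, x) →
        ((F x f / F y f : kˣ) : k) • φ (P.ract f m) = Q.ract f (φ m)) := by
  refine exists_congr fun φ => and_congr Iff.rfl (and_congr ⟨fun h f y x m hm => ?_, fun h f m => ?_⟩
    ⟨fun h f y x m hm => ?_, fun h f m => ?_⟩)
  · rw [← h f m, P.twist_lact_apply F f hm, map_smul]
  · refine P.eq_of_comp (φ.toLinearMap ∘ₗ (P.twist F).lact f) (Q.lact f ∘ₗ φ.toLinearMap)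
      (fun p m hm => ?_) m
    rw [LinearMap.comp_apply, P.twist_lact_apply F f hm, map_smul]
    exact h f _ _ m hm
  · rw [← h f m, P.twist_ract_apply F f hm, map_smul]
  · refine P.eq_of_comp (φ.toLinearMap ∘ₗ (P.twist F).ract f) (Q.ract f ∘ₗ φ.toLinearMap)
      (fun p m hm => ?_) m
    rw [LinearMap.comp_apply, P.twist_ract_apply F f hm, map_smul]
    exact h f _ _ m hm

end Bimodule

end twistedBimodule

/-! ### Realizations inside the path coalgebra -/

section realization

variable {k : Type*} {G : Type*} [Field k] [Group G] {Φ Φ' : Cocycle3 k G} {M N : Type*}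
  [AddCommGroup M] [Module k M] [AddCommGroup N] [Module k N]
  {P : Bimodule Φ M} {Q : Bimodule Φ' N}
  {C C' : Type*} [AddCommGroup C] [Module k C] [Coalgebra k C]
  [AddCommGroup C'] [Module k C'] [Coalgebra k C']

namespace PathSpace

lemma reassoc_vertex (x y z : HopfQuiver P) :
    reassoc P (vertex x ⊗ₜ (vertex y ⊗ₜ vertex z)) = Φ x.val y.val z.val := by
  simp [reassoc, vertex]

lemma base_mem_span (u : PathSpace P) :
    base u ∈ Submodule.span k (Set.range fun g : G => vertex (P := P) ⟨g⟩) := by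
  have : (Submodule.span k (Set.range fun g : G => vertex (P := P) ⟨g⟩)).mkQ ∘ₗ base = 0 :=
    hom_ext fun x y p => by
      cases p with
      | nil =>
        change Submodule.mkQ _ (base (vertex x)) = 0
        rw [base_vertex, Submodule.mkQ_apply, Submodule.Quotient.mk_eq_zero]
        exact Submodule.subset_span ⟨x.val, rfl⟩
      | cons p e => simp [base_cons]
  simpa using LinearMap.congr_fun this u

end PathSpace

open PathSpace

/-- A realization of the structure `A` on the coalgebra `C` as a sub Majid algebra of `H(M)` that
contains the vertices and the arrows. Both `H(M)` and `B(M)` have one, and the comparison of Majid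
algebras with bimodules only uses these data. -/
structure Realization (P : Bimodule Φ M) (A : MajidData k C) where
  /-- the inclusion into the path coalgebra -/
  j : C →ₗc[k] PathSpace P
  inj : Function.Injective j
  /-- the elements of the group -/
  vtx : G → C
  j_vtx : ∀ g, j (vtx g) = vertex ⟨g⟩
  /-- the combinations of arrows -/
  arr : M →ₗ[k] C
  j_arr : ∀ m, j (arr m) = incl m
  j_mul : ∀ x y, j (A.mul x y) = mul (j x) (j y)
  one_eq : A.one = vtx 1
  reassoc_eq : ∀ x y z, A.reassoc (x ⊗ₜ (y ⊗ₜ z)) = reassoc P (j x ⊗ₜ (j y ⊗ₜ j z))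

namespace Realization

variable {A : MajidData k C} {A' : MajidData k C'} (R : Realization P A) (S : Realization Q A')

include R in
lemma map_j_injective : Function.Injective (TensorProduct.map R.j.toLinearMap R.j.toLinearMap) :=
  TensorProduct.map_injective_of_flat_flat _ _ R.inj R.inj

lemma isGroupLikeElem_of_j {c : C} (h : IsGroupLikeElem k (R.j c)) : IsGroupLikeElem k c where
  counit_eq_one := by
    rw [← CoalgHomClass.counit_comp_apply R.j]
    exact h.counit_eq_one
  comul_eq_tmul_self := by
    apply R.map_j_injective
    have h1 := CoalgHomClass.map_comp_comul_apply R.j c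
    rw [h.comul_eq_tmul_self] at h1
    exact h1

lemma skewPrimitive_of_j {a b c : C} (h : SkewPrimitive k (R.j a) (R.j b) (R.j c)) :
    SkewPrimitive k a b c := by
  apply R.map_j_injective
  have h1 := CoalgHomClass.map_comp_comul_apply R.j c
  rw [SkewPrimitive] at h
  rw [h] at h1
  refine h1.trans ?_
  rw [map_add]
  rfl

lemma isGroupLikeElem_vtx (g : G) : IsGroupLikeElem k (R.vtx g) :=
  R.isGroupLikeElem_of_j (by rw [R.j_vtx]; exact isGroupLikeElem_vertex _)

lemma skewPrimitive_arr {y x : G} {m : M} (hm : m ∈ P.comp (y, x)) :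
    SkewPrimitive k (R.vtx y) (R.vtx x) (R.arr m) :=
  R.skewPrimitive_of_j (by rw [R.j_vtx, R.j_vtx, R.j_arr]; exact skewPrimitive_incl hm)

lemma eq_vtx_of_isGroupLikeElem {c : C} (hc : IsGroupLikeElem k c) : ∃ g, c = R.vtx g := by
  obtain ⟨x, hx⟩ := eq_vertex_of_isGroupLikeElem (hc.map R.j)
  exact ⟨x.val, R.inj (by rw [hx, R.j_vtx])⟩

lemma vtx_injective : Function.Injective R.vtx := fun g h hgh => by
  have h1 := congrArg (fun c => coeff (⟨g⟩ : HopfQuiver P) (R.j c)) hgh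
  simp only [R.j_vtx, coeff_vertex_self] at h1
  by_contra hne
  rw [coeff_vertex_of_ne (by simpa using Ne.symm hne)] at h1
  exact one_ne_zero h1

lemma mul_vtx_vtx (g h : G) : A.mul (R.vtx g) (R.vtx h) = R.vtx (g * h) :=
  R.inj (by rw [R.j_mul, R.j_vtx, R.j_vtx, R.j_vtx, mul_vertex_vertex])

lemma mul_vtx_arr (g : G) (m : M) : A.mul (R.vtx g) (R.arr m) = R.arr (P.lact g m) :=
  R.inj (by rw [R.j_mul, R.j_vtx, R.j_arr, R.j_arr, mul_vertex_incl])

lemma mul_arr_vtx (g : G) (m : M) : A.mul (R.arr m) (R.vtx g) = R.arr (P.ract g m) :=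
  R.inj (by rw [R.j_mul, R.j_vtx, R.j_arr, R.j_arr, mul_incl_vertex])

lemma reassoc_vtx (x y z : G) :
    A.reassoc (R.vtx x ⊗ₜ (R.vtx y ⊗ₜ R.vtx z)) = Φ x y z := by
  rw [R.reassoc_eq, R.j_vtx, R.j_vtx, R.j_vtx, reassoc_vertex]

/-! ### From Majid algebras to bimodules -/

/-- A coalgebra isomorphism permutes the group-like elements, i.e. the vertices. -/
lemma exists_equiv (ψ : C ≃ₗc[k] C') : ∃ σ : G ≃ G, ∀ g, ψ (R.vtx g) = S.vtx (σ g) := by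
  have h1 : ∀ g, ∃ h, ψ (R.vtx g) = S.vtx h := fun g =>
    S.eq_vtx_of_isGroupLikeElem ((R.isGroupLikeElem_vtx g).map ψ)
  have h2 : ∀ g, ∃ h, ψ.symm (S.vtx g) = R.vtx h := fun g =>
    R.eq_vtx_of_isGroupLikeElem ((S.isGroupLikeElem_vtx g).map ψ.symm)
  choose s hs using h1
  choose t ht using h2
  refine ⟨⟨s, t, fun g => R.vtx_injective ?_, fun g => S.vtx_injective ?_⟩, hs⟩
  · rw [← ht, ← hs, CoalgEquiv.symm_apply_apply]
  · rw [← hs, ← ht, CoalgEquiv.apply_symm_apply]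

/-- The value of a gauge transformation on two elements of the group. -/
def groupGauge (T : A.Gauge) : GroupGauge k G where
  toFun g h :=
    { val := T.F (R.vtx g ⊗ₜ R.vtx h)
      inv := T.inv (R.vtx g ⊗ₜ R.vtx h)
      val_inv := by
        have hgl := isGroupLikeElem_tmul (R.isGroupLikeElem_vtx g) (R.isGroupLikeElem_vtx h)
        have := LinearMap.congr_fun T.conv_inv (R.vtx g ⊗ₜ R.vtx h)
        rwa [convL_groupLike hgl, hgl.counit_eq_one] at this
      inv_val := by
        have hgl := isGroupLikeElem_tmul (R.isGroupLikeElem_vtx g) (R.isGroupLikeElem_vtx h)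
        have := LinearMap.congr_fun T.inv_conv (R.vtx g ⊗ₜ R.vtx h)
        rwa [convL_groupLike hgl, hgl.counit_eq_one] at this }
  map_one_left g := Units.ext (by
    rw [Units.val_one, Units.val_mk, ← R.one_eq, T.one_apply,
      (R.isGroupLikeElem_vtx g).counit_eq_one])
  map_one_right g := Units.ext (by
    rw [Units.val_one, Units.val_mk, ← R.one_eq, T.apply_one,
      (R.isGroupLikeElem_vtx g).counit_eq_one])

lemma groupGauge_apply (T : A.Gauge) (g h : G) :
    (R.groupGauge T g h : k) = T.F (R.vtx g ⊗ₜ R.vtx h) := rfl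

lemma groupGauge_inv_apply (T : A.Gauge) (g h : G) :
    ((R.groupGauge T g h)⁻¹ : k) = T.inv (R.vtx g ⊗ₜ R.vtx h) := by
  rw [← Units.val_inv_eq_inv_val]
  rfl

lemma twist_mul_vtx_vtx (T : A.Gauge) (g h : G) :
    (A.twist T).mul (R.vtx g) (R.vtx h) = R.vtx (g * h) := by
  have hgl := isGroupLikeElem_tmul (R.isGroupLikeElem_vtx g) (R.isGroupLikeElem_vtx h)
  change convL T.inv (convR A.mulT T.F) (R.vtx g ⊗ₜ R.vtx h) = _
  rw [convL_groupLike hgl, convR_groupLike hgl, ← R.groupGauge_apply, ← R.groupGauge_inv_apply,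
    smul_smul, inv_mul_cancel₀ (Units.ne_zero _), one_smul, MajidData.mulT, TensorProduct.lift.tmul,
    R.mul_vtx_vtx]

lemma twist_reassoc_vtx (T : A.Gauge) (x y z : G) :
    (A.twist T).reassoc (R.vtx x ⊗ₜ (R.vtx y ⊗ₜ R.vtx z)) =
      (Φ.twist (R.groupGauge T) x y z : kˣ) := by
  have hgl := isGroupLikeElem_tmul (R.isGroupLikeElem_vtx x)
    (isGroupLikeElem_tmul (R.isGroupLikeElem_vtx y) (R.isGroupLikeElem_vtx z))
  simp only [MajidData.twist, convL_groupLike hgl, LinearMap.comp_apply, LinearEquiv.coe_coe,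
    TensorProduct.map_tmul, TensorProduct.lid_tmul, TensorProduct.rid_tmul,
    TensorProduct.assoc_symm_tmul, LinearMap.id_apply, MajidData.mulT, TensorProduct.lift.tmul,
    R.mul_vtx_vtx, (R.isGroupLikeElem_vtx _).counit_eq_one, R.reassoc_vtx, smul_eq_mul,
    ← R.groupGauge_apply, ← R.groupGauge_inv_apply, Cocycle3.twist]
  push_cast
  field_simp

/-- The twisted product of a vertex and an arrow is a multiple of the old one, up to degree zero. -/
lemma twist_mul_vtx_arr (T : A.Gauge) (f : G) {y x : G} {m : M} (hm : m ∈ P.comp (y, x)) :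
    ∃ a b : k, (A.twist T).mul (R.vtx f) (R.arr m) =
      ((R.groupGauge T f x / R.groupGauge T f y : kˣ) : k) • R.arr (P.lact f m) +
        (a • R.vtx (f * y) + b • R.vtx (f * x)) := by
  have h := ((R.skewPrimitive_arr hm).groupLike_tmul (R.isGroupLikeElem_vtx f)).convL_convR
    (isGroupLikeElem_tmul (R.isGroupLikeElem_vtx f) (R.isGroupLikeElem_vtx x)) T.inv T.F A.mulT
  refine ⟨T.inv (R.vtx f ⊗ₜ R.vtx y) * T.F (R.vtx f ⊗ₜ R.arr m),
    T.inv (R.vtx f ⊗ₜ R.arr m) * T.F (R.vtx f ⊗ₜ R.vtx x), h.trans ?_⟩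
  simp only [MajidData.mulT, TensorProduct.lift.tmul, R.mul_vtx_vtx, R.mul_vtx_arr]
  rw [add_assoc]
  congr 2
  rw [← R.groupGauge_apply, ← R.groupGauge_inv_apply, Units.val_div_eq_div_val]
  field_simp

lemma twist_mul_arr_vtx (T : A.Gauge) (f : G) {y x : G} {m : M} (hm : m ∈ P.comp (y, x)) :
    ∃ a b : k, (A.twist T).mul (R.arr m) (R.vtx f) =
      ((R.groupGauge T x f / R.groupGauge T y f : kˣ) : k) • R.arr (P.ract f m) +
        (a • R.vtx (y * f) + b • R.vtx (x * f)) := by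
  have h := ((R.skewPrimitive_arr hm).tmul_groupLike (R.isGroupLikeElem_vtx f)).convL_convR
    (isGroupLikeElem_tmul (R.isGroupLikeElem_vtx x) (R.isGroupLikeElem_vtx f)) T.inv T.F A.mulT
  refine ⟨T.inv (R.vtx y ⊗ₜ R.vtx f) * T.F (R.arr m ⊗ₜ R.vtx f),
    T.inv (R.arr m ⊗ₜ R.vtx f) * T.F (R.vtx x ⊗ₜ R.vtx f), h.trans ?_⟩
  simp only [MajidData.mulT, TensorProduct.lift.tmul, R.mul_vtx_vtx, R.mul_arr_vtx]
  rw [add_assoc]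
  congr 2
  rw [← R.groupGauge_apply, ← R.groupGauge_inv_apply, Units.val_div_eq_div_val]
  field_simp

/-- The degree-one part of a coalgebra isomorphism. -/
def arrowPart (ψ : C ≃ₗc[k] C') : M →ₗ[k] N :=
  deg1 ∘ₗ S.j.toLinearMap ∘ₗ (ψ : C →ₗc[k] C').toLinearMap ∘ₗ R.arr

lemma arrowPart_apply (ψ : C ≃ₗc[k] C') (m : M) :
    R.arrowPart S ψ m = deg1 (S.j (ψ (R.arr m))) := rfl

section

variable {R S} {ψ : C ≃ₗc[k] C'} {σ : G ≃ G} (hσ : ∀ g, ψ (R.vtx g) = S.vtx (σ g))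
include hσ

lemma skewPrimitive_map_arr {y x : G} {m : M} (hm : m ∈ P.comp (y, x)) :
    SkewPrimitive k (vertex (P := Q) ⟨σ y⟩) (vertex ⟨σ x⟩) (S.j (ψ (R.arr m))) := by
  have := ((R.skewPrimitive_arr hm).map (ψ : C →ₗc[k] C')).map S.j
  change SkewPrimitive k (S.j (ψ (R.vtx y))) (S.j (ψ (R.vtx x))) _ at this
  rwa [hσ, hσ, S.j_vtx, S.j_vtx] at this

lemma arrowPart_mem {y x : G} {m : M} (hm : m ∈ P.comp (y, x)) :
    R.arrowPart S ψ m ∈ Q.comp (σ y, σ x) :=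
  SkewPrimitive.deg1_mem (skewPrimitive_map_arr hσ hm)

lemma j_map_arr {y x : G} {m : M} (hm : m ∈ P.comp (y, x)) :
    S.j (ψ (R.arr m)) = base (S.j (ψ (R.arr m))) + incl (R.arrowPart S ψ m) :=
  SkewPrimitive.eq_base_add_incl (skewPrimitive_map_arr hσ hm)

lemma symm_vtx (g : G) : ψ.symm (S.vtx g) = R.vtx (σ.symm g) := by
  rw [← CoalgEquiv.symm_apply_apply ψ (R.vtx (σ.symm g)), hσ, Equiv.apply_symm_apply]

lemma arrowPart_arrowPart (m : M) : S.arrowPart R ψ.symm (R.arrowPart S ψ m) = m := by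
  refine P.eq_of_comp (S.arrowPart R ψ.symm ∘ₗ R.arrowPart S ψ) LinearMap.id
    (fun p m hm => ?_) m
  have hj := j_map_arr hσ hm
  obtain ⟨b, hb, hb'⟩ : ∃ b ∈ Submodule.span k (Set.range S.vtx),
      S.j b = base (S.j (ψ (R.arr m))) := by
    have h := base_mem_span (S.j (ψ (R.arr m)))
    have h2 : (Set.range fun g : G => vertex (P := Q) ⟨g⟩) = S.j.toLinearMap '' Set.range S.vtx := by
      rw [← Set.range_comp]
      exact congrArg _ (funext fun g => (S.j_vtx g).symm)
    rw [h2, ← Submodule.map_span] at h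
    exact h
  have h1 : S.arr (R.arrowPart S ψ m) = ψ (R.arr m) - b := by
    apply S.inj
    rw [S.j_arr, map_sub, hb', eq_sub_iff_add_eq', ← hj]
  have h2 : deg1 (R.j (ψ.symm b)) = 0 := by
    clear h1 hb'
    induction hb using Submodule.span_induction with
    | mem b hb =>
      obtain ⟨g, rfl⟩ := hb
      rw [symm_vtx hσ, R.j_vtx, deg1_vertex]
    | zero => simp
    | add a b _ _ ha hb => simp only [map_add, ha, hb, add_zero]
    | smul c b _ hb => simp only [map_smul, hb, smul_zero]
  rw [LinearMap.comp_apply, LinearMap.id_apply, S.arrowPart_apply, h1, map_sub, map_sub, map_sub,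
    h2, sub_zero, CoalgEquiv.symm_apply_apply, R.j_arr, deg1_incl]

end

lemma deg1_mul_vertex_base (f : G) (u : PathSpace P) :
    deg1 (mul (vertex (P := P) ⟨f⟩) (base u)) = 0 := by
  rw [← base_vertex, ← base_mul, deg1_base]

lemma deg1_mul_base_vertex (f : G) (u : PathSpace P) :
    deg1 (mul (base u) (vertex (P := P) ⟨f⟩)) = 0 := by
  rw [← base_vertex, ← base_mul, deg1_base]

section

variable {R S} {ψ : C ≃ₗc[k] C'} {T : A.Gauge} (hψ : (A.twist T).IsIso A' ψ)
include hψ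

/-- An isomorphism `H_F ≅ H'` acts on the group by an automorphism. -/
lemma exists_mulEquiv (R : Realization P A) (S : Realization Q A') :
    ∃ σ : G ≃* G, ∀ g, ψ (R.vtx g) = S.vtx (σ g) := by
  obtain ⟨σ, hσ⟩ := R.exists_equiv S ψ
  refine ⟨⟨σ, fun g h => S.vtx_injective ?_⟩, hσ⟩
  change S.vtx (σ (g * h)) = S.vtx (σ g * σ h)
  rw [← hσ, ← R.twist_mul_vtx_vtx T, hψ.1, hσ, hσ, S.mul_vtx_vtx]

variable {σ : G ≃* G} (hσ : ∀ g, ψ (R.vtx g) = S.vtx (σ g))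
include hσ

lemma arrowPart_lact (f : G) {y x : G} {m : M} (hm : m ∈ P.comp (y, x)) :
    ((R.groupGauge T f x / R.groupGauge T f y : kˣ) : k) • R.arrowPart S ψ (P.lact f m) =
      Q.lact (σ f) (R.arrowPart S ψ m) := by
  have hσ' : ∀ g, ψ (R.vtx g) = S.vtx (σ.toEquiv g) := hσ
  obtain ⟨a, b, h⟩ := R.twist_mul_vtx_arr T f hm
  have h1 := congrArg (fun c => deg1 (S.j c)) (hψ.1 (R.vtx f) (R.arr m))
  simp only [h, map_add, map_smul, hσ, S.j_vtx, deg1_vertex, smul_zero, add_zero, S.j_mul] at h1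
  rw [j_map_arr hσ' hm, map_add, map_add, deg1_mul_vertex_base, zero_add, mul_vertex_incl,
    deg1_incl] at h1
  exact h1

lemma arrowPart_ract (f : G) {y x : G} {m : M} (hm : m ∈ P.comp (y, x)) :
    ((R.groupGauge T x f / R.groupGauge T y f : kˣ) : k) • R.arrowPart S ψ (P.ract f m) =
      Q.ract (σ f) (R.arrowPart S ψ m) := by
  have hσ' : ∀ g, ψ (R.vtx g) = S.vtx (σ.toEquiv g) := hσ
  obtain ⟨a, b, h⟩ := R.twist_mul_arr_vtx T f hm
  have h1 := congrArg (fun c => deg1 (S.j c)) (hψ.1 (R.arr m) (R.vtx f))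
  simp only [h, map_add, map_smul, hσ, S.j_vtx, deg1_vertex, smul_zero, add_zero, S.j_mul] at h1
  rw [j_map_arr hσ' hm, map_add, LinearMap.add_apply, map_add, deg1_mul_base_vertex, zero_add,
    mul_incl_vertex, deg1_incl] at h1
  exact h1

/-- Gauge equivalent Majid algebras come from gauge equivalent bimodules. -/
theorem gaugeEquiv_pullback : P.GaugeEquiv (Q.pullback σ) := by
  have hσ' : ∀ g, ψ (R.vtx g) = S.vtx (σ.toEquiv g) := hσ
  refine ⟨R.groupGauge T, ?_, ?_⟩
  · have h : ∀ x y z, Φ'.pullback σ x y z = Φ.twist (R.groupGauge T) x y z := fun x y z =>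
      Units.ext (by
        rw [← R.twist_reassoc_vtx, ← hψ.2.2, hσ, hσ, hσ, S.reassoc_vtx]
        rfl)
    generalize Φ'.pullback σ = Ψ₁ at h ⊢
    generalize Φ.twist (R.groupGauge T) = Ψ₂ at h ⊢
    obtain ⟨a, _, _, _, _⟩ := Ψ₁
    obtain ⟨b, _, _, _, _⟩ := Ψ₂
    obtain rfl : a = b := funext fun x => funext fun y => funext fun z => h x y z
    rfl
  · let φ : M ≃ₗ[k] N := LinearEquiv.ofLinearMap (R.arrowPart S ψ) (S.arrowPart R ψ.symm)
      (LinearMap.ext fun n => arrowPart_arrowPart (ψ := ψ.symm) (symm_vtx hσ') n)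
      (LinearMap.ext fun m => arrowPart_arrowPart hσ' m)
    refine (Bimodule.isIso_twist_iff P (Q.pullback σ) _).2 ⟨φ, fun p m => ⟨fun hm =>
      arrowPart_mem hσ' hm, fun hm => ?_⟩, fun f y x m hm => arrowPart_lact hψ hσ f hm,
      fun f y x m hm => arrowPart_ract hψ hσ f hm⟩
    have h1 := arrowPart_mem (symm_vtx hσ') (m := φ m) hm
    have h2 : S.arrowPart R ψ.symm (φ m) = m := arrowPart_arrowPart hσ' m
    rw [h2] at h1
    simpa using h1

end

end Realization

end realization

/-! ### Transport of the path coalgebra along a map of bimodules -/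

section transport

variable {k : Type*} {G : Type*} [Field k] [Group G] {Φ Φ' : Cocycle3 k G} {M N : Type*}
  [AddCommGroup M] [Module k M] [AddCommGroup N] [Module k N]
  {P : Bimodule Φ M} {Q : Bimodule Φ' N}

namespace PathSpace

lemma proj_of_proj_ne {v w : HopfQuiver P} (h : v ≠ w) (u : PathSpace P) :
    proj w (proj v u) = 0 := by
  refine LinearMap.congr_fun (f := proj w ∘ₗ proj v) (g := 0) (hom_ext fun x y p => ?_) u
  by_cases hy : y = v
  · subst hy
    simp [proj_path, proj_of_ne _ h]
  · simp [proj_of_ne _ hy]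

lemma counit_concat (m : M) (u : PathSpace P) : counit (concat m u) = 0 :=
  comp_concat_eq_zero (fun _ _ => counit_append) m u

lemma mul_vertex_concat {z w : G} {m : M} (hm : m ∈ P.comp (z, w)) (x : HopfQuiver P)
    (v : PathSpace P) : mul (vertex x) (concat m v) =
      concat (P.lact x.val m) (mul (vertex x) (proj ⟨w⟩ v)) := by
  refine P.comp_ext (a := mul (vertex x) ∘ₗ (concat (P := P)).flip v)
    (b := (concat (P := P)).flip (mul (vertex x) (proj ⟨w⟩ v)) ∘ₗ P.lact x.val) (fun e => ?_) hm
  have h := mul_vertex_append (P := P) (w := ⟨w⟩) (z := ⟨z⟩) x e v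
  rw [← concat_arrow] at h
  exact h

lemma mul_concat_vertex {z w : G} {m : M} (hm : m ∈ P.comp (z, w)) (x : HopfQuiver P)
    (u : PathSpace P) : mul (concat m u) (vertex x) =
      concat (P.ract x.val m) (mul (proj ⟨w⟩ u) (vertex x)) := by
  refine P.comp_ext (a := mul.flip (vertex x) ∘ₗ (concat (P := P)).flip u)
    (b := (concat (P := P)).flip (mul (proj ⟨w⟩ u) (vertex x)) ∘ₗ P.ract x.val) (fun e => ?_) hm
  have h := mul_append_vertex (P := P) (w := ⟨w⟩) (z := ⟨z⟩) e x u
  rw [← concat_arrow] at h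
  exact h

lemma mul_concat_concat {z w z' w' : G} {m m' : M} (hm : m ∈ P.comp (z, w))
    (hm' : m' ∈ P.comp (z', w')) (u v : PathSpace P) : mul (concat m u) (concat m' v) =
      concat (P.ract z' m) (mul (proj ⟨w⟩ u) (concat m' v)) +
        concat (P.lact z m') (mul (concat m u) (proj ⟨w'⟩ v)) := by
  refine P.comp_ext (a := mul.flip (concat m' v) ∘ₗ (concat (P := P)).flip u)
    (b := (concat (P := P)).flip (mul (proj ⟨w⟩ u) (concat m' v)) ∘ₗ P.ract z' +
      concat (P.lact z m') ∘ₗ mul.flip (proj ⟨w'⟩ v) ∘ₗ (concat (P := P)).flip u) (fun e => ?_) hm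
  refine P.comp_ext (a := mul (concat (P.basis ⟨(z, w), e⟩) u) ∘ₗ (concat (P := P)).flip v)
    (b := concat (P.ract z' (P.basis ⟨(z, w), e⟩)) ∘ₗ mul (proj ⟨w⟩ u) ∘ₗ (concat (P := P)).flip v +
      (concat (P := P)).flip (mul (concat (P.basis ⟨(z, w), e⟩) u) (proj ⟨w'⟩ v)) ∘ₗ P.lact z)
    (fun e' => ?_) hm'
  have h := mul_append_append (P := P) (w := ⟨w⟩) (z := ⟨z⟩) (w' := ⟨w'⟩) (z' := ⟨z'⟩) e e' u v
  rw [← concat_arrow, ← concat_arrow] at h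
  exact h

/-- The image of a path under the map of quivers `σ`, `φ`: every arrow is replaced by its image in
`N` and the results are concatenated. -/
def mapPath (φ : M →ₗ[k] N) (σ : G → G) :
    ∀ {x y : HopfQuiver P}, Quiver.Path x y → PathSpace Q
  | x, _, .nil => vertex ⟨σ x.val⟩
  | _, _, .cons p e => concat (φ (arrow e)) (mapPath φ σ p)

/-- The map of path coalgebras induced by a map `φ : M → N` of bigraded spaces over `σ : G → G`. -/
def map (φ : M →ₗ[k] N) (σ : G → G) : PathSpace P →ₗ[k] PathSpace Q :=
  lin fun _ _ p => mapPath φ σ p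

lemma map_vertex (φ : M →ₗ[k] N) (σ : G → G) (x : HopfQuiver P) :
    map φ σ (vertex x) = vertex (P := Q) ⟨σ x.val⟩ := by
  simp [map, vertex, mapPath]

lemma map_cons (φ : M →ₗ[k] N) (σ : G → G) {x y z : HopfQuiver P} (p : Quiver.Path x y)
    (e : y ⟶ z) : map φ σ (path (p.cons e)) =
      concat (P := Q) (φ (arrow e)) (map φ σ (path p)) := by
  simp [map, mapPath]

lemma base_map (φ : M →ₗ[k] N) (σ : G → G) (u : PathSpace P) :
    base (map (Q := Q) φ σ u) = map φ σ (base u) := by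
  refine LinearMap.congr_fun (f := base ∘ₗ map φ σ) (g := map φ σ ∘ₗ base)
    (hom_ext fun x y p => ?_) u
  cases p with
  | nil =>
    change base (map φ σ (vertex x)) = map φ σ (base (vertex x))
    rw [base_vertex, map_vertex, base_vertex]
  | cons p e => rw [LinearMap.comp_apply, LinearMap.comp_apply, map_cons, base_concat, base_cons,
      map_zero]

section

variable {φ : M →ₗ[k] N} {σ : G → G} (hσ : Function.Injective σ)
  (hφ : ∀ y x m, m ∈ P.comp (y, x) → φ m ∈ Q.comp (σ y, σ x))
include hφ

lemma proj_map {x y : HopfQuiver P} (p : Quiver.Path x y) :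
    proj ⟨σ y.val⟩ (map (Q := Q) φ σ (path p)) = map φ σ (path p) := by
  cases p with
  | nil =>
    change proj _ (map φ σ (vertex x)) = map φ σ (vertex x)
    rw [map_vertex]
    exact proj_path _
  | cons p e => rw [map_cons, proj_concat (hφ _ _ _ (arrow_mem e))]

include hσ

lemma map_append {w z : HopfQuiver P} (e : w ⟶ z) (u : PathSpace P) :
    map φ σ (append e u) = concat (P := Q) (φ (arrow e)) (map φ σ u) := by
  refine LinearMap.congr_fun (f := map φ σ ∘ₗ append e)
    (g := concat (P := Q) (φ (arrow e)) ∘ₗ map φ σ) (hom_ext fun x y p => ?_) u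
  by_cases hy : y = w
  · subst hy
    rw [LinearMap.comp_apply, append_cons, map_cons, LinearMap.comp_apply]
  · have h : (⟨σ y.val⟩ : HopfQuiver Q) ≠ ⟨σ w.val⟩ := fun h =>
      hy (HopfQuiver.ext (hσ (congrArg HopfQuiver.val h)))
    rw [LinearMap.comp_apply, append_of_ne _ _ hy, map_zero, LinearMap.comp_apply,
      ← concat_proj (hφ _ _ _ (arrow_mem e)), ← proj_map hφ, proj_of_proj_ne h, map_zero]

lemma map_concat (m : M) (u : PathSpace P) :
    map φ σ (concat m u) = concat (P := Q) (φ m) (map φ σ u) := by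
  refine LinearMap.congr_fun (f := map φ σ ∘ₗ (concat (P := P)).flip u)
    (g := (concat (P := Q)).flip (map φ σ u) ∘ₗ φ) (arrow_ext (P := P) fun x y e => ?_) m
  simp only [LinearMap.comp_apply, LinearMap.flip_apply, concat_arrow]
  exact map_append hσ hφ e u

lemma map_map_comul (u : PathSpace P) :
    TensorProduct.map (map φ σ) (map φ σ) (comul u) = comul (map (Q := Q) φ σ u) := by
  refine LinearMap.congr_fun (f := TensorProduct.map (map φ σ) (map φ σ) ∘ₗ comul)
    (g := comul ∘ₗ map φ σ) (hom_ext fun x y p => ?_) u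
  induction p with
  | nil =>
    change TensorProduct.map (map φ σ) (map φ σ) (comul (vertex x)) = comul (map φ σ (vertex x))
    rw [comul_vertex, TensorProduct.map_tmul, map_vertex, comul_vertex]
  | cons p e ih =>
    simp only [LinearMap.comp_apply] at ih ⊢
    have h : map φ σ ∘ₗ append e = concat (P := Q) (φ (arrow e)) ∘ₗ map φ σ :=
      LinearMap.ext fun u => map_append hσ hφ e u
    rw [map_cons, comul_concat (hφ _ _ _ (arrow_mem e)), ← ih, comul_cons, map_add,
      TensorProduct.map_tmul, map_vertex, map_cons,
      ← LinearMap.comp_apply (TensorProduct.map (map φ σ) (map φ σ)),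
      LinearMap.map_comp_rTensor, h, ← LinearMap.rTensor_comp_map, LinearMap.comp_apply]

/-- The induced map is a map of coalgebras. -/
def mapHom : PathSpace P →ₗc[k] PathSpace Q where
  toLinearMap := map φ σ
  counit_comp := hom_ext fun x y p => by
    change counit (map φ σ (path p)) = counit (path p)
    cases p with
    | nil =>
      change counit (map φ σ (vertex x)) = counit (vertex x)
      rw [map_vertex, counit_vertex, counit_vertex]
    | cons p e => rw [map_cons, counit_concat, counit_cons]
  map_comp_comul := LinearMap.ext fun u => map_map_comul hσ hφ u

end

lemma map_map_inverse {φ : M →ₗ[k] N} {σ : G → G} {φ' : N →ₗ[k] M} {σ' : G → G}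
    (hσ' : Function.Injective σ') (hφ' : ∀ y x m, m ∈ Q.comp (y, x) → φ' m ∈ P.comp (σ' y, σ' x))
    (h : ∀ m, φ' (φ m) = m) (h' : ∀ g, σ' (σ g) = g) (u : PathSpace P) :
    map φ' σ' (map (Q := Q) φ σ u) = u := by
  refine LinearMap.congr_fun (f := map φ' σ' ∘ₗ map (Q := Q) φ σ) (g := LinearMap.id)
    (hom_ext fun x y p => ?_) u
  induction p with
  | nil =>
    change map φ' σ' (map (Q := Q) φ σ (vertex x)) = vertex x
    rw [map_vertex, map_vertex, h']
  | cons p e ih =>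
    rw [LinearMap.comp_apply, LinearMap.id_apply] at ih ⊢
    rw [map_cons, map_concat hσ' hφ', ih, h, concat_arrow, append_cons]

/-- An isomorphism of bigraded spaces over a bijection of `G` induces an isomorphism of path
coalgebras. -/
def mapEquiv (φ : M ≃ₗ[k] N) (σ : G ≃* G)
    (hφ : ∀ p m, m ∈ P.comp p ↔ φ m ∈ Q.comp (σ p.1, σ p.2)) : PathSpace P ≃ₗc[k] PathSpace Q :=
  have h1 : ∀ y x m, m ∈ P.comp (y, x) → φ m ∈ Q.comp (σ y, σ x) := fun y x m => (hφ (y, x) m).1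
  have h2 : ∀ y x m, m ∈ Q.comp (y, x) → φ.symm m ∈ P.comp (σ.symm y, σ.symm x) :=
    fun y x m hm => (hφ _ _).2 (by simpa using hm)
  { toCoalgHom := mapHom (φ := φ.toLinearMap) σ.injective h1
    invFun := map φ.symm.toLinearMap σ.symm
    left_inv := map_map_inverse σ.symm.injective h2 (fun m => φ.symm_apply_apply m)
      σ.symm_apply_apply
    right_inv := map_map_inverse σ.injective h1 (fun m => φ.apply_symm_apply m)
      σ.apply_symm_apply }

/-- For an isomorphism out of the twisted bimodule, the induced map of path spaces is multiplicative
up to the scalar `F(x,x')/F(y,y')` on paths from `x` to `y` and from `x'` to `y'`. -/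
lemma map_mulPath {φ : M →ₗ[k] N} {σ : G ≃* G} {F : GroupGauge k G}
    (hφ : ∀ y x m, m ∈ P.comp (y, x) → φ m ∈ Q.comp (σ y, σ x))
    (hl : ∀ f y x m, m ∈ P.comp (y, x) →
      ((F f x / F f y : kˣ) : k) • φ (P.lact f m) = Q.lact (σ f) (φ m))
    (hr : ∀ f y x m, m ∈ P.comp (y, x) →
      ((F x f / F y f : kˣ) : k) • φ (P.ract f m) = Q.ract (σ f) (φ m))
    {x y x' y' : HopfQuiver P} (p : Quiver.Path x y) (q : Quiver.Path x' y') :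
    ((F x.val x'.val / F y.val y'.val : kˣ) : k) • map φ σ (mulPath p q) =
      mul (map (Q := Q) φ σ (path p)) (map φ σ (path q)) := by
  have hσ : Function.Injective σ := σ.injective
  -- one step of the recursion: the scalar of the action completes the scalar of the shorter product
  have step : ∀ (a b c : kˣ) (n n' : N) (u v : PathSpace Q), ((b / c : kˣ) : k) • n = n' →
      ((a / b : kˣ) : k) • u = v →
      ((a / c : kˣ) : k) • concat (P := Q) n u = concat (P := Q) n' v := by
    rintro a b c n _ u _ rfl rfl
    rw [map_smul, map_smul, LinearMap.smul_apply, smul_smul]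
    congr 1
    push_cast
    field_simp
  induction p generalizing y' with
  | nil =>
    induction q with
    | nil =>
      change _ = mul (map φ σ (vertex x)) (map φ σ (vertex x'))
      rw [div_self', Units.val_one, one_smul, mulPath_nil_nil, map_vertex, map_vertex, map_vertex,
        mul_vertex_vertex, map_mul]
    | cons q b ih =>
      have h0 : map (Q := Q) φ σ (path (.nil : Quiver.Path x x)) = vertex ⟨σ x.val⟩ :=
        map_vertex φ σ x
      rw [h0] at ih ⊢
      rw [mulPath_nil_cons, map_concat hσ hφ, map_cons,
        mul_vertex_concat (hφ _ _ _ (arrow_mem b)), proj_map hφ]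
      exact step _ _ _ _ _ _ _ (hl _ _ _ _ (arrow_mem b)) ih
  | @cons y z p a ihp =>
    induction q with
    | nil =>
      have h0 : map (Q := Q) φ σ (path (.nil : Quiver.Path x' x')) = vertex ⟨σ x'.val⟩ :=
        map_vertex φ σ x'
      have ih := ihp (.nil : Quiver.Path x' x')
      rw [h0] at ih ⊢
      rw [mulPath_cons_nil, map_concat hσ hφ, map_cons,
        mul_concat_vertex (hφ _ _ _ (arrow_mem a)), proj_map hφ]
      exact step _ _ _ _ _ _ _ (hr _ _ _ _ (arrow_mem a)) ih
    | cons q b ihq =>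
      have ih := ihp (q.cons b)
      rw [map_cons] at ih ihq
      rw [mulPath_cons_cons, map_add, smul_add, map_concat hσ hφ, map_concat hσ hφ, map_cons,
        map_cons, mul_concat_concat (hφ _ _ _ (arrow_mem a)) (hφ _ _ _ (arrow_mem b)),
        proj_map hφ, proj_map hφ]
      exact congrArg₂ (· + ·) (step _ _ _ _ _ _ _ (hr _ _ _ _ (arrow_mem a)) ih)
        (step _ _ _ _ _ _ _ (hl _ _ _ _ (arrow_mem b)) ihq)

end PathSpace

end transport

/-! ### Restricting gauge transformations -/

section comap

variable {k C D : Type*} [Field k] [AddCommGroup C] [Module k C] [Coalgebra k C]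
  [AddCommGroup D] [Module k D] [Coalgebra k D]

namespace MajidData

/-- A map of coalgebras that respects product, unit and reassociator. -/
structure IsHom (A : MajidData k C) (B : MajidData k D) (j : C →ₗc[k] D) : Prop where
  map_mul : ∀ x y, j (A.mul x y) = B.mul (j x) (j y)
  map_one : j A.one = B.one
  map_reassoc : ∀ x y z, B.reassoc (j x ⊗ₜ (j y ⊗ₜ j z)) = A.reassoc (x ⊗ₜ (y ⊗ₜ z))

variable {A : MajidData k C} {B : MajidData k D} {j : C →ₗc[k] D} (hj : IsHom A B j)
include hj

/-- The restriction of a gauge transformation along a map of Majid algebras. -/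
def IsHom.comap (T : B.Gauge) : A.Gauge where
  F := T.F ∘ₗ (Coalgebra.TensorProduct.map j j).toLinearMap
  inv := T.inv ∘ₗ (Coalgebra.TensorProduct.map j j).toLinearMap
  conv_inv := by rw [convL_comp, T.conv_inv, CoalgHom.counit_comp]
  inv_conv := by rw [convL_comp, T.inv_conv, CoalgHom.counit_comp]
  apply_one h := by
    change T.F (j h ⊗ₜ j A.one) = _
    rw [hj.map_one, T.apply_one, CoalgHomClass.counit_comp_apply]
  one_apply h := by
    change T.F (j A.one ⊗ₜ j h) = _
    rw [hj.map_one, T.one_apply, CoalgHomClass.counit_comp_apply]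

lemma IsHom.comp_mulT : j.toLinearMap ∘ₗ A.mulT =
    B.mulT ∘ₗ (Coalgebra.TensorProduct.map j j).toLinearMap :=
  TensorProduct.ext' fun x y => hj.map_mul x y

/-- Restricting a gauge transformation commutes with twisting. -/
lemma IsHom.twist (T : B.Gauge) : IsHom (A.twist (hj.comap T)) (B.twist T) j where
  map_mul x y := by
    change (j.toLinearMap ∘ₗ convL (hj.comap T).inv (convR A.mulT (hj.comap T).F)) (x ⊗ₜ y) = _
    rw [← comp_convL, ← comp_convR, hj.comp_mulT, comap, convR_comp, convL_comp]
    rfl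
  map_one := hj.map_one
  map_reassoc x y z := by
    let J := Coalgebra.TensorProduct.map j (Coalgebra.TensorProduct.map j j)
    have h1 : (TensorProduct.lid k k).toLinearMap ∘ₗ
        TensorProduct.map Coalgebra.counit (hj.comap T).inv =
        ((TensorProduct.lid k k).toLinearMap ∘ₗ TensorProduct.map Coalgebra.counit T.inv) ∘ₗ
          J.toLinearMap := by
      refine TensorProduct.ext' fun x t => ?_
      change Coalgebra.counit (R := k) x * _ = Coalgebra.counit (R := k) (j x) * _
      rw [CoalgHomClass.counit_comp_apply]
      rfl
    have h2 : (hj.comap T).inv ∘ₗ TensorProduct.map LinearMap.id A.mulT =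
        (T.inv ∘ₗ TensorProduct.map LinearMap.id B.mulT) ∘ₗ J.toLinearMap := by
      refine TensorProduct.ext' fun x t => ?_
      exact congrArg (fun s => T.inv (j x ⊗ₜ s)) (LinearMap.congr_fun hj.comp_mulT t)
    have h3 : A.reassoc = B.reassoc ∘ₗ J.toLinearMap := by
      refine TensorProduct.ext' fun x t => ?_
      refine LinearMap.congr_fun (f := A.reassoc ∘ₗ TensorProduct.mk k _ _ x)
        (g := B.reassoc ∘ₗ TensorProduct.mk k _ _ (j x) ∘ₗ
          (Coalgebra.TensorProduct.map j j).toLinearMap) (TensorProduct.ext' fun y z => ?_) t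
      exact (hj.map_reassoc x y z).symm
    have h4 : (hj.comap T).F ∘ₗ TensorProduct.map A.mulT LinearMap.id ∘ₗ
        (TensorProduct.assoc k C C C).symm.toLinearMap =
        (T.F ∘ₗ TensorProduct.map B.mulT LinearMap.id ∘ₗ
          (TensorProduct.assoc k D D D).symm.toLinearMap) ∘ₗ J.toLinearMap := by
      refine TensorProduct.ext_threefold' fun x y z => ?_
      exact congrArg (fun s => T.F (s ⊗ₜ j z)) (hj.map_mul x y)
    have h5 : (TensorProduct.rid k k).toLinearMap ∘ₗ
        TensorProduct.map (hj.comap T).F Coalgebra.counit ∘ₗ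
          (TensorProduct.assoc k C C C).symm.toLinearMap =
        ((TensorProduct.rid k k).toLinearMap ∘ₗ TensorProduct.map T.F Coalgebra.counit ∘ₗ
          (TensorProduct.assoc k D D D).symm.toLinearMap) ∘ₗ J.toLinearMap := by
      refine TensorProduct.ext_threefold' fun x y z => ?_
      change Coalgebra.counit (R := k) z * T.F (j x ⊗ₜ j y) =
        Coalgebra.counit (R := k) (j z) * T.F (j x ⊗ₜ j y)
      rw [CoalgHomClass.counit_comp_apply]
    have h : (A.twist (hj.comap T)).reassoc = (B.twist T).reassoc ∘ₗ J.toLinearMap := by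
      simp only [MajidData.twist]
      rw [h1, h2, h3, h4, h5, convL_comp, convL_comp, convL_comp, convL_comp]
    rw [h]
    rfl

end MajidData

end comap

/-! ### From bimodules to Majid algebras -/

section gaugeOfGroup

variable {k : Type*} {G : Type*} [Field k] [Group G] {Φ Φ' : Cocycle3 k G} {M N : Type*}
  [AddCommGroup M] [Module k M] [AddCommGroup N] [Module k N]
  {P : Bimodule Φ M} {Q : Bimodule Φ' N}

namespace PathSpace

open MajidData

/-- The projection onto the vertices, as an endomorphism of the Majid algebra `H(M)`. -/
lemma isHom_baseHom : IsHom P.H P.H baseHom where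
  map_mul := base_mul
  map_one := base_vertex _
  map_reassoc u v w := by
    have key : ∀ {x y x' y' x'' y'' : HopfQuiver P} (p : Quiver.Path x y) (q : Quiver.Path x' y')
        (r : Quiver.Path x'' y''), reassoc P (base (path p) ⊗ₜ (base (path q) ⊗ₜ base (path r))) =
          reassoc P (path p ⊗ₜ (path q ⊗ₜ path r)) := by
      intro x y x' y' x'' y'' p q r
      by_cases hp : p.length = 0
      · by_cases hq : q.length = 0
        · by_cases hr : r.length = 0 <;> simp [base, reassoc, hp, hq, hr]
        · simp [base, reassoc, hq]
      · simp [base, reassoc, hp]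
    have h : reassoc P ∘ₗ TensorProduct.map base (TensorProduct.map base base) = reassoc P :=
      TensorProduct.ext (hom_ext fun x y p => TensorProduct.ext (hom_ext fun x' y' q =>
        hom_ext fun x'' y'' r => key p q r))
    exact LinearMap.congr_fun h (u ⊗ₜ (v ⊗ₜ w))

/-- The bilinear form that is `f` on pairs of vertices and `0` on paths of positive length. -/
def vertexForm (P : Bimodule Φ M) (f : G → G → k) : PathSpace P ⊗[k] PathSpace P →ₗ[k] k :=
  TensorProduct.lift <| lin fun x _ p => lin fun y _ q =>
    if p.length + q.length = 0 then f x.val y.val else 0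

lemma vertexForm_vertex (f : G → G → k) (x y : HopfQuiver P) :
    vertexForm P f (vertex x ⊗ₜ vertex y) = f x.val y.val := by
  simp [vertexForm, vertex]

lemma vertexForm_comp_base (f : G → G → k) :
    vertexForm P f ∘ₗ TensorProduct.map base base = vertexForm P f := by
  refine TensorProduct.ext (hom_ext fun x y p => hom_ext fun x' y' q => ?_)
  by_cases hp : p.length = 0
  · by_cases hq : q.length = 0 <;> simp [base, vertexForm, hp, hq]
  · simp [base, vertexForm, hp]

lemma convL_vertexForm {V : Type*} [AddCommGroup V] [Module k V] (f : G → G → k)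
    (h : PathSpace P ⊗[k] PathSpace P →ₗ[k] V) {x y x' y' : HopfQuiver P} (p : Quiver.Path x y)
    (q : Quiver.Path x' y') :
    convL (vertexForm P f) h (path p ⊗ₜ path q) = f y.val y'.val • h (path p ⊗ₜ path q) := by
  have h1 := rTensor_map_comul_tmul (k := k) (C := PathSpace P) (D := PathSpace P) (π := base)
    (ρ := base) (g := vertex y) (h := vertex y') (base_rTensor_comul p) (base_rTensor_comul q)
  have h2 := convL_of_rTensor h1 (vertexForm P f) h
  rwa [vertexForm_comp_base, vertexForm_vertex] at h2

lemma convR_vertexForm {V : Type*} [AddCommGroup V] [Module k V] (f : G → G → k)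
    (h : PathSpace P ⊗[k] PathSpace P →ₗ[k] V) {x y x' y' : HopfQuiver P} (p : Quiver.Path x y)
    (q : Quiver.Path x' y') :
    convR h (vertexForm P f) (path p ⊗ₜ path q) = f x.val x'.val • h (path p ⊗ₜ path q) := by
  have h1 := lTensor_map_comul_tmul (k := k) (C := PathSpace P) (D := PathSpace P) (π := base)
    (ρ := base) (g := vertex x) (h := vertex x') (base_lTensor_comul p) (base_lTensor_comul q)
  have h2 := convR_of_lTensor h1 h (vertexForm P f)
  rwa [vertexForm_comp_base, vertexForm_vertex] at h2

lemma convL_vertexForm_vertexForm (f g : G → G → k) (hfg : ∀ x y, f x y * g x y = 1) :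
    convL (vertexForm P f) (vertexForm P g) = Coalgebra.counit := by
  refine TensorProduct.ext (hom_ext fun x y p => hom_ext fun x' y' q => ?_)
  change convL (vertexForm P f) (vertexForm P g) (path p ⊗ₜ path q) =
    counit (path q) * counit (path p)
  rw [convL_vertexForm]
  cases p with
  | nil =>
    cases q with
    | nil =>
      change _ • vertexForm P g (vertex x ⊗ₜ vertex x') = counit (vertex x') * counit (vertex x)
      rw [vertexForm_vertex, counit_vertex, counit_vertex, smul_eq_mul, hfg, one_mul]
    | cons q b => simp [vertexForm, counit_cons]
  | cons p a => simp [vertexForm, counit_cons]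

lemma vertexForm_tmul_one (f : G → G → k) (hf : ∀ x, f x 1 = 1) (u : PathSpace P) :
    vertexForm P f (u ⊗ₜ vertex ⟨1⟩) = counit u := by
  refine LinearMap.congr_fun (f := vertexForm P f ∘ₗ (TensorProduct.mk k _ _).flip (vertex ⟨1⟩))
    (g := counit) (hom_ext fun x y p => ?_) u
  simp [vertexForm, vertex, counit, hf]

lemma vertexForm_one_tmul (f : G → G → k) (hf : ∀ x, f 1 x = 1) (u : PathSpace P) :
    vertexForm P f (vertex ⟨1⟩ ⊗ₜ u) = counit u := by
  refine LinearMap.congr_fun (f := vertexForm P f ∘ₗ TensorProduct.mk k _ _ (vertex ⟨1⟩))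
    (g := counit) (hom_ext fun x y p => ?_) u
  simp [vertexForm, vertex, counit, hf]

variable (P) in
/-- The gauge transformation on `H(M)` given by a gauge transformation on `G`, extended by `0` to
paths of positive length. -/
def vertexGauge (F : GroupGauge k G) : P.H.Gauge where
  F := vertexForm P fun x y => F x y
  inv := vertexForm P fun x y => ((F x y)⁻¹ : kˣ)
  conv_inv := convL_vertexForm_vertexForm _ _ fun _ _ => Units.mul_inv _
  inv_conv := convL_vertexForm_vertexForm _ _ fun _ _ => Units.inv_mul _
  apply_one := vertexForm_tmul_one _ fun x => by rw [F.map_one_right, Units.val_one]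
  one_apply := vertexForm_one_tmul _ fun x => by rw [F.map_one_left, Units.val_one]

lemma twist_vertexGauge_mul (F : GroupGauge k G) {x y x' y' : HopfQuiver P} (p : Quiver.Path x y)
    (q : Quiver.Path x' y') : (P.H.twist (vertexGauge P F)).mul (path p) (path q) =
      ((F x.val x'.val / F y.val y'.val : kˣ) : k) • mulPath p q := by
  change convL (vertexForm P fun x y => ((F x y)⁻¹ : kˣ))
    (convR P.H.mulT (vertexForm P fun x y => F x y)) (path p ⊗ₜ path q) = _
  rw [convL_vertexForm, convR_vertexForm, smul_smul]
  change _ • mul (path p) (path q) = _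
  rw [mul_path, div_eq_inv_mul, Units.val_mul]

/-- Twisting back with the inverse cochain recovers the product. -/
lemma convL_convR_twist_vertexGauge_mul (F : GroupGauge k G) :
    convL (vertexForm P fun x y => F x y)
      (convR (P.H.twist (vertexGauge P F)).mulT (vertexForm P fun x y => ((F x y)⁻¹ : kˣ))) =
      P.H.mulT := by
  refine TensorProduct.ext (hom_ext fun x y p => hom_ext fun x' y' q => ?_)
  change convL (vertexForm P fun x y => F x y) (convR (P.H.twist (vertexGauge P F)).mulT
    (vertexForm P fun x y => ((F x y)⁻¹ : kˣ))) (path p ⊗ₜ path q) = mul (path p) (path q)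
  rw [convL_vertexForm, convR_vertexForm, mulT, TensorProduct.lift.tmul, twist_vertexGauge_mul, smul_smul,
    smul_smul, mul_path, ← Units.val_mul, ← Units.val_mul]
  simp [div_eq_mul_inv, mul_assoc]

end PathSpace

end gaugeOfGroup

/-! ### Isomorphisms of Majid algebras induced by isomorphisms of bimodules -/

section correspondence

variable {k : Type*} {G : Type*} [Field k] [Group G] {Φ Φ' : Cocycle3 k G} {M N : Type*}
  [AddCommGroup M] [Module k M] [AddCommGroup N] [Module k N]

open PathSpace MajidData

/-- The realization of `H(M)` by the identity. -/
def Bimodule.realizationH (P : Bimodule Φ M) : Realization P P.H where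
  j := CoalgHom.id k _
  inj := Function.injective_id
  vtx := P.inclH
  j_vtx _ := rfl
  arr := incl
  j_arr _ := rfl
  j_mul _ _ := rfl
  one_eq := rfl
  reassoc_eq _ _ _ := rfl

lemma Bimodule.incl_mem_BSpace (P : Bimodule Φ M) (m : M) : incl m ∈ P.BSpace := by
  have h : P.BSpace.mkQ ∘ₗ incl = 0 := arrow_ext (P := P) fun x y e => by
    rw [LinearMap.comp_apply, incl_arrow, Submodule.mkQ_apply, LinearMap.zero_apply,
      Submodule.Quotient.mk_eq_zero]
    exact P.arrow_mem_BSpace e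
  simpa using LinearMap.congr_fun h m

/-- The realization of `B(M)` by its inclusion into `H(M)`. -/
def Bimodule.realizationB (P : Bimodule Φ M) : Realization P P.B where
  j := { toLinearMap := P.BSpace.subtype
         counit_comp := rfl
         map_comp_comul := LinearMap.ext fun u => map_subComul P.BSpace P.comul_mem u }
  inj := P.BSpace.subtype_injective
  vtx := P.inclB
  j_vtx _ := rfl
  arr := incl.codRestrict P.BSpace P.incl_mem_BSpace
  j_arr _ := rfl
  j_mul _ _ := rfl
  one_eq := rfl
  reassoc_eq _ _ _ := rfl

variable {P : Bimodule Φ M} {Q : Bimodule Φ' N}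

lemma MajidData.Gauge.ext_forms {H : Type*} [AddCommGroup H] [Module k H] [Coalgebra k H]
    {A : MajidData k H} {T T' : A.Gauge} (h : T.F = T'.F) (h' : T.inv = T'.inv) : T = T' := by
  obtain ⟨F, I, _, _, _, _⟩ := T
  obtain ⟨F', I', _, _, _, _⟩ := T'
  obtain rfl : F = F' := h
  obtain rfl : I = I' := h'
  rfl

namespace PathSpace

lemma comap_base_vertexGauge (F : GroupGauge k G) :
    (isHom_baseHom (P := P)).comap (vertexGauge P F) = vertexGauge P F :=
  Gauge.ext_forms (vertexForm_comp_base (P := P) fun x y => (F x y : k))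
    (vertexForm_comp_base (P := P) fun x y => ((F x y)⁻¹ : kˣ))

lemma groupGauge_vertexGauge (F : GroupGauge k G) :
    P.realizationH.groupGauge (vertexGauge P F) = F := by
  have h : ∀ x y, P.realizationH.groupGauge (vertexGauge P F) x y = F x y := fun x y =>
    Units.ext (vertexForm_vertex (P := P) (fun x y => (F x y : k)) ⟨x⟩ ⟨y⟩)
  generalize P.realizationH.groupGauge (vertexGauge P F) = F' at h
  obtain ⟨a, _, _⟩ := F
  obtain ⟨b, _, _⟩ := F'
  obtain rfl : b = a := funext fun x => funext fun y => h x y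
  rfl

variable {φ : M ≃ₗ[k] N} {σ : G ≃* G} {F : GroupGauge k G}
  (hΦ : Φ'.pullback σ = Φ.twist F)
  (hφ : ∀ p m, m ∈ P.comp p ↔ φ m ∈ Q.comp (σ p.1, σ p.2))
  (hl : ∀ f y x m, m ∈ P.comp (y, x) →
    ((F f x / F f y : kˣ) : k) • φ (P.lact f m) = Q.lact (σ f) (φ m))
  (hr : ∀ f y x m, m ∈ P.comp (y, x) →
    ((F x f / F y f : kˣ) : k) • φ (P.ract f m) = Q.ract (σ f) (φ m))

include hl hr in
lemma mapEquiv_twist_mul (u v : PathSpace P) :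
    mapEquiv φ σ hφ ((P.H.twist (vertexGauge P F)).mul u v) =
      mul (mapEquiv φ σ hφ u) (mapEquiv φ σ hφ v) := by
  have : (P.H.twist (vertexGauge P F)).mul.compr₂ (map (Q := Q) φ.toLinearMap σ) =
      mul.compl₁₂ (map φ.toLinearMap σ) (map φ.toLinearMap σ) :=
    hom_ext fun x y p => hom_ext fun x' y' q => by
      rw [LinearMap.compr₂_apply, twist_vertexGauge_mul, LinearMap.map_smul,
        LinearMap.compl₁₂_apply]
      exact map_mulPath (fun y x m => (hφ (y, x) m).1) hl hr p q
  exact LinearMap.congr_fun₂ this u v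

include hΦ in
lemma reassoc_mapEquiv (u v w : PathSpace P) :
    reassoc Q (mapEquiv φ σ hφ u ⊗ₜ (mapEquiv φ σ hφ v ⊗ₜ mapEquiv φ σ hφ w)) =
      (P.H.twist (vertexGauge P F)).reassoc (u ⊗ₜ (v ⊗ₜ w)) := by
  let T := map (P := P) (Q := Q) φ.toLinearMap σ
  -- both sides factor through the projection onto the vertices
  have h1 : ∀ u v w, (P.H.twist (vertexGauge P F)).reassoc (base u ⊗ₜ (base v ⊗ₜ base w)) =
      (P.H.twist (vertexGauge P F)).reassoc (u ⊗ₜ (v ⊗ₜ w)) := fun u v w => by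
    have := ((isHom_baseHom (P := P)).twist (vertexGauge P F)).map_reassoc u v w
    rwa [comap_base_vertexGauge] at this
  have h2 : ∀ u v w, reassoc Q (T (base u) ⊗ₜ (T (base v) ⊗ₜ T (base w))) =
      reassoc Q (T u ⊗ₜ (T v ⊗ₜ T w)) := fun u v w => by
    simp only [T, ← base_map]
    exact (isHom_baseHom (P := Q)).map_reassoc _ _ _
  have h3 : reassoc Q ∘ₗ TensorProduct.map T (TensorProduct.map T T) =
      (P.H.twist (vertexGauge P F)).reassoc :=
    TensorProduct.ext (hom_ext fun x y p => TensorProduct.ext (hom_ext fun x' y' q =>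
      hom_ext fun x'' y'' r => by
        change reassoc Q (T (path p) ⊗ₜ (T (path q) ⊗ₜ T (path r))) =
          (P.H.twist (vertexGauge P F)).reassoc (path p ⊗ₜ (path q ⊗ₜ path r))
        rw [← h1, ← h2]
        cases p with
        | cons p e => simp [base_cons]
        | nil =>
          cases q with
          | cons q e => simp [base_cons]
          | nil =>
            cases r with
            | cons r e => simp [base_cons]
            | nil =>
              have h4 : ∀ x : HopfQuiver P, base (path (.nil : Quiver.Path x x)) = vertex x :=
                base_vertex
              have h5 : ∀ x : HopfQuiver P, T (vertex x) = vertex ⟨σ x.val⟩ := map_vertex _ _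
              have h6 := P.realizationH.twist_reassoc_vtx (vertexGauge P F) x.val x'.val x''.val
              rw [groupGauge_vertexGauge, ← hΦ] at h6
              rw [h4, h4, h4, h5, h5, h5, reassoc_vertex]
              exact h6.symm))
  exact LinearMap.congr_fun h3 (u ⊗ₜ (v ⊗ₜ w))

include hΦ hl hr in
/-- The induced map of path coalgebras is an isomorphism `H(M)_F ≅ H(N)`. -/
lemma isHom_mapEquiv : IsHom (P.H.twist (vertexGauge P F)) Q.H (mapEquiv φ σ hφ) where
  map_mul := mapEquiv_twist_mul hφ hl hr
  map_one := by
    change map φ.toLinearMap σ (vertex ⟨1⟩) = vertex ⟨1⟩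
    rw [map_vertex, map_one]
  map_reassoc := reassoc_mapEquiv hΦ hφ

lemma mapEquiv_incl (m : M) : mapEquiv φ σ hφ (incl m) = incl (φ m) := by
  refine P.eq_of_comp (map φ.toLinearMap σ ∘ₗ incl) (incl ∘ₗ φ.toLinearMap) (fun p m hm => ?_) m
  rw [LinearMap.comp_apply, incl_eq_concat hm,
    map_concat σ.injective (fun y x m => (hφ (y, x) m).1), map_vertex, LinearMap.comp_apply]
  exact (incl_eq_concat ((hφ p m).1 hm)).symm

end PathSpace

namespace Realization

variable {C C' : Type*} [AddCommGroup C] [Module k C] [Coalgebra k C]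
  [AddCommGroup C'] [Module k C'] [Coalgebra k C'] {A : MajidData k C} {A' : MajidData k C'}

lemma isHom (R : Realization P A) : IsHom A P.H R.j where
  map_mul := R.j_mul
  map_one := by rw [R.one_eq, R.j_vtx]; rfl
  map_reassoc x y z := (R.reassoc_eq x y z).symm

/-- An isomorphism `H(M)_F ≅ H(N)` restricts to realizations whose images correspond. -/
lemma exists_isIso (R : Realization P A) (S : Realization Q A') {T : P.H.Gauge}
    {θ : PathSpace P ≃ₗc[k] PathSpace Q} (hθ : IsHom (P.H.twist T) Q.H θ) {σ : G → G}
    (hσ : ∀ g, θ (vertex ⟨g⟩) = vertex ⟨σ g⟩)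
    (hrange : LinearMap.range ((θ : PathSpace P →ₗc[k] PathSpace Q).toLinearMap ∘ₗ
      R.j.toLinearMap) = LinearMap.range S.j.toLinearMap) :
    ∃ (T' : A.Gauge) (ψ : C ≃ₗc[k] C'), (A.twist T').IsIso A' ψ ∧
      ∀ g, ψ (R.vtx g) = S.vtx (σ g) := by
  have inj : Function.Injective ((θ : PathSpace P →ₗc[k] PathSpace Q).toLinearMap ∘ₗ
      R.j.toLinearMap) := θ.injective.comp R.inj
  let e : C ≃ₗ[k] C' := (LinearEquiv.ofInjective _ inj).trans
    ((LinearEquiv.ofEq _ _ hrange).trans (LinearEquiv.ofInjective S.j.toLinearMap S.inj).symm)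
  have he : ∀ c, S.j (e c) = θ (R.j c) := fun c =>
    congrArg Subtype.val (LinearEquiv.apply_symm_apply
      (LinearEquiv.ofInjective S.j.toLinearMap S.inj) _)
  have hcomp : S.j.toLinearMap ∘ₗ e.toLinearMap =
      (θ : PathSpace P →ₗc[k] PathSpace Q).toLinearMap ∘ₗ R.j.toLinearMap := LinearMap.ext he
  let ψ : C ≃ₗc[k] C' :=
    { e with
      counit_comp := LinearMap.ext fun c => by
        change Coalgebra.counit (e c) = _
        rw [← CoalgHomClass.counit_comp_apply S.j, he, CoalgHomClass.counit_comp_apply,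
          CoalgHomClass.counit_comp_apply]
      map_comp_comul := by
        have h : TensorProduct.map S.j.toLinearMap S.j.toLinearMap ∘ₗ
            (TensorProduct.map e.toLinearMap e.toLinearMap ∘ₗ Coalgebra.comul) =
            TensorProduct.map S.j.toLinearMap S.j.toLinearMap ∘ₗ
              (Coalgebra.comul ∘ₗ e.toLinearMap) := by
          rw [← LinearMap.comp_assoc, ← TensorProduct.map_comp, hcomp, TensorProduct.map_comp,
            LinearMap.comp_assoc, R.j.map_comp_comul, ← LinearMap.comp_assoc,
            CoalgHom.map_comp_comul, LinearMap.comp_assoc, ← hcomp, ← LinearMap.comp_assoc,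
            ← LinearMap.comp_assoc, S.j.map_comp_comul]
        exact LinearMap.ext fun c => S.map_j_injective (LinearMap.congr_fun h c) }
  have hψ : ∀ c, S.j (ψ c) = θ (R.j c) := he
  have htw := R.isHom.twist T
  refine ⟨R.isHom.comap T, ψ, ⟨fun x y => S.inj ?_, S.inj ?_, fun x y z => ?_⟩, fun g => S.inj ?_⟩
  · rw [hψ, htw.map_mul, S.j_mul, hψ, hψ]
    exact hθ.map_mul _ _
  · rw [hψ, htw.map_one, S.isHom.map_one]
    exact hθ.map_one
  · rw [← htw.map_reassoc, S.reassoc_eq, hψ, hψ, hψ]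
    exact hθ.map_reassoc _ _ _
  · rw [hψ, R.j_vtx, S.j_vtx, hσ]

end Realization

namespace Bimodule

open Realization

/-- Gauge equivalent bimodules have gauge equivalent algebras `H(M)`. -/
theorem GaugeEquiv.exists_isIso_H {σ : G ≃* G} (h : P.GaugeEquiv (Q.pullback σ)) :
    ∃ (T : P.H.Gauge) (ψ : PathSpace P ≃ₗc[k] PathSpace Q), (P.H.twist T).IsIso Q.H ψ ∧
      ∀ g, ψ (P.inclH g) = Q.inclH (σ g) := by
  obtain ⟨F, hΦ, hF⟩ := h
  obtain ⟨φ, hφ, hl, hr⟩ := (P.isIso_twist_iff (Q.pullback σ) F).1 hF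
  refine P.realizationH.exists_isIso Q.realizationH (isHom_mapEquiv hΦ hφ hl hr)
    (fun g => map_vertex _ _ _) ?_
  refine (LinearMap.range_eq_top.2 ?_).trans (LinearMap.range_eq_top.2 ?_).symm
  · exact (mapEquiv φ σ hφ).surjective
  · exact Function.surjective_id

/-- Gauge equivalent bimodules have gauge equivalent algebras `B(M)`. -/
theorem GaugeEquiv.exists_isIso_B {σ : G ≃* G} (h : P.GaugeEquiv (Q.pullback σ)) :
    ∃ (T : P.B.Gauge) (ψ : P.BSpace ≃ₗc[k] Q.BSpace), (P.B.twist T).IsIso Q.B ψ ∧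
      ∀ g, ψ (P.inclB g) = Q.inclB (σ g) := by
  obtain ⟨F, hΦ, hF⟩ := h
  obtain ⟨φ, hφ, hl, hr⟩ := (P.isIso_twist_iff (Q.pullback σ) F).1 hF
  have hθ := isHom_mapEquiv hΦ hφ hl hr
  have hv : ∀ x : HopfQuiver P, mapEquiv φ σ hφ (vertex x) = vertex ⟨σ x.val⟩ := map_vertex _ _
  refine P.realizationB.exists_isIso Q.realizationB hθ (fun g => hv ⟨g⟩) (le_antisymm ?_ ?_)
  · -- The preimage of `B(N)` contains the vertices and the arrows. It is closed under the product
    -- because the product of `H(M)` is the twist by `F⁻¹` of the product of `H(M)_F`, and the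
    -- preimage is a subcoalgebra.
    let i : Q.BSpace →ₗc[k] PathSpace P :=
      ((mapEquiv φ σ hφ).symm : PathSpace Q →ₗc[k] PathSpace P).comp Q.realizationB.j
    have hi : ∀ b, mapEquiv φ σ hφ (i b) = b := fun b => CoalgEquiv.apply_symm_apply _ _
    have hmul : (P.H.twist (vertexGauge P F)).mulT ∘ₗ (Coalgebra.TensorProduct.map i i).toLinearMap
        = i.toLinearMap ∘ₗ Q.B.mulT := TensorProduct.ext' fun b d => by
      apply (mapEquiv φ σ hφ).injective
      refine (hθ.map_mul (i b) (i d)).trans ?_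
      exact (congrArg₂ (fun u v => PathSpace.mul u v) (hi b) (hi d)).trans (hi (Q.B.mul b d)).symm
    have hle : P.BSpace ≤ LinearMap.range i.toLinearMap := by
      refine sInf_le ⟨fun x => ?_, fun x y e => ?_, ?_⟩
      · refine ⟨Q.inclB (σ x.val), (mapEquiv φ σ hφ).injective ?_⟩
        exact (hi _).trans (hv x).symm
      · refine ⟨⟨incl (φ (arrow e)), Q.incl_mem_BSpace _⟩, (mapEquiv φ σ hφ).injective ?_⟩
        refine (hi _).trans ?_
        rw [← incl_arrow]
        exact (mapEquiv_incl hφ _).symm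
      · rintro _ ⟨b, rfl⟩ _ ⟨d, rfl⟩
        change (P.H.mulT ∘ₗ (Coalgebra.TensorProduct.map i i).toLinearMap) (b ⊗ₜ d) ∈ _
        rw [← convL_convR_twist_vertexGauge_mul F, ← convL_comp, ← convR_comp, hmul, comp_convR,
          comp_convL]
        exact ⟨_, rfl⟩
    rintro _ ⟨u, rfl⟩
    obtain ⟨b, hb⟩ := hle u.2
    exact ⟨b, ((congrArg (mapEquiv φ σ hφ) hb).symm.trans (hi b)).symm⟩
  · rintro _ ⟨w, rfl⟩
    refine Submodule.mem_sInf.1 w.2 _ ⟨fun x => ?_, fun x y e => ?_, ?_⟩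
    · refine ⟨P.inclB (σ.symm x.val), (hv _).trans ?_⟩
      rw [MulEquiv.apply_symm_apply]
    · refine ⟨⟨incl (φ.symm (arrow e)), P.incl_mem_BSpace _⟩, (mapEquiv_incl hφ _).trans ?_⟩
      rw [LinearEquiv.apply_symm_apply, incl_arrow]
    · rintro _ ⟨u, rfl⟩ _ ⟨v, rfl⟩
      refine ⟨(P.B.twist (P.realizationB.isHom.comap (vertexGauge P F))).mul u v, ?_⟩
      exact (congrArg (mapEquiv φ σ hφ) ((P.realizationB.isHom.twist _).map_mul u v)).trans
        (hθ.map_mul _ _)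

end Bimodule

end correspondence

/-! ### Bimodules and their collections -/

section collections

variable {k : Type*} {G : Type*} [Field k] [Group G] {Φ Φ' : Cocycle3 k G} {M N : Type*}
  [AddCommGroup M] [Module k M] [AddCommGroup N] [Module k N]

namespace Bimodule

/-- The translate `(a.m).b`. -/
def translate (P : Bimodule Φ M) (a b : G) : M →ₗ[k] M := P.ract b ∘ₗ P.lact a

lemma translate_apply (P : Bimodule Φ M) (a b : G) (m : M) :
    P.translate a b m = P.ract b (P.lact a m) := rfl

lemma conj_eq_translate (P : Bimodule Φ M) (f : G) : P.conj f = P.translate f f⁻¹ := rfl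

lemma translate_mem (P : Bimodule Φ M) (a b : G) {g : G} {v : M} (hv : v ∈ P.comp (g, 1)) :
    P.translate a b v ∈ P.comp (a * g * b, a * b) := by
  simpa [translate] using P.ract_mem (f := b) (P.lact_mem (f := a) hv)

lemma lact_translate (P : Bimodule Φ M) (f a b : G) {g : G} {v : M} (hv : v ∈ P.comp (g, 1)) :
    P.lact f (P.translate a b v) =
      (Φ f (a * g) b / Φ f a b * Φ f a g : kˣ) • P.translate (f * a) b v := by
  have h1 := P.ract_lact f b (P.lact_mem (f := a) hv)
  rw [mul_one, P.lact_lact f a hv, Φ.map_one_right, div_one, Units.smul_def, map_smul,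
    ← Units.smul_def] at h1
  rw [translate_apply, translate_apply, mul_smul, h1, smul_smul, div_mul_div_cancel, div_self',
    one_smul]

lemma ract_translate (P : Bimodule Φ M) (f a b : G) {g : G} {v : M} (hv : v ∈ P.comp (g, 1)) :
    P.ract f (P.translate a b v) =
      (Φ a b f / Φ (a * g) b f : kˣ) • P.translate a (b * f) v := by
  have h1 := P.ract_ract b f (P.lact_mem (f := a) hv)
  rw [mul_one] at h1
  exact h1

lemma translate_conj (P : Bimodule Φ M) (a b z : G) {g : G} {v : M} (hv : v ∈ P.comp (g, 1)) :
    P.translate a b (P.conj z v) =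
      (Φ a (z * g) z⁻¹ / Φ a z z⁻¹ * Φ a z g * (Φ (a * z) z⁻¹ b / Φ (a * z * g) z⁻¹ b) : kˣ) •
        P.translate (a * z) (z⁻¹ * b) v := by
  rw [translate_apply, conj_eq_translate, P.lact_translate a z z⁻¹ hv, Units.smul_def,
    map_smul, ← Units.smul_def, P.ract_translate b (a * z) z⁻¹ hv, smul_smul]

lemma lact_inv_lact (P : Bimodule Φ M) (a : G) {y x : G} {m : M} (hm : m ∈ P.comp (y, x)) :
    P.lact a (P.lact a⁻¹ m) = (Φ a a⁻¹ y / Φ a a⁻¹ x : kˣ) • m := by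
  rw [P.lact_lact a a⁻¹ hm, mul_inv_cancel, P.one_lact]

lemma ract_inv_ract (P : Bimodule Φ M) (b : G) {y x : G} {m : M} (hm : m ∈ P.comp (y, x)) :
    P.ract b (P.ract b⁻¹ m) = (Φ x b⁻¹ b / Φ y b⁻¹ b : kˣ) • m := by
  rw [P.ract_ract b⁻¹ b hm, inv_mul_cancel, P.one_ract]

lemma eq_zero_of_lact_eq_zero (P : Bimodule Φ M) {a : G} {y x : G} {m : M}
    (hm : m ∈ P.comp (y, x)) (h : P.lact a m = 0) : m = 0 := by
  have h1 := P.lact_inv_lact a⁻¹ hm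
  rw [inv_inv, h, map_zero] at h1
  exact (smul_eq_zero_iff_eq _).1 h1.symm

lemma eq_zero_of_ract_eq_zero (P : Bimodule Φ M) {b : G} {y x : G} {m : M}
    (hm : m ∈ P.comp (y, x)) (h : P.ract b m = 0) : m = 0 := by
  have h1 := P.ract_inv_ract b⁻¹ hm
  rw [inv_inv, h, map_zero] at h1
  exact (smul_eq_zero_iff_eq _).1 h1.symm

lemma eq_zero_of_translate_eq_zero (P : Bimodule Φ M) {a b g : G} {v : M}
    (hv : v ∈ P.comp (g, 1)) (h : P.translate a b v = 0) : v = 0 :=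
  P.eq_zero_of_lact_eq_zero hv (P.eq_zero_of_ract_eq_zero (P.lact_mem hv) h)

/-- Every homogeneous element is a translate of an element of degree `(g, 1)`. -/
lemma exists_translate (P : Bimodule Φ M) {a b g : G} {m : M}
    (hm : m ∈ P.comp (a * g * b, a * b)) : ∃ v ∈ P.comp (g, 1), P.translate a b v = m := by
  have h1 := P.ract_mem (f := b⁻¹) hm
  have h2 : P.lact a⁻¹ (P.ract b⁻¹ m) ∈ P.comp (g, 1) := by
    have := P.lact_mem (f := a⁻¹) h1
    simpa [mul_assoc] using this
  obtain ⟨s, hs⟩ : ∃ s : kˣ, P.translate a b (P.lact a⁻¹ (P.ract b⁻¹ m)) = s • m := by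
    refine ⟨Φ a a⁻¹ (a * g * b * b⁻¹) / Φ a a⁻¹ (a * b * b⁻¹) *
      (Φ (a * b) b⁻¹ b / Φ (a * g * b) b⁻¹ b), ?_⟩
    rw [translate_apply, P.lact_inv_lact a h1, Units.smul_def, map_smul, P.ract_inv_ract b hm,
      ← Units.smul_def, smul_smul]
  refine ⟨s⁻¹ • P.lact a⁻¹ (P.ract b⁻¹ m), ?_, ?_⟩
  · rw [Units.smul_def]
    exact Submodule.smul_mem _ _ h2
  · rw [Units.smul_def, map_smul, ← Units.smul_def, hs, inv_smul_smul]

lemma exists_eq_mul_classRep (r : ClassReps G) (p : G × G) :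
    ∃ (C : ConjClasses G) (a b : G), p = (a * r C * b, a * b) := by
  obtain ⟨y, x⟩ := p
  have h := r.2 (ConjClasses.mk (y * x⁻¹))
  obtain ⟨a, ha⟩ := isConj_iff.1 (ConjClasses.mk_eq_mk_iff_isConj.1 h)
  refine ⟨ConjClasses.mk (y * x⁻¹), a, a⁻¹ * x, Prod.ext ?_ ?_⟩
  · rw [← mul_assoc, ha, inv_mul_cancel_right]
  · rw [mul_inv_cancel_left]

/-- Two descriptions of a degree as a translate of a class representative differ by an element of
the centralizer. -/
lemma exists_centralizer (r : ClassReps G) {C C' : ConjClasses G} {a b a' b' : G}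
    (h : (a * r C * b, a * b) = (a' * r C' * b', a' * b')) :
    C = C' ∧ ∃ z ∈ Subgroup.centralizer {(r C : G)}, a' = a * z ∧ b' = z⁻¹ * b := by
  obtain ⟨h1, h2⟩ := Prod.ext_iff.1 h
  simp only at h1 h2
  have hb : b' = a'⁻¹ * a * b := by rw [mul_assoc, h2, inv_mul_cancel_left]
  have hC : (a'⁻¹ * a) * r C * (a'⁻¹ * a)⁻¹ = r C' := by
    have h3 : a * r C * b * b'⁻¹ = a' * r C' := by rw [h1, mul_inv_cancel_right]
    rw [hb] at h3
    simp only [mul_inv_rev, inv_inv, mul_assoc, mul_inv_cancel_left] at h3 ⊢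
    rw [h3, inv_mul_cancel_left]
  have hCC : C = C' := by
    have h4 := ConjClasses.mk_eq_mk_iff_isConj.2 (isConj_iff.2 ⟨_, hC⟩)
    rwa [r.2, r.2] at h4
  subst hCC
  refine ⟨rfl, a⁻¹ * a', ?_, by group, by rw [hb]; group⟩
  rw [Subgroup.mem_centralizer_singleton_iff]
  have h5 : (a'⁻¹ * a) * r C = r C * (a'⁻¹ * a) := by
    rw [← mul_inv_eq_iff_eq_mul]; exact hC
  have h6 : a⁻¹ * a' = (a'⁻¹ * a)⁻¹ := by group
  rw [h6]
  exact (Commute.inv_left (show Commute _ _ from h5)).eq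

section

variable {P : Bimodule Φ M} {Q : Bimodule Φ N} {r : ClassReps G}

/-- Maps between the members of the collections of `P` and `Q` that commute with the conjugation
actions extend to all translates. The scalars produced by moving group elements around only depend
on the cocycle, so that they agree for `P` and `Q`. -/
lemma exists_extension (e : ∀ C, P.comp (r C, 1) →ₗ[k] Q.comp (r C, 1))
    (he : ∀ C f, e C ∘ₗ (P.collection r C).ρ f = (Q.collection r C).ρ f ∘ₗ e C) :
    ∃ φ : M →ₗ[k] N, ∀ C a b (v : P.comp (r C, 1)),
      φ (P.translate a b v) = Q.translate a b (e C v) := by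
  have h1 : ∀ p : G × G, ∃ φ : M →ₗ[k] N, ∀ C a b, p = (a * r C * b, a * b) →
      ∀ v : P.comp (r C, 1), φ (P.translate a b v) = Q.translate a b (e C v) := by
    intro p
    obtain ⟨C, a, b, rfl⟩ := exists_eq_mul_classRep r p
    obtain ⟨l, hl⟩ := LinearMap.exists_leftInverse_of_injective
      (P.translate a b ∘ₗ (P.comp (r C, 1)).subtype) (LinearMap.ker_eq_bot'.2 fun v hv =>
        Subtype.ext (P.eq_zero_of_translate_eq_zero v.2 hv))
    refine ⟨Q.translate a b ∘ₗ (Q.comp (r C, 1)).subtype ∘ₗ e C ∘ₗ l, fun C' a' b' h v => ?_⟩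
    obtain ⟨rfl, z, hz, rfl, rfl⟩ := exists_centralizer r h
    have h2 : ∀ w : P.comp (r C, 1), l (P.translate a b w) = w := LinearMap.congr_fun hl
    have h3 := P.translate_conj a b z v.2
    have h4 := Q.translate_conj a b z (e C v).2
    have h5 : (e C ((P.collection r C).ρ ⟨z, hz⟩ v) : N) = Q.conj z (e C v) :=
      congrArg Subtype.val (LinearMap.congr_fun (he C ⟨z, hz⟩) v)
    have h6 : l (P.translate a b (P.conj z v)) = (P.collection r C).ρ ⟨z, hz⟩ v :=
      h2 ((P.collection r C).ρ ⟨z, hz⟩ v)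
    rw [← inv_smul_eq_iff] at h3 h4
    rw [← h3, ← h4, Units.smul_def, map_smul, Units.smul_def, ← h5, ← h6]
    rfl
  choose φ hφ using h1
  refine ⟨P.basis.constr k fun i => φ i.1 (P.basis i), fun C a b v => ?_⟩
  rw [← hφ _ C a b rfl v]
  exact P.comp_ext (fun i => by rw [Module.Basis.constr_basis]) (P.translate_mem a b v.2)

/-- Bimodules over the same cocycle are determined by their collections. -/
lemma isIso_of_collection (e : ∀ C, P.comp (r C, 1) ≃ₗ[k] Q.comp (r C, 1))
    (he : ∀ C f, (e C).toLinearMap ∘ₗ (P.collection r C).ρ f =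
      (Q.collection r C).ρ f ∘ₗ (e C).toLinearMap) : P.IsIso Q := by
  obtain ⟨φ, hφ⟩ := exists_extension (fun C => (e C).toLinearMap) he
  obtain ⟨χ, hχ⟩ := exists_extension (P := Q) (Q := P) (fun C => (e C).symm.toLinearMap)
    fun C f => LinearMap.ext fun w => by
      have := LinearMap.congr_fun (he C f) ((e C).symm w)
      simp only [LinearMap.comp_apply, LinearEquiv.coe_coe, LinearEquiv.apply_symm_apply] at this ⊢
      rw [← this, LinearEquiv.symm_apply_apply]
  have h1 : ∀ m, χ (φ m) = m := P.eq_of_comp (χ ∘ₗ φ) LinearMap.id fun p m hm => by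
    obtain ⟨C, a, b, rfl⟩ := exists_eq_mul_classRep r p
    obtain ⟨v, hv, rfl⟩ := P.exists_translate hm
    rw [LinearMap.comp_apply, hφ C a b ⟨v, hv⟩, hχ]
    simp
  have h2 : ∀ n, φ (χ n) = n := Q.eq_of_comp (φ ∘ₗ χ) LinearMap.id fun p m hm => by
    obtain ⟨C, a, b, rfl⟩ := exists_eq_mul_classRep r p
    obtain ⟨v, hv, rfl⟩ := Q.exists_translate hm
    rw [LinearMap.comp_apply, hχ C a b ⟨v, hv⟩, hφ]
    simp
  refine ⟨LinearEquiv.ofLinearMap φ χ (LinearMap.ext h2) (LinearMap.ext h1), fun p m => ?_,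
    fun f m => ?_, fun f m => ?_⟩
  · change _ ↔ φ m ∈ _
    obtain ⟨C, a, b, rfl⟩ := exists_eq_mul_classRep r p
    refine ⟨fun hm => ?_, fun hm => ?_⟩
    · obtain ⟨v, hv, rfl⟩ := P.exists_translate hm
      rw [hφ C a b ⟨v, hv⟩]
      exact Q.translate_mem a b (Subtype.property _)
    · obtain ⟨w, hw, h⟩ := Q.exists_translate hm
      rw [← h1 m, ← h, hχ C a b ⟨w, hw⟩]
      exact P.translate_mem a b (Subtype.property _)
  · refine P.eq_of_comp (φ ∘ₗ P.lact f) (Q.lact f ∘ₗ φ) (fun p m hm => ?_) m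
    obtain ⟨C, a, b, rfl⟩ := exists_eq_mul_classRep r p
    obtain ⟨v, hv, rfl⟩ := P.exists_translate hm
    rw [LinearMap.comp_apply, LinearMap.comp_apply, P.lact_translate f a b hv, Units.smul_def,
      map_smul, hφ C (f * a) b ⟨v, hv⟩, hφ C a b ⟨v, hv⟩,
      Q.lact_translate f a b (Subtype.property _), Units.smul_def]
  · refine P.eq_of_comp (φ ∘ₗ P.ract f) (Q.ract f ∘ₗ φ) (fun p m hm => ?_) m
    obtain ⟨C, a, b, rfl⟩ := exists_eq_mul_classRep r p
    obtain ⟨v, hv, rfl⟩ := P.exists_translate hm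
    rw [LinearMap.comp_apply, LinearMap.comp_apply, P.ract_translate f a b hv, Units.smul_def,
      map_smul, hφ C a (b * f) ⟨v, hv⟩, hφ C a b ⟨v, hv⟩,
      Q.ract_translate f a b (Subtype.property _), Units.smul_def]

end

/-- Conjugation in the twisted bimodule is the conjugation action rescaled by `μ^F_g`. -/
lemma conj_twist (P : Bimodule Φ M) (F : GroupGauge k G) {g : G} (f : Subgroup.centralizer {g})
    {v : M} (hv : v ∈ P.comp (g, 1)) :
    (P.twist F).conj f v = F.mu g f • P.conj f v := by
  have h1 : P.lact (f : G) v ∈ P.comp (f * g, f) := by simpa using P.lact_mem (f := (f : G)) hv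
  simp only [conj, LinearMap.comp_apply]
  rw [P.twist_lact_apply F f hv, map_smul, P.twist_ract_apply F _ h1, smul_smul, Units.smul_def,
    F.map_one_right, GroupGauge.mu]
  congr 1
  push_cast
  field_simp

theorem gaugeEquiv_iff_collection (P : Bimodule Φ M) (Q : Bimodule Φ' N) (r : ClassReps G) :
    P.GaugeEquiv Q ↔ (P.collection r).GaugeEquiv (Q.collection r) := by
  refine exists_congr fun F => and_congr_right fun hΦ => ?_
  subst hΦ
  have hcoll : ∀ C f (v : P.comp (r C, 1)), (((P.collection r).twist F C).ρ f v : M) =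
      (P.twist F).conj f v := fun C f v => (P.conj_twist F f v.2).symm
  constructor
  · rintro ⟨φ, hφ, hl, hr⟩ C
    have hmap : (P.comp (r C, 1)).map φ.toLinearMap = Q.comp (r C, 1) := by
      ext n
      refine ⟨?_, fun hn => ⟨φ.symm n, (hφ _ _).2 (by simpa using hn), by simp⟩⟩
      rintro ⟨m, hm, rfl⟩
      exact (hφ _ _).1 hm
    refine ⟨φ.ofSubmodules _ _ hmap, fun f => LinearMap.ext fun v => Subtype.ext ?_⟩
    refine (congrArg φ (hcoll C f v)).trans ?_
    change φ ((P.twist F).ract _ ((P.twist F).lact _ _)) = _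
    rw [hr, hl]
    rfl
  · intro h
    choose e he using h
    refine isIso_of_collection (P := P.twist F) (r := r) e fun C f => ?_
    exact LinearMap.ext fun v =>
      (congrArg (e C) (Subtype.ext (hcoll C f v).symm)).trans (LinearMap.congr_fun (he C f) v)

end Bimodule

lemma Collection.gaugeEquiv_iff_uniformlyProjEquiv {r : ClassReps G} {V W : ConjClasses G → Type*}
    [∀ C, AddCommGroup (V C)] [∀ C, Module k (V C)] [∀ C, AddCommGroup (W C)]
    [∀ C, Module k (W C)] (A : Collection Φ r V) (B : Collection Φ' r W) :
    A.GaugeEquiv B ↔ A.UniformlyProjEquiv B := by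
  refine exists_congr fun F => and_congr_right fun _ => forall_congr' fun C =>
    exists_congr fun φ => forall_congr' fun f => ?_
  change φ.toLinearMap ∘ₗ (F.mu (r C) f • (A C).ρ f) = _ ↔ _
  constructor
  · intro h
    ext w
    have := LinearMap.congr_fun h (φ.symm w)
    simp only [LinearMap.comp_apply, LinearMap.smul_apply, LinearEquiv.coe_coe, Units.smul_def,
      map_smul, LinearEquiv.apply_symm_apply] at this ⊢
    exact this.symm
  · intro h
    ext v
    have := LinearMap.congr_fun h (φ v)
    simp only [LinearMap.comp_apply, LinearMap.smul_apply, LinearEquiv.coe_coe, Units.smul_def,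
      map_smul, LinearEquiv.symm_apply_apply] at this ⊢
    exact this.symm

end collections

/-! ### The equivalences -/

section equivalences

variable {k : Type*} {G : Type*} [Field k] [Group G] {Φ Φ' : Cocycle3 k G} {M N : Type*}
  [AddCommGroup M] [Module k M] [AddCommGroup N] [Module k N]

namespace Bimodule

lemma gaugeEquiv_pullback_refl (P : Bimodule Φ M) (Q : Bimodule Φ' N) :
    P.GaugeEquiv (Q.pullback (MulEquiv.refl G)) ↔ P.GaugeEquiv Q := Iff.rfl

theorem gaugeEquivOver_H_iff (P : Bimodule Φ M) (Q : Bimodule Φ' N) :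
    MajidData.GaugeEquivOver P.inclH Q.inclH P.H Q.H ↔ P.GaugeEquiv Q := by
  rw [← gaugeEquiv_pullback_refl]
  refine ⟨?_, GaugeEquiv.exists_isIso_H⟩
  rintro ⟨T, ψ, hψ, h⟩
  exact Realization.gaugeEquiv_pullback (R := P.realizationH) (S := Q.realizationH) hψ h

theorem gaugeEquivOver_B_iff (P : Bimodule Φ M) (Q : Bimodule Φ' N) :
    MajidData.GaugeEquivOver P.inclB Q.inclB P.B Q.B ↔ P.GaugeEquiv Q := by
  rw [← gaugeEquiv_pullback_refl]
  refine ⟨?_, GaugeEquiv.exists_isIso_B⟩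
  rintro ⟨T, ψ, hψ, h⟩
  exact Realization.gaugeEquiv_pullback (R := P.realizationB) (S := Q.realizationB) hψ h

theorem gaugeEquiv_H_iff (P : Bimodule Φ M) (Q : Bimodule Φ' N) :
    P.H.GaugeEquiv Q.H ↔ ∃ σ : G ≃* G, P.GaugeEquiv (Q.pullback σ) := by
  constructor
  · rintro ⟨T, ψ, hψ⟩
    obtain ⟨σ, hσ⟩ := Realization.exists_mulEquiv hψ P.realizationH Q.realizationH
    exact ⟨σ, Realization.gaugeEquiv_pullback hψ hσ⟩
  · rintro ⟨σ, h⟩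
    obtain ⟨T, ψ, hψ, _⟩ := h.exists_isIso_H
    exact ⟨T, ψ, hψ⟩

theorem gaugeEquiv_B_iff (P : Bimodule Φ M) (Q : Bimodule Φ' N) :
    P.B.GaugeEquiv Q.B ↔ ∃ σ : G ≃* G, P.GaugeEquiv (Q.pullback σ) := by
  constructor
  · rintro ⟨T, ψ, hψ⟩
    obtain ⟨σ, hσ⟩ := Realization.exists_mulEquiv hψ P.realizationB Q.realizationB
    exact ⟨σ, Realization.gaugeEquiv_pullback hψ hσ⟩
  · rintro ⟨σ, h⟩
    obtain ⟨T, ψ, hψ, _⟩ := h.exists_isIso_B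
    exact ⟨T, ψ, hψ⟩

end Bimodule

end equivalences

end Majid

end


theorem theorem4p3 {k : Type*} {G : Type*} [Field k] [Group G] {Φ Φ' : Majid.Cocycle3 k G}
    {M N : Type*} [AddCommGroup M] [Module k M] [AddCommGroup N] [Module k N]
    (P : Majid.Bimodule Φ M) (Q : Majid.Bimodule Φ' N) (r : Majid.ClassReps G) :
    List.TFAE [
      Majid.MajidData.GaugeEquivOver P.inclH Q.inclH P.H Q.H,
      Majid.MajidData.GaugeEquivOver P.inclB Q.inclB P.B Q.B,
      P.GaugeEquiv Q,
      (P.collection r).GaugeEquiv (Q.collection r),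
      (P.collection r).UniformlyProjEquiv (Q.collection r)] ∧
    (P.H.GaugeEquiv Q.H ↔ ∃ σ : G ≃* G, P.GaugeEquiv (Q.pullback σ)) ∧
    (P.B.GaugeEquiv Q.B ↔ ∃ σ : G ≃* G, P.GaugeEquiv (Q.pullback σ)) := by
  refine ⟨?_, P.gaugeEquiv_H_iff Q, P.gaugeEquiv_B_iff Q⟩
  tfae_have 1 ↔ 3 := P.gaugeEquivOver_H_iff Q
  tfae_have 2 ↔ 3 := P.gaugeEquivOver_B_iff Q
  tfae_have 3 ↔ 4 := P.gaugeEquiv_iff_collection Q r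
  tfae_have 4 ↔ 5 := Majid.Collection.gaugeEquiv_iff_uniformlyProjEquiv _ _
  tfae_finish
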